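/- Let $(M,g)$ be a smooth Riemannian manifold of dimension $N$ (Hausdorff, second countable, without boundary) and let $V\in C^\infty(M)$. Let $\theta=p_i\,dq^i$ be the tautological one-form on $T^*M$, $\Omega=d\theta$ the canonical symplectic form, and $|\Omega^N|$ the associated Liouville measure, where $\Omega^N$ is the $N$-fold wedge power. Around every point of $T^*M$, in the canonical coordinates $(q^i,p_i)$ induced by a preferred chart of $M$ there, one has $|\Omega^N|=c_N\,dq^1\cdots dq^N\,dp_1\cdots dp_N$ with the constant $c_N=N!$, which depends only on $N$. Let $H(q,p)=\tfrac12|p|_g^2+V(q)$ on $T^*M$. The Hamiltonian vector field $X_H$, defined by $\Omega(X_H,\cdot)=-dH$, exists and is unique; let $\varphi_t$ be its (possibly incomplete) flow. For $E\in\mathbb R$ put $M_E=\{V<E\}$, $\mathcal M^r=\{dH\neq 0\}\subset T^*M$, $\mathcal S_E^r=\{H=E\}\cap\mathcal M^r$ and $\mathcal S_E^0=\{(q,p): H(q,p)=E,\ p\ne 0\}$. Then there is a unique Radon measure $d\Sigma_E$ on $\mathcal M^r$ such that, for every continuous $\psi$ with compact support in $\mathcal M^r$, the function $t\mapsto\int_{\{H<t\}}\psi\,|\Omega^N|$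 is differentiable at $t=E$ and $$\frac{d}{dt}\Big|_{t=E}\int_{\{H<t\}}\psi\,|\Omega^N| = \int\psi\,d\Sigma_E .$$ Let $d\sigma_1(p)\,dv(q)$ be the measure on the unit cosphere bundle determined by the Riemannian volume measure $dv$ of $M$ and the usual surface measure $d\sigma_1$ on each unit sphere $\{p\in T_q^*M:|p|_g=1\}$ of the Euclidean space $(T_q^*M,g)$. The map $\Phi(q,p)=(q,p/|p|_g)$ is a bijection of $\mathcal S_E^0$ onto $S^*M_E=\{(q,p):q\in M_E,\ |p|_g=1\}$, and on $\mathcal S_E^0$ $$d\Sigma_E=c_N\,\big(2(E-V(q))\big)^{\frac N2-1}\,\Phi^*\big(d\sigma_1(p)\,dv(q)\big),$$ where $\Phi^*m(A)=m(\Phi(A))$. Moreover $d\Sigma_E$ is concentrated on $\mathcal S_E^r$ and is a smooth measure there, that is, in local parametrizations of this hypersurface it is a nonnegative smooth function times Lebesgue measure. The flow $\varphi_t$ maps $\mathcal S_E^r$ into itself, and $d\Sigma_E$ is invariant under it: $\Sigma_E(\varphi_t(A))=\Sigma_E(A)$ for all $t\in\mathbb R$ and all Borel sets $A\subset\mathcal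 S_E^r$ on which $\varphi_t$ is defined. In particular, the measure on the right-hand side of the formula is the restriction to $\mathcal S_E^0$ of a smooth measure on $\mathcal S_E^r$ that is invariant under the flow. -/

import Mathlib

open Bundle MeasureTheory Module
open scoped Manifold ContDiff Topology

noncomputable section

/-! ### Densities, one-forms and level-set measures on a manifold without boundary -/

section General

variable {F : Type*} [NormedAddCommGroup F] [NormedSpace ℝ F]
  {K : Type*} [TopologicalSpace K] (I : ModelWithCorners ℝ F K)
  {X : Type*} [TopologicalSpace X] [ChartedSpace K X]

/-- The coordinate expression, in the chart at `c`, of a density `ρ` on `X`, where `ρ x` assigns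
a nonnegative number to each family of tangent vectors at `x` indexed like the basis `b` of the
model space: the value of `ρ` on the coordinate vector fields `∂_i` belonging to `b`. -/
def densityInChart {ι : Type*} [Fintype ι] (b : Basis ι ℝ F)
    (ρ : ∀ x : X, (ι → TangentSpace I x) → ℝ) (c : X) (y : F) : ℝ :=
  ρ ((extChartAt I c).symm y) (fun i ↦ mfderiv 𝓘(ℝ, F) I (extChartAt I c).symm y (b i))

open Classical in
/-- The measure on `X` given by integration of a density `ρ`. In each chart it is the coordinate
expression of `ρ` times the Lebesgue measure normalized by the basis `b`; globally, these
measures are put together along a countable partition of `X` into Borel sets, each contained in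
one chart domain. By the transformation rule of densities, the result depends neither on the
partition nor on the basis. -/
def densityMeasure [MeasurableSpace F] [BorelSpace F] [MeasurableSpace X]
    {ι : Type*} [Fintype ι] (b : Basis ι ℝ F)
    (ρ : ∀ x : X, (ι → TangentSpace I x) → ℝ) : Measure X :=
  if h : ∃ c : ℕ → X, ⋃ n, (chartAt K (c n)).source = Set.univ then
    Measure.sum fun n ↦
      ((b.addHaar.restrict ((extChartAt I (h.choose n)).target ∩
          (extChartAt I (h.choose n)).symm ⁻¹'
            disjointed (fun m ↦ (chartAt K (h.choose m)).source) n)).withDensity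
        (fun y ↦ ENNReal.ofReal (densityInChart I b ρ (h.choose n) y))).map
      (extChartAt I (h.choose n)).symm
  else 0

/-- The coordinate expression of a one-form in the chart at `c`. -/
def oneFormInChart (α : ∀ x : X, TangentSpace I x →L[ℝ] ℝ) (c : X) (y : F) : F →L[ℝ] ℝ :=
  (α ((extChartAt I c).symm y)).comp (mfderiv 𝓘(ℝ, F) I (extChartAt I c).symm y)

/-- The exterior derivative of a one-form: in coordinates,
`dα (u, v) = (D_u α) v - (D_v α) u`. -/
def extDerivOneForm (α : ∀ x : X, TangentSpace I x →L[ℝ] ℝ) (x : X) (u v : TangentSpace I x) :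
    ℝ :=
  let a : F → F →L[ℝ] ℝ := oneFormInChart I α x
  let D : TangentSpace I x →L[ℝ] F := mfderiv I 𝓘(ℝ, F) (extChartAt I x) x
  fderiv ℝ a (extChartAt I x x) (D u) (D v) - fderiv ℝ a (extChartAt I x x) (D v) (D u)

/-- The set of regular points of `H`, that is, of the points where `dH ≠ 0`. -/
def regularSet (H : X → ℝ) : Set X := {x | mfderiv I 𝓘(ℝ, ℝ) H x ≠ 0}

/-- The regular part of the level set `{H = E}`. -/
def regularLevel (H : X → ℝ) (E : ℝ) : Set X := {x | H x = E} ∩ regularSet I H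

/-- `ν` is the measure that `μ` and `H` induce at the level `E`: the Radon measure on the set of
regular points of `H` (regarded as a measure on `X` for which the other points form a null set)
that represents the functional `ψ ↦ d/dt (∫_{H < t} ψ dμ)` at `t = E`, on the continuous
functions `ψ` with compact support in the set of regular points. -/
structure IsLevelMeasure [MeasurableSpace X] (μ : Measure X) (H : X → ℝ) (E : ℝ)
    (ν : Measure X) : Prop where
  compl_regularSet : ν (regularSet I H)ᶜ = 0
  finite_on_compacts : ∀ C : Set X, IsCompact C → C ⊆ regularSet I H → ν C < ⊤
  hasDerivAt : ∀ ψ : X → ℝ, Continuous ψ → HasCompactSupport ψ → tsupport ψ ⊆ regularSet I H →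
    HasDerivAt (fun t : ℝ ↦ ∫ x in {x | H x < t}, ψ x ∂μ) (∫ x, ψ x ∂ν) E

/-- `ν` is a smooth measure on the `d`-dimensional embedded submanifold `S` of `X`: it is
concentrated on `S`, and near each point of `S` it is given, in some smooth local parametrization
`φ : W → S`, `W ⊆ ℝ^d` open, by a nonnegative smooth function times Lebesgue measure. -/
def IsSmoothMeasureOn [MeasurableSpace X] (d : ℕ) (S : Set X) (ν : Measure X) : Prop :=
  ν Sᶜ = 0 ∧ ∀ x ∈ S, ∃ (U : Set X) (W : Set (EuclideanSpace ℝ (Fin d)))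
    (φ : EuclideanSpace ℝ (Fin d) → X) (φinv : X → EuclideanSpace ℝ (Fin d))
    (f : EuclideanSpace ℝ (Fin d) → ℝ),
    IsOpen U ∧ x ∈ U ∧ IsOpen W ∧
    ContMDiffOn (𝓡 d) I ∞ φ W ∧
    (∀ w ∈ W, Function.Injective (mfderiv (𝓡 d) I φ w)) ∧
    φ '' W = S ∩ U ∧
    ContinuousOn φinv (S ∩ U) ∧ (∀ w ∈ W, φinv (φ w) = w) ∧
    ContDiffOn ℝ ∞ f W ∧ (∀ w ∈ W, 0 ≤ f w) ∧
    ν.restrict U =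
      ((volume.restrict W).withDensity (fun w ↦ ENNReal.ofReal (f w))).map φ

/-- The flow `φ_t` of the vector field `Y` is defined at `x`, and `φ_t x = y`. -/
def FlowsTo (Y : ∀ x : X, TangentSpace I x) (t : ℝ) (x y : X) : Prop :=
  ∃ γ : ℝ → X, γ 0 = x ∧ γ t = y ∧ IsMIntegralCurveOn (I := I) γ Y (Set.uIcc 0 t)

/-- The (possibly incomplete) flow `φ_t` of `Y` maps `S` into itself and leaves the measure `ν`
on `S` invariant: `ν (φ_t A) = ν A` for all `t` and all Borel sets `A ⊆ S` on which `φ_t` is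
defined. -/
def IsInvariantUnderFlow [MeasurableSpace X] (Y : ∀ x : X, TangentSpace I x) (S : Set X)
    (ν : Measure X) : Prop :=
  (∀ (t : ℝ) (x y : X), x ∈ S → FlowsTo I Y t x y → y ∈ S) ∧
  ∀ (t : ℝ) (A : Set X), MeasurableSet A → A ⊆ S → (∀ x ∈ A, ∃ y, FlowsTo I Y t x y) →
    ν {y | ∃ x ∈ A, FlowsTo I Y t x y} = ν A

end General

section LinearAlgebra

/-- The `N`-th exterior power `Ω^N = Ω ∧ ⋯ ∧ Ω` of an alternating bilinear form, evaluated on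
`2 N` vectors: `2^{-N} ∑_σ sign σ ∏_i Ω (w_{σ(i, 1)}, w_{σ(i, 2)})`. The argument slots are
listed as `Fin N ⊕ Fin N`; their order only affects the sign of the value. -/
def wedgePow {N : ℕ} {V : Type*} (Ω : V → V → ℝ) (w : Fin N ⊕ Fin N → V) : ℝ :=
  (1 / 2 ^ N : ℝ) * ∑ σ : Equiv.Perm (Fin N ⊕ Fin N), ((Equiv.Perm.sign σ : ℤ) : ℝ) *
    ∏ i : Fin N, Ω (w (σ (Sum.inl i))) (w (σ (Sum.inr i)))

/-- The basis of the continuous dual that is dual to `b`. -/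
def continuousDualBasis {ι : Type*} [Fintype ι] [DecidableEq ι] {V : Type*} [AddCommGroup V]
    [Module ℝ V] [TopologicalSpace V] [IsTopologicalAddGroup V] [ContinuousSMul ℝ V] [T2Space V]
    [FiniteDimensional ℝ V] (b : Basis ι ℝ V) : Basis ι ℝ (V →L[ℝ] ℝ) :=
  b.dualBasis.map LinearMap.toContinuousLinearMap

end LinearAlgebra

/-! ### The cotangent bundle -/

section Cotangent

variable (N : ℕ) (M : Type*) [TopologicalSpace M] [ChartedSpace (EuclideanSpace ℝ (Fin N)) M]

/-- The cotangent bundle `T*M` of an `N`-dimensional manifold. -/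
abbrev CotangentBundle : Type _ :=
  TotalSpace (EuclideanSpace ℝ (Fin N) →L[ℝ] ℝ) (fun q : M ↦ TangentSpace (𝓡 N) q →L[ℝ] ℝ)

/-- The model with corners of the cotangent bundle, with model space `ℝ^N × (ℝ^N)*`. -/
abbrev cotangentModel : ModelWithCorners ℝ
    (EuclideanSpace ℝ (Fin N) × (EuclideanSpace ℝ (Fin N) →L[ℝ] ℝ))
    (ModelProd (EuclideanSpace ℝ (Fin N)) (EuclideanSpace ℝ (Fin N) →L[ℝ] ℝ)) :=
  (𝓡 N).prod 𝓘(ℝ, EuclideanSpace ℝ (Fin N) →L[ℝ] ℝ)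

/-- The standard basis of `ℝ^N × (ℝ^N)*`; its Haar measure is the Lebesgue measure
`dq^1 ⋯ dq^N dp_1 ⋯ dp_N`. -/
def canonicalBasis : Basis (Fin N ⊕ Fin N) ℝ
    (EuclideanSpace ℝ (Fin N) × (EuclideanSpace ℝ (Fin N) →L[ℝ] ℝ)) :=
  (EuclideanSpace.basisFun (Fin N) ℝ).toBasis.prod
    (continuousDualBasis (EuclideanSpace.basisFun (Fin N) ℝ).toBasis)

variable [IsManifold (𝓡 N) ∞ M]

/-- The Borel `σ`-algebra of the cotangent bundle. -/
instance : MeasurableSpace (CotangentBundle N M) := borel _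

instance : BorelSpace (CotangentBundle N M) := ⟨rfl⟩

variable {N M}

/-- The tautological one-form `θ = p_i dq^i`, that is, `θ_{(q,p)} (w) = p (dπ w)`. -/
def tautologicalForm (x : CotangentBundle N M) :
    TangentSpace (cotangentModel N) x →L[ℝ] ℝ :=
  ContinuousLinearMap.comp (x.snd : TangentSpace (𝓡 N) x.proj →L[ℝ] ℝ)
    (mfderiv (cotangentModel N) (𝓡 N) (fun z : CotangentBundle N M ↦ z.proj) x)

/-- The canonical symplectic form `Ω = dθ`. -/
def symplecticForm (x : CotangentBundle N M) (u v : TangentSpace (cotangentModel N) x) : ℝ :=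
  extDerivOneForm (cotangentModel N) tautologicalForm x u v

variable (N M) in
/-- The Liouville measure `|Ω^N|`. -/
def liouvilleMeasure : Measure (CotangentBundle N M) :=
  densityMeasure (cotangentModel N) (canonicalBasis N)
    (fun x w ↦ |wedgePow (symplecticForm x) w|)

/-- `Y` is the Hamiltonian vector field of `H`, that is, `Ω (Y, ·) = - dH`. -/
def IsHamiltonianVectorField (H : CotangentBundle N M → ℝ)
    (Y : ∀ x : CotangentBundle N M, TangentSpace (cotangentModel N) x) : Prop :=
  ∀ (x : CotangentBundle N M) (w : TangentSpace (cotangentModel N) x),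
    symplecticForm x (Y x) w = - (mfderiv (cotangentModel N) 𝓘(ℝ, ℝ) H x w : ℝ)

end Cotangent

/-! ### Motion in a potential on a Riemannian manifold -/

section Riemannian

variable {N : ℕ} {M : Type*} [TopologicalSpace M] [ChartedSpace (EuclideanSpace ℝ (Fin N)) M]

instance tangentSpace_finiteDimensional (q : M) : FiniteDimensional ℝ (TangentSpace (𝓡 N) q) :=
  inferInstanceAs (FiniteDimensional ℝ (EuclideanSpace ℝ (Fin N)))

variable [RiemannianBundle (fun q : M ↦ TangentSpace (𝓡 N) q)]

/-- The dual norm `|p|_g` of a covector, that is, its operator norm with respect to `g_q`. -/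
def covectorNorm {q : M} (p : TangentSpace (𝓡 N) q →L[ℝ] ℝ) : ℝ := ‖p‖

/-- The Hamiltonian `H (q, p) = |p|_g ^ 2 / 2 + V q`. -/
def hamiltonian (V : M → ℝ) (x : CotangentBundle N M) : ℝ :=
  1 / 2 * covectorNorm x.snd ^ 2 + V x.proj

/-- The part `p ≠ 0` of the level set `{H = E}`. -/
def levelNonzero (V : M → ℝ) (E : ℝ) : Set (CotangentBundle N M) :=
  {x | hamiltonian V x = E ∧ x.snd ≠ 0}

/-- The unit cosphere bundle over `M_E = {V < E}`. -/
def cosphereBundle (V : M → ℝ) (E : ℝ) : Set (CotangentBundle N M) :=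
  {x | V x.proj < E ∧ covectorNorm x.snd = 1}

/-- The map `Φ (q, p) = (q, p / |p|)`. -/
def normalizeCovector (x : CotangentBundle N M) : CotangentBundle N M :=
  ⟨x.proj, (covectorNorm x.snd)⁻¹ • x.snd⟩

/-- The Riemannian volume measure `dv`, given by the density `√(det (g (v_i, v_j)))`. -/
def riemannianVolume [MeasurableSpace M] : Measure M :=
  densityMeasure (𝓡 N) (EuclideanSpace.basisFun (Fin N) ℝ).toBasis
    (fun q (v : Fin N → TangentSpace (𝓡 N) q) ↦
      √(Matrix.of fun i j ↦ inner ℝ (v i) (v j)).det)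

/-- The usual surface measure `dσ_1` of the unit sphere of the Euclidean space `(T*_q M, g)`,
as a measure on `T*_q M`. The Lebesgue measure of `T*_q M` is the one normalized by the dual
basis of an orthonormal basis of `T_q M`. -/
def cosphereMeasure (q : M) : Measure (TangentSpace (𝓡 N) q →L[ℝ] ℝ) :=
  ((continuousDualBasis
    (stdOrthonormalBasis ℝ (TangentSpace (𝓡 N) q)).toBasis).addHaar.toSphere).map Subtype.val

variable (N M) in
/-- The canonical measure `dσ_1(p) dv(q)` on the unit cosphere bundle, as a measure on `T*M`:
`B ↦ ∫_M σ_1 {p | |p|_g = 1, (q, p) ∈ B} dv(q)`. -/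
def cosphereBundleMeasure [IsManifold (𝓡 N) ∞ M] [MeasurableSpace M] :
    Measure (CotangentBundle N M) :=
  (riemannianVolume (N := N) (M := M)).bind fun q ↦
    (cosphereMeasure q).map fun p ↦ (⟨q, p⟩ : CotangentBundle N M)

end Riemannian

end

/-!
The level measure `Σ_E` is found by making the Hamiltonian a coordinate. If, near the support of a
test function `ψ`, the Liouville measure `μ` is the image of a measure `J ds dm` under a map `Ψ`
with `H ∘ Ψ = s`, then by Fubini `∫_{H < t} ψ dμ = ∫_{s < t} (∫ J ψ(Ψ) dm) ds`, and the
fundamental theorem of calculus gives the derivative at `t = E` as the integral of `ψ` over the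
slice `s = E` (`hasDerivAt_setIntegral_of_map_eq`). A measure with the required derivatives is
unique, since the integrals of the continuous functions with compact support determine a Radon
measure (`IsLevelMeasureOn.unique`); so level measures on the members of an open cover can be glued
(`exists_isLevelMeasureOn_of_forall`). All the claims about `Σ_E` follow from these facts, applied
in different ways.

*The Liouville measure.* In every canonical chart the tautological form is `p_i dq^i`
(`oneFormInChart_tautologicalForm`), so `Ω = dp_i ∧ dq^i` (`symplecticForm_eq`). In the expansion of
`Ω^N` on the canonical basis only the `2^N N!` permutations that respect the pairs `(q^i, p_i)`
contribute, all with the same sign, and `|Ω^N| = N! dq dp` (`wedgePow_modelSymplecticForm`,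
`map_restrict_liouvilleMeasure`). Coordinate changes are symplectic, hence have Jacobian
determinant `±1`, so that these local expressions fit together.

*Existence and smoothness.* Near a regular point, the inverse function theorem provides smooth
coordinates of which `H` is the first, in which `μ` has a smooth density
(`exists_straightening`). The slice `s = E` then parametrizes the level set, and the density
restricts to a smooth density of `Σ_E` (`exists_isLevelMeasureOn_nhds`).

*The formula.* In canonical coordinates the Lebesgue measure of the fibre `T*_q M` and the
Riemannian volume of the base have the densities `(det g_ij)^(-1/2)` and `(det g_ij)^(1/2)`, so
`μ` is `N!` times the product of `dv` and the Euclidean measures of the fibres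
(`liouvilleMeasure_eq_bind`). Polar coordinates in the fibres, and the substitution
`s = r^2 / 2 + V` (`setLIntegral_Ioi_energy`), turn `μ` on `{p ≠ 0}` into
`N! (2 (s - V))^(N/2 - 1) ds dσ_1 dv` (`restrict_liouvilleMeasure_eq_map`). The general principle
applies again, now with the unit cosphere bundle as the space of the remaining variables, and by
uniqueness the slice `s = E` is `Σ_E` (`IsLevelMeasureOn.comap_levelNonzero`). The density, which
is defined only on unit covectors and for `s > V`, is extended to a continuous function for this
purpose (`energyTest`).

*Invariance.* A homeomorphism between open sets that preserves `μ` and `H` preserves `Σ_E`, again by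
uniqueness (`IsLevelMeasureOn.measure_image_eq`). The flow preserves `H`, and it preserves `μ` by
Liouville's theorem. The latter is needed only for a Hamiltonian with compact support on a vector
space, into which `H` is cut off in a chart. There it is proved without differentiating the flow
with respect to the initial point: the flow maps are Lipschitz, and the derivative of
`∫ G ∘ φ_t` vanishes for Lipschitz `G`, since by Rademacher's theorem one may integrate by parts
and the Hamiltonian field is divergence free (`measurePreserving_hamiltonian_flow`). As the flow is
incomplete, this covers only small times near a given point. But a trajectory over `[0, t]` is
compact, so it can be followed in `n` steps of equal length for large `n`; the set of the points
that allow `n` steps is open, and a Borel set on which `φ_t` is defined is a countable disjoint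
union of Borel sets on which it is composed of such steps
(`isInvariantUnderFlow_of_isLevelMeasureOn`).
-/

open Bundle MeasureTheory Module
open scoped Manifold ContDiff Topology

noncomputable section

set_option linter.unusedSectionVars false

/-! ### Charts and measures given by densities -/

section ChartMeasure

variable {F : Type*} [NormedAddCommGroup F] [NormedSpace ℝ F]
  {K : Type*} [TopologicalSpace K] (I : ModelWithCorners ℝ F K) [I.Boundaryless]
  {X : Type*} [TopologicalSpace X] [ChartedSpace K X]

/-- The preferred chart at `c` of a manifold without boundary, as a homeomorphism from an open
subset of the manifold onto an open subset of the model vector space. -/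
def chartHomeo (c : X) : OpenPartialHomeomorph X F where
  toPartialEquiv := extChartAt I c
  open_source := isOpen_extChartAt_source c
  open_target := isOpen_extChartAt_target c
  continuousOn_toFun := continuousOn_extChartAt c
  continuousOn_invFun := continuousOn_extChartAt_symm c

@[simp] lemma chartHomeo_coe (c : X) : ⇑(chartHomeo I c) = extChartAt I c := rfl

@[simp] lemma chartHomeo_symm_coe (c : X) :
    ⇑(chartHomeo I c).symm = (extChartAt I c).symm := rfl

@[simp] lemma chartHomeo_source (c : X) : (chartHomeo I c).source = (extChartAt I c).source := rfl

@[simp] lemma chartHomeo_target (c : X) : (chartHomeo I c).target = (extChartAt I c).target := rfl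

lemma ContinuousOn.measurableSet_inter_preimage {X Y : Type*} [TopologicalSpace X]
    [TopologicalSpace Y] [MeasurableSpace X] [BorelSpace X] [MeasurableSpace Y] [BorelSpace Y]
    {f : X → Y} {s : Set X} (hf : ContinuousOn f s) (hs : MeasurableSet s) {A : Set Y}
    (hA : MeasurableSet A) : MeasurableSet (s ∩ f ⁻¹' A) := by
  have h := hs.subtype_image ((continuousOn_iff_continuous_domRestrict.1 hf).measurable hA)
  convert h using 1
  ext x
  simp [and_comm]

/-- A homeomorphism between open sets maps Borel subsets of its source to Borel sets. -/
lemma OpenPartialHomeomorph.measurableSet_image {X Y : Type*} [TopologicalSpace X]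
    [TopologicalSpace Y] [MeasurableSpace X] [BorelSpace X] [MeasurableSpace Y] [BorelSpace Y]
    (e : OpenPartialHomeomorph X Y) {A : Set X} (hA : MeasurableSet A) (hAs : A ⊆ e.source) :
    MeasurableSet (e '' A) := by
  rw [e.image_eq_target_inter_inv_preimage hAs]
  exact e.symm.continuousOn.measurableSet_inter_preimage e.open_target.measurableSet hA

lemma exists_seq_iUnion_chart_source [SecondCountableTopology X] [Nonempty X] :
    ∃ c : ℕ → X, ⋃ n, (chartAt K (c n)).source = Set.univ := by
  obtain ⟨s, hs, hsu⟩ := TopologicalSpace.countable_cover_nhds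
    (fun x : X ↦ chart_source_mem_nhds K x)
  have hne : s.Nonempty := by
    by_contra h
    rw [Set.not_nonempty_iff_eq_empty] at h
    subst h
    exact Set.empty_ne_univ (by simpa using hsu)
  obtain ⟨c, rfl⟩ := hs.exists_eq_range hne
  exact ⟨c, by simpa using hsu⟩

section CoordinateChange

variable [IsManifold I ∞ X]

lemma contDiffAt_coordChange {c c' : X} {y : F} (hy : y ∈ (extChartAt I c).target)
    (hy' : (extChartAt I c).symm y ∈ (extChartAt I c').source) :
    ContDiffAt ℝ ∞ (extChartAt I c' ∘ (extChartAt I c).symm) y := by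
  have h := contDiffWithinAt_ext_coord_change (I := I) (n := ∞) c' c
    (y := y) (by simpa [PartialEquiv.trans_source] using ⟨by simpa using hy, by simpa using hy'⟩)
  rwa [I.range_eq_univ, contDiffWithinAt_univ] at h

omit [I.Boundaryless] in
lemma mdifferentiableAt_extChartAt_of_mem {c x : X} (hx : x ∈ (extChartAt I c).source) :
    MDifferentiableAt I 𝓘(ℝ, F) (extChartAt I c) x :=
  (contMDiffAt_extChartAt' (n := ∞) (by simpa using hx)).mdifferentiableAt (by simp)

lemma contMDiffAt_extChartAt_symm {c : X} {y : F} (hy : y ∈ (extChartAt I c).target) :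
    ContMDiffAt 𝓘(ℝ, F) I ∞ (extChartAt I c).symm y :=
  (contMDiffOn_extChartAt_symm c).contMDiffAt ((isOpen_extChartAt_target c).mem_nhds hy)

lemma mdifferentiableAt_extChartAt_symm_of_mem {c : X} {y : F}
    (hy : y ∈ (extChartAt I c).target) :
    MDifferentiableAt 𝓘(ℝ, F) I (extChartAt I c).symm y :=
  (contMDiffAt_extChartAt_symm I hy).mdifferentiableAt (by simp)

lemma mfderiv_extChartAt_symm_apply_mfderiv_extChartAt {c x : X}
    (hx : x ∈ (extChartAt I c).source) (v : TangentSpace I x) :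
    mfderiv 𝓘(ℝ, F) I (extChartAt I c).symm (extChartAt I c x)
      (mfderiv I 𝓘(ℝ, F) (extChartAt I c) x v) = v := by
  have h := mfderiv_comp x (mdifferentiableAt_extChartAt_symm_of_mem I
    ((extChartAt I c).map_source hx)) (mdifferentiableAt_extChartAt_of_mem I hx)
  have h2 : mfderiv I I ((extChartAt I c).symm ∘ extChartAt I c) x = mfderiv I I id x := by
    apply Filter.EventuallyEq.mfderiv_eq
    filter_upwards [(isOpen_extChartAt_source c).mem_nhds hx] with z hz
    exact (extChartAt I c).left_inv hz
  rw [h2, mfderiv_id] at h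
  exact (DFunLike.congr_fun h v).symm

lemma mfderiv_extChartAt_apply_mfderiv_extChartAt_symm {c : X} {y : F}
    (hy : y ∈ (extChartAt I c).target) (v : F) :
    mfderiv I 𝓘(ℝ, F) (extChartAt I c) ((extChartAt I c).symm y)
      (mfderiv 𝓘(ℝ, F) I (extChartAt I c).symm y v) = v := by
  have h := mfderiv_comp y (mdifferentiableAt_extChartAt_of_mem I
    ((extChartAt I c).map_target hy)) (mdifferentiableAt_extChartAt_symm_of_mem I hy)
  have h2 : mfderiv 𝓘(ℝ, F) 𝓘(ℝ, F) (extChartAt I c ∘ (extChartAt I c).symm) y =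
      mfderiv 𝓘(ℝ, F) 𝓘(ℝ, F) id y := by
    apply Filter.EventuallyEq.mfderiv_eq
    filter_upwards [(isOpen_extChartAt_target c).mem_nhds hy] with z hz
    exact (extChartAt I c).right_inv hz
  rw [h2, mfderiv_id] at h
  exact (DFunLike.congr_fun h v).symm

lemma fderiv_coordChange_apply_mfderiv_extChartAt {c c' x : X} (hx : x ∈ (extChartAt I c).source)
    (hx' : x ∈ (extChartAt I c').source) (v : TangentSpace I x) :
    fderiv ℝ (extChartAt I c' ∘ (extChartAt I c).symm) (extChartAt I c x)
      (mfderiv I 𝓘(ℝ, F) (extChartAt I c) x v) = mfderiv I 𝓘(ℝ, F) (extChartAt I c') x v := by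
  have hd := (contDiffAt_coordChange I ((extChartAt I c).map_source hx)
    (by rwa [(extChartAt I c).left_inv hx] : _ ∈ (extChartAt I c').source)).differentiableAt
    (by simp)
  have h1 := mfderiv_comp x hd.mdifferentiableAt (mdifferentiableAt_extChartAt_of_mem I hx)
  have h2 : mfderiv I 𝓘(ℝ, F) ((extChartAt I c' ∘ (extChartAt I c).symm) ∘ extChartAt I c) x =
      mfderiv I 𝓘(ℝ, F) (extChartAt I c') x := by
    apply Filter.EventuallyEq.mfderiv_eq
    filter_upwards [(isOpen_extChartAt_source c).mem_nhds hx] with z hz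
    exact congrArg _ ((extChartAt I c).left_inv hz)
  rw [h2, mfderiv_eq_fderiv] at h1
  exact (DFunLike.congr_fun h1 v).symm

/-- The coordinate vector fields of two charts are related by the derivative of the
coordinate change. -/
lemma mfderiv_extChartAt_symm_eq_comp {c c' : X} {y : F} (hy : y ∈ (extChartAt I c).target)
    (hy' : (extChartAt I c).symm y ∈ (extChartAt I c').source) (v : F) :
    mfderiv 𝓘(ℝ, F) I (extChartAt I c).symm y v =
      mfderiv 𝓘(ℝ, F) I (extChartAt I c').symm (extChartAt I c' ((extChartAt I c).symm y))
        (fderiv ℝ (extChartAt I c' ∘ (extChartAt I c).symm) y v) := by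
  have h1 := mfderiv_comp y (mdifferentiableAt_extChartAt_of_mem I hy')
    (mdifferentiableAt_extChartAt_symm_of_mem I hy)
  rw [← mfderiv_eq_fderiv, h1]
  exact (mfderiv_extChartAt_symm_apply_mfderiv_extChartAt I hy' _).symm

end CoordinateChange

variable [FiniteDimensional ℝ F] [MeasurableSpace F] [BorelSpace F] [MeasurableSpace X]
  [BorelSpace X] [IsManifold I ∞ X]

/-- The measure of a density is given, in every chart, by the coordinate expression of the
density, provided the coordinate expressions transform by the Jacobian determinants. -/
lemma densityMeasure_apply [SecondCountableTopology X] {ι : Type*} [Fintype ι] (b : Basis ι ℝ F)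
    (ρ : ∀ x : X, (ι → TangentSpace I x) → ℝ)
    (hρ : ∀ c c' : X, ∀ y ∈ (extChartAt I c).target,
      (extChartAt I c).symm y ∈ (extChartAt I c').source →
      densityInChart I b ρ c y =
        |(fderiv ℝ (extChartAt I c' ∘ (extChartAt I c).symm) y).det| *
          densityInChart I b ρ c' (extChartAt I c' ((extChartAt I c).symm y)))
    (c : X) {A : Set X} (hA : MeasurableSet A) (hAc : A ⊆ (extChartAt I c).source) :
    densityMeasure I b ρ A =
      ∫⁻ y in extChartAt I c '' A, ENNReal.ofReal (densityInChart I b ρ c y) ∂b.addHaar := by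
  have : Nonempty X := ⟨c⟩
  have h := exists_seq_iUnion_chart_source (K := K) (X := X)
  rw [densityMeasure, dif_pos h]
  set d : ℕ → X := h.choose
  have hd : ⋃ n, (chartAt K (d n)).source = Set.univ := h.choose_spec
  -- `D n` are the pieces of the partition that the definition of `densityMeasure` uses
  set D : ℕ → Set X := disjointed (fun m ↦ (chartAt K (d m)).source) with hD
  have hDm : ∀ n, MeasurableSet (D n) := fun n ↦
    MeasurableSet.disjointed (fun m ↦ (chartAt K (d m)).open_source.measurableSet) n
  have hDs : ∀ n, D n ⊆ (extChartAt I (d n)).source := fun n ↦ by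
    rw [extChartAt_source]
    exact disjointed_subset _ n
  have hDu : ⋃ n, D n = Set.univ := by rw [hD, iUnion_disjointed, hd]
  have hDd : Pairwise (Function.onFun Disjoint D) := disjoint_disjointed _
  rw [Measure.sum_apply _ hA]
  -- the change of variables on the `n`-th piece
  have key : ∀ n, (((b.addHaar.restrict ((extChartAt I (d n)).target ∩
          (extChartAt I (d n)).symm ⁻¹' D n)).withDensity
        (fun y ↦ ENNReal.ofReal (densityInChart I b ρ (d n) y))).map
      (extChartAt I (d n)).symm) A = ∫⁻ y in extChartAt I c '' (A ∩ D n),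
        ENNReal.ofReal (densityInChart I b ρ c y) ∂b.addHaar := by
    intro n
    set T := (extChartAt I (d n)).target ∩ (extChartAt I (d n)).symm ⁻¹' D n
    have hTm : MeasurableSet T :=
      (continuousOn_extChartAt_symm (d n)).measurableSet_inter_preimage
        (isOpen_extChartAt_target (d n)).measurableSet (hDm n)
    have hae : AEMeasurable (extChartAt I (d n)).symm (b.addHaar.restrict T) :=
      ((continuousOn_extChartAt_symm (d n)).mono Set.inter_subset_left).aemeasurable hTm
    have hac := withDensity_absolutelyContinuous (b.addHaar.restrict T)
      (fun y ↦ ENNReal.ofReal (densityInChart I b ρ (d n) y))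
    have hT' : MeasurableSet (T ∩ (extChartAt I (d n)).symm ⁻¹' A) :=
      ((continuousOn_extChartAt_symm (d n)).mono
        Set.inter_subset_left).measurableSet_inter_preimage hTm hA
    rw [Measure.map_apply_of_aemeasurable (hae.mono_ac hac) hA]
    have hnull : NullMeasurableSet ((extChartAt I (d n)).symm ⁻¹' A) (b.addHaar.restrict T) :=
      hae.nullMeasurable hA
    rw [withDensity_apply₀ _ hnull, Measure.restrict_restrict₀ hnull, Set.inter_comm]
    have himg : extChartAt I c '' (A ∩ D n) = (extChartAt I c ∘ (extChartAt I (d n)).symm) ''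
        (T ∩ (extChartAt I (d n)).symm ⁻¹' A) := by
      rw [Set.image_comp]
      congr 1
      ext x
      constructor
      · rintro ⟨hxA, hxD⟩
        refine ⟨extChartAt I (d n) x, ⟨⟨(extChartAt I (d n)).map_source (hDs n hxD), ?_⟩, ?_⟩,
          (extChartAt I (d n)).left_inv (hDs n hxD)⟩
        · rwa [Set.mem_preimage, (extChartAt I (d n)).left_inv (hDs n hxD)]
        · rwa [Set.mem_preimage, (extChartAt I (d n)).left_inv (hDs n hxD)]
      · rintro ⟨y, ⟨⟨-, hyD⟩, hyA⟩, rfl⟩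
        exact ⟨hyA, hyD⟩
    rw [himg, lintegral_image_eq_lintegral_abs_det_fderiv_mul b.addHaar hT'
      (f' := fun y ↦ fderiv ℝ (extChartAt I c ∘ (extChartAt I (d n)).symm) y)]
    · refine setLIntegral_congr_fun hT' fun y hy ↦ ?_
      rw [hρ (d n) c y hy.1.1 (hAc hy.2), ENNReal.ofReal_mul (abs_nonneg _)]
      rfl
    · intro y hy
      exact ((contDiffAt_coordChange I hy.1.1
        (hAc hy.2)).differentiableAt (by simp)).hasFDerivAt.hasFDerivWithinAt
    · rintro y hy z hz hyz
      have h1 := (extChartAt I c).injOn (hAc hy.2) (hAc hz.2) hyz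
      exact (extChartAt I (d n)).symm.injOn hy.1.1 hz.1.1 h1
  simp_rw [key]
  rw [← lintegral_iUnion]
  · rw [← Set.image_iUnion, ← Set.inter_iUnion, hDu, Set.inter_univ]
  · exact fun n ↦ (chartHomeo I c).measurableSet_image (hA.inter (hDm n))
      (Set.inter_subset_left.trans hAc)
  · intro m n hmn
    refine Set.disjoint_image_image fun x hx y hy hxy ↦ ?_
    have h1 := (extChartAt I c).injOn (hAc hx.1) (hAc hy.1) hxy
    subst h1
    exact (Set.disjoint_left.1 (hDd hmn) hx.2 hy.2)

end ChartMeasure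

/-! ### Level measures: uniqueness and gluing -/

section LevelMeasure

variable {X : Type*} [TopologicalSpace X] [T2Space X] [LocallyCompactSpace X]
  [SecondCountableTopology X] [MeasurableSpace X] [BorelSpace X]

omit [T2Space X] [LocallyCompactSpace X] [SecondCountableTopology X] [BorelSpace X] in
/-- If approximations of the indicator function of `C` with values in `[0, 1]` vanish off a set of
finite measure, their integrals converge to the measure of `C`. -/
lemma tendsto_integral_of_tendsto_indicator {ν : Measure X} {C : Set X}
    (hCm : MeasurableSet C) {K : Set X} (hKm : MeasurableSet K) (hK : ν K < ⊤)
    {f : ℕ → X → ℝ} (hf : ∀ n, Measurable (f n)) (h01 : ∀ n x, f n x ∈ Set.Icc (0 : ℝ) 1)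
    (hfK : ∀ n x, x ∉ K → f n x = 0)
    (hlim : ∀ x, Filter.Tendsto (fun n ↦ f n x) Filter.atTop
      (𝓝 (C.indicator (fun _ ↦ (1 : ℝ)) x))) :
    Filter.Tendsto (fun n ↦ ∫ x, f n x ∂ν) Filter.atTop (𝓝 (ν.real C)) := by
  have h := tendsto_integral_of_dominated_convergence (μ := ν) (F := f)
    (f := C.indicator (fun _ ↦ (1 : ℝ))) (K.indicator (fun _ ↦ (1 : ℝ)))
    (fun n ↦ (hf n).aestronglyMeasurable)
    ((integrable_indicator_iff hKm).2 (integrableOn_const hK.ne))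
    (fun n ↦ Filter.Eventually.of_forall fun x ↦ ?_) (Filter.Eventually.of_forall hlim)
  · rwa [integral_indicator_const _ hCm, smul_eq_mul, mul_one] at h
  · by_cases hx : x ∈ K
    · rw [Set.indicator_of_mem hx, Real.norm_of_nonneg (h01 n x).1]
      exact (h01 n x).2
    · simp [hfK n x hx, hx]

/-- Two measures which agree and are finite on the compact subsets of an open set `U` agree
on `U`. -/
lemma Measure.restrict_eq_of_forall_isCompact {U : Set X} (hU : IsOpen U) {ν₁ ν₂ : Measure X}
    (h₁ : ∀ C, IsCompact C → C ⊆ U → ν₁ C < ⊤)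
    (hcomp : ∀ C, IsCompact C → C ⊆ U → ν₁ C = ν₂ C) : ν₁.restrict U = ν₂.restrict U := by
  have hpiece : ∀ K, IsCompact K → K ⊆ U → ν₁.restrict K = ν₂.restrict K := by
    intro K hK hKU
    have : IsFiniteMeasure (ν₁.restrict K) := ⟨by simpa using h₁ K hK hKU⟩
    refine ext_of_generate_finite {s | IsClosed s} ?_ isPiSystem_isClosed ?_ ?_
    · rw [← borel_eq_generateFrom_isClosed]; exact BorelSpace.measurable_eq
    · intro s hs
      rw [Measure.restrict_apply hs.measurableSet, Measure.restrict_apply hs.measurableSet]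
      exact hcomp _ (hK.inter_left hs) (Set.inter_subset_right.trans hKU)
    · simpa using hcomp K hK hKU
  have hK : ∀ x : U, ∃ K : Set X, IsCompact K ∧ x.1 ∈ interior K ∧ K ⊆ U := fun x ↦ by
    obtain ⟨K, hK, hxK, hKU⟩ := exists_compact_between (isCompact_singleton (x := x.1)) hU
      (Set.singleton_subset_iff.2 x.2)
    exact ⟨K, hK, hxK rfl, hKU⟩
  choose K hKc hKx hKU using hK
  obtain ⟨T, hT, hTU⟩ := TopologicalSpace.isOpen_iUnion_countable (fun x : U ↦ interior (K x))
    (fun x ↦ isOpen_interior)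
  have : Countable T := hT.to_subtype
  have hUeq : U = ⋃ i : T, K i := by
    apply Set.Subset.antisymm
    · intro x hx
      have : x ∈ ⋃ i ∈ T, interior (K i) := by
        rw [hTU]; exact Set.mem_iUnion.2 ⟨⟨x, hx⟩, hKx _⟩
      simp only [Set.mem_iUnion] at this
      obtain ⟨i, hi, hxi⟩ := this
      exact Set.mem_iUnion.2 ⟨⟨i, hi⟩, interior_subset hxi⟩
    · exact Set.iUnion_subset fun i ↦ hKU i
  rw [hUeq]
  exact Measure.restrict_iUnion_congr.2 fun i ↦ hpiece _ (hKc i) (hKU i)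

/-- Two measures which are finite on the compact subsets of an open set `U` and define the same
functional on the continuous functions with compact support in `U` agree on `U`. -/
lemma Measure.restrict_eq_of_integral_eq {U : Set X} (hU : IsOpen U) {ν₁ ν₂ : Measure X}
    (h₁ : ∀ C, IsCompact C → C ⊆ U → ν₁ C < ⊤) (h₂ : ∀ C, IsCompact C → C ⊆ U → ν₂ C < ⊤)
    (h : ∀ ψ : X → ℝ, Continuous ψ → HasCompactSupport ψ → tsupport ψ ⊆ U →
      ∫ x, ψ x ∂ν₁ = ∫ x, ψ x ∂ν₂) : ν₁.restrict U = ν₂.restrict U := by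
  -- The indicator function of a compact set `C ⊆ U` is the limit of the functions `f n`, which
  -- are approximations of it from above, cut off by `χ` to have compact support in `U`.
  refine Measure.restrict_eq_of_forall_isCompact hU h₁ fun C hC hCU ↦ ?_
  obtain ⟨K, hK, hCK, hKU⟩ := exists_compact_between hC hU hCU
  obtain ⟨χ, hχ1, hχ0, hχc, hχ⟩ := exists_continuous_one_zero_of_isCompact hC
    isOpen_interior.isClosed_compl
    (Set.disjoint_compl_right_iff_subset.2 hCK)
  set f : ℕ → X → ℝ := fun n x ↦ hC.isClosed.apprSeq n x * χ x
  have hf : ∀ n, Continuous (f n) := fun n ↦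
    (NNReal.continuous_coe.comp (hC.isClosed.apprSeq n).continuous).mul χ.continuous
  have h01 : ∀ n x, f n x ∈ Set.Icc (0 : ℝ) 1 := fun n x ↦
    ⟨mul_nonneg (NNReal.coe_nonneg _) (hχ x).1,
      mul_le_one₀ (by exact_mod_cast HasOuterApproxClosed.apprSeq_apply_le_one _ n x)
        (hχ x).1 (hχ x).2⟩
  have hfK : ∀ n x, x ∉ K → f n x = 0 := fun n x hx ↦ by
    have : χ x = 0 := hχ0 (fun hx' ↦ hx (interior_subset hx'))
    simp [f, this]
  have hlim : ∀ x, Filter.Tendsto (fun n ↦ f n x) Filter.atTop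
      (𝓝 (C.indicator (fun _ ↦ (1 : ℝ)) x)) := fun x ↦ by
    have h1 := (NNReal.tendsto_coe.2 ((tendsto_pi_nhds.1
      (HasOuterApproxClosed.tendsto_apprSeq hC.isClosed)) x)).mul_const (χ x)
    convert h1 using 2
    by_cases hx : x ∈ C
    · simp [hx, hχ1 hx]
    · simp [hx]
  have hsupp : ∀ n, tsupport (f n) ⊆ K := fun n ↦
    closure_minimal (fun x hx ↦ by_contra fun hxK ↦ hx (hfK n x hxK)) hK.isClosed
  have key : ν₁.real C = ν₂.real C := by
    refine tendsto_nhds_unique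
      (tendsto_integral_of_tendsto_indicator hC.measurableSet hK.measurableSet
        (h₁ K hK hKU) (fun n ↦ (hf n).measurable) h01 hfK hlim) ?_
    have : ∀ n, ∫ x, f n x ∂ν₁ = ∫ x, f n x ∂ν₂ := fun n ↦
      h (f n) (hf n) (HasCompactSupport.of_support_subset_isCompact hK
        (subset_tsupport _ |>.trans (hsupp n))) ((hsupp n).trans hKU)
    simp_rw [this]
    exact tendsto_integral_of_tendsto_indicator hC.measurableSet hK.measurableSet
        (h₂ K hK hKU) (fun n ↦ (hf n).measurable) h01 hfK hlim
  exact (measureReal_eq_measureReal_iff (h₁ C hC hCU).ne (h₂ C hC hCU).ne).1 key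

/-- `ν` is the measure induced by `μ` and `H` at the level `E` on the open set `U`. -/
structure IsLevelMeasureOn (μ : Measure X) (H : X → ℝ) (E : ℝ) (U : Set X) (ν : Measure X) :
    Prop where
  compl : ν Uᶜ = 0
  finite_on_compacts : ∀ C : Set X, IsCompact C → C ⊆ U → ν C < ⊤
  hasDerivAt : ∀ ψ : X → ℝ, Continuous ψ → HasCompactSupport ψ → tsupport ψ ⊆ U →
    HasDerivAt (fun t : ℝ ↦ ∫ x in {x | H x < t}, ψ x ∂μ) (∫ x, ψ x ∂ν) E

variable {μ : Measure X} {H : X → ℝ} {E : ℝ} {U V : Set X} {ν ν' : Measure X}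

lemma IsLevelMeasureOn.restrict_self (h : IsLevelMeasureOn μ H E U ν) : ν.restrict U = ν :=
  Measure.restrict_eq_self_of_ae_mem (by rw [ae_iff]; exact h.compl)

lemma IsLevelMeasureOn.unique (hU : IsOpen U) (h : IsLevelMeasureOn μ H E U ν)
    (h' : IsLevelMeasureOn μ H E U ν') : ν = ν' := by
  rw [← h.restrict_self, ← h'.restrict_self]
  exact Measure.restrict_eq_of_integral_eq hU h.finite_on_compacts h'.finite_on_compacts
    fun ψ h1 h2 h3 ↦ (h.hasDerivAt ψ h1 h2 h3).unique (h'.hasDerivAt ψ h1 h2 h3)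

lemma IsLevelMeasureOn.restrict (hV : IsOpen V) (hVU : V ⊆ U) (h : IsLevelMeasureOn μ H E U ν) :
    IsLevelMeasureOn μ H E V (ν.restrict V) where
  compl := by simp [Measure.restrict_apply hV.measurableSet.compl]
  finite_on_compacts C hC hCV := (Measure.restrict_le_self C).trans_lt
    (h.finite_on_compacts C hC (hCV.trans hVU))
  hasDerivAt ψ h1 h2 h3 := by
    rw [setIntegral_eq_integral_of_forall_compl_eq_zero
      fun x hx ↦ image_eq_zero_of_notMem_tsupport fun hx' ↦ hx (h3 hx')]
    exact h.hasDerivAt ψ h1 h2 (h3.trans hVU)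

/-- Level measures on the members of an open cover can be glued. -/
lemma exists_isLevelMeasureOn_of_forall [IsFiniteMeasureOnCompacts μ]
    (h : ∀ x ∈ U, ∃ V, IsOpen V ∧ x ∈ V ∧ V ⊆ U ∧ ∃ ν, IsLevelMeasureOn μ H E V ν) :
    ∃ ν, IsLevelMeasureOn μ H E U ν := by
  rcases U.eq_empty_or_nonempty with rfl | ⟨x₀, hx₀⟩
  · refine ⟨0, by simp, fun C hC hCU ↦ by simp, fun ψ h1 h2 h3 ↦ ?_⟩
    have : ψ = 0 := by
      ext x
      exact image_eq_zero_of_notMem_tsupport (fun hx ↦ (h3 hx).elim)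
    simpa [this] using hasDerivAt_const E (0 : ℝ)
  choose! W hWo hxW hWU m hm using h
  obtain ⟨T, hT, hTU⟩ := TopologicalSpace.isOpen_iUnion_countable (fun x : U ↦ W x)
    (fun x ↦ hWo x x.2)
  have hTne : T.Nonempty := by
    by_contra hne
    rw [Set.not_nonempty_iff_eq_empty] at hne
    have : x₀ ∈ ⋃ i : U, W i := Set.mem_iUnion.2 ⟨⟨x₀, hx₀⟩, hxW _ hx₀⟩
    rw [← hTU, hne] at this
    simp at this
  obtain ⟨c, rfl⟩ := hT.exists_eq_range hTne
  have hcov : U = ⋃ n, W (c n) := by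
    apply Set.Subset.antisymm
    · intro x hx
      have : x ∈ ⋃ i : U, W i := Set.mem_iUnion.2 ⟨⟨x, hx⟩, hxW _ hx⟩
      rw [← hTU] at this
      simpa using this
    · exact Set.iUnion_subset fun n ↦ hWU _ (c n).2
  -- the given measures, restricted to the members of a partition `D` subordinate to the cover
  set D : ℕ → Set X := disjointed fun n ↦ W (c n)
  have hDm : ∀ n, MeasurableSet (D n) := fun n ↦
    MeasurableSet.disjointed (fun m ↦ (hWo _ (c m).2).measurableSet) n
  have hDW : ∀ n, D n ⊆ W (c n) := fun n ↦ disjointed_subset _ n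
  have hDu : ⋃ n, D n = U := by rw [iUnion_disjointed, ← hcov]
  have hDd : Pairwise (Function.onFun Disjoint D) := disjoint_disjointed _
  set ν : Measure X := Measure.sum fun n ↦ (m (c n)).restrict (D n)
  -- on overlaps, the given measures agree by uniqueness
  have hcompat : ∀ x ∈ U, ∀ y ∈ U, (m x).restrict (W x ∩ W y) = (m y).restrict (W x ∩ W y) :=
    fun x hx y hy ↦ IsLevelMeasureOn.unique ((hWo x hx).inter (hWo y hy))
      ((hm x hx).restrict ((hWo x hx).inter (hWo y hy)) Set.inter_subset_left)
      ((hm y hy).restrict ((hWo x hx).inter (hWo y hy)) Set.inter_subset_right)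
  -- the glued measure restricts to the given ones
  have hνW : ∀ x ∈ U, ν.restrict (W x) = m x := by
    intro x hx
    have h1 : ∀ n, ((m (c n)).restrict (D n)).restrict (W x) = (m x).restrict (D n) := by
      intro n
      rw [Measure.restrict_restrict (hWo x hx).measurableSet]
      have h2 : W x ∩ D n ⊆ W x ∩ W (c n) := Set.inter_subset_inter_right _ (hDW n)
      rw [← Measure.restrict_restrict_of_subset h2, ← hcompat x hx _ (c n).2,
        Measure.restrict_restrict_of_subset h2, Set.inter_comm,
        ← Measure.restrict_restrict (hDm n), (hm x hx).restrict_self]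
    rw [Measure.restrict_sum _ (hWo x hx).measurableSet]
    simp_rw [h1]
    rw [← Measure.restrict_iUnion hDd hDm, hDu]
    refine Measure.restrict_eq_self_of_ae_mem ?_
    rw [ae_iff]
    exact measure_mono_null (Set.compl_subset_compl.2 (hWU x hx)) (hm x hx).compl
  have hUm : MeasurableSet U := by rw [← hDu]; exact MeasurableSet.iUnion hDm
  have hfin : ∀ C : Set X, IsCompact C → C ⊆ U → ν C < ⊤ := by
    intro C hC hCU
    refine hC.measure_lt_top_of_nhdsWithin fun x hx ↦ ?_
    obtain ⟨K, hK, hxK, hKW⟩ := exists_compact_between (isCompact_singleton (x := x))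
      (hWo x (hCU hx)) (Set.singleton_subset_iff.2 (hxW x (hCU hx)))
    refine ⟨K, mem_nhdsWithin_of_mem_nhds (mem_interior_iff_mem_nhds.1 (hxK rfl)), ?_⟩
    have : ν K = m x K := by
      rw [← hνW x (hCU hx), Measure.restrict_apply hK.measurableSet,
        Set.inter_eq_left.2 hKW]
    rw [this]
    exact (hm x (hCU hx)).finite_on_compacts K hK hKW
  refine ⟨ν, ?_, hfin, ?_⟩
  · rw [Measure.sum_apply _ hUm.compl, ENNReal.tsum_eq_zero]
    intro n
    rw [Measure.restrict_apply hUm.compl]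
    have : Uᶜ ∩ D n = ∅ := by
      rw [← Set.disjoint_iff_inter_eq_empty, Set.disjoint_compl_left_iff_subset, ← hDu]
      exact Set.subset_iUnion _ _
    simp [this]
  · intro ψ hψ hψc hψU
    -- the derivative is additive in `ψ`, which a partition of unity decomposes into functions
    -- supported in members of the cover
    obtain ⟨t, ht⟩ := IsCompact.elim_finite_subcover hψc (fun n ↦ W (c n))
      (fun n ↦ hWo _ (c n).2) (hψU.trans hcov.subset)
    obtain ⟨f, hfs, hf1, -, hfc⟩ := exists_continuous_sum_one_of_isOpen_isCompact
      (n := t.card) (t := tsupport ψ) (s := fun i ↦ W (c (t.equivFin.symm i)))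
      (fun i ↦ hWo _ (c _).2) hψc (fun x hx ↦ by
        have := ht hx
        simp only [Set.mem_iUnion] at this ⊢
        obtain ⟨n, hn, hx⟩ := this
        exact ⟨t.equivFin ⟨n, hn⟩, by simpa using hx⟩)
    set g : Fin t.card → X → ℝ := fun i x ↦ f i x * ψ x
    have hgc : ∀ i, Continuous (g i) := fun i ↦ (f i).continuous.mul hψ
    have hgs : ∀ i, HasCompactSupport (g i) := fun i ↦ (hfc i).mul_right
    have hgW : ∀ i, tsupport (g i) ⊆ W (c (t.equivFin.symm i)) := fun i ↦
      (tsupport_mul_subset_left).trans (hfs i)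
    have hgsum : ∀ x, ψ x = ∑ i, g i x := by
      intro x
      simp only [g, ← Finset.sum_mul]
      by_cases hx : x ∈ tsupport ψ
      · have := hf1 hx
        simp only [Finset.sum_apply, Pi.one_apply] at this
        simp only [this, one_mul]
      · simp [image_eq_zero_of_notMem_tsupport hx]
    have hgν : ∀ i, ∫ x, g i x ∂ν = ∫ x, g i x ∂(m (c (t.equivFin.symm i))) := by
      intro i
      rw [← hνW _ (c (t.equivFin.symm i)).2]
      exact (setIntegral_eq_integral_of_forall_compl_eq_zero
        fun x hx ↦ image_eq_zero_of_notMem_tsupport fun hx' ↦ hx (hgW i hx')).symm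
    have hgint : ∀ i, Integrable (g i) ν := fun i ↦ by
      refine (integrableOn_iff_integrable_of_support_subset (subset_tsupport _)).1 ?_
      have : IsFiniteMeasure (ν.restrict (tsupport (g i))) :=
        ⟨by simpa using hfin _ (hgs i) ((hgW i).trans (hWU _ (c _).2))⟩
      obtain ⟨B, hB⟩ := (hgs i).exists_bound_of_continuous (hgc i)
      exact Integrable.of_bound (hgc i).measurable.aestronglyMeasurable B
        (Filter.Eventually.of_forall hB)
    have hd := HasDerivAt.fun_sum (u := Finset.univ) fun i _ ↦
      (hm _ (c (t.equivFin.symm i)).2).hasDerivAt (g i) (hgc i) (hgs i) (hgW i)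
    simp_rw [hgsum]
    rw [integral_finsetSum _ fun i _ ↦ hgint i]
    simp_rw [hgν]
    refine hd.congr_of_eventuallyEq (Filter.Eventually.of_forall fun s ↦ ?_)
    exact integral_finsetSum _ fun i _ ↦
      ((hgc i).integrable_of_hasCompactSupport (hgs i)).integrableOn

end LevelMeasure

/-! ### Derivatives of integrals over sublevel sets -/

section Extension

variable {X : Type*} [TopologicalSpace X] [T2Space X] {O K : Set X} {g : X → ℝ}

lemma tsupport_indicator_subset (hK : IsCompact K) (h0 : ∀ x ∈ O, x ∉ K → g x = 0) :
    tsupport (O.indicator g) ⊆ K := by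
  refine closure_minimal (fun x hx ↦ ?_) hK.isClosed
  by_contra hxK
  by_cases hxO : x ∈ O
  · exact hx (by simp [hxO, h0 x hxO hxK])
  · exact hx (by simp [hxO])

lemma hasCompactSupport_indicator (hK : IsCompact K) (h0 : ∀ x ∈ O, x ∉ K → g x = 0) :
    HasCompactSupport (O.indicator g) :=
  HasCompactSupport.of_support_subset_isCompact hK
    ((subset_tsupport _).trans (tsupport_indicator_subset hK h0))

lemma continuous_indicator_of_isCompact (hO : IsOpen O) (hK : IsCompact K) (hKO : K ⊆ O)
    (hg : ContinuousOn g O) (h0 : ∀ x ∈ O, x ∉ K → g x = 0) : Continuous (O.indicator g) := by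
  refine continuous_of_tsupport fun x hx ↦ ?_
  have hxO := hO.mem_nhds (hKO (tsupport_indicator_subset hK h0 hx))
  refine (hg.continuousAt hxO).congr ?_
  filter_upwards [hxO] with y hy
  simp [hy]

end Extension

section LevelMeasure

variable {X : Type*} [TopologicalSpace X] [T2Space X] [LocallyCompactSpace X]
  [SecondCountableTopology X] [MeasurableSpace X] [BorelSpace X]

lemma hasDerivAt_setIntegral_Iio {k : ℝ → ℝ} (hk : Continuous k) (hki : Integrable k) (E : ℝ) :
    HasDerivAt (fun t ↦ ∫ s in Set.Iio t, k s) (k E) E := by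
  have h1 : (fun t ↦ ∫ s in Set.Iio t, k s) =
      fun t ↦ (∫ s in Set.Iic E, k s) + ∫ s in E..t, k s := by
    ext t
    rw [← integral_Iic_eq_integral_Iio, ← intervalIntegral.integral_Iic_sub_Iic
      hki.integrableOn hki.integrableOn]
    ring
  rw [h1]
  exact (intervalIntegral.integral_hasDerivAt_right (hk.intervalIntegrable _ _)
    (hk.stronglyMeasurableAtFilter _ _) hk.continuousAt).const_add _

/-- The derivative of `∫_{H < t} ψ dμ` if `μ` is, on an open set containing the support of `ψ`, the
image of a measure `J ds dm` under a map `Ψ` with `H (Ψ (s, z)) = s`. It is required that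
`ψ ∘ Ψ · J` agree almost everywhere with a continuous function `G` with compact support. -/
lemma hasDerivAt_setIntegral_of_map_eq {Z : Type*} [TopologicalSpace Z] [LocallyCompactSpace Z]
    [SecondCountableTopology Z] [MeasurableSpace Z] [BorelSpace Z] {m : Measure Z}
    [IsFiniteMeasureOnCompacts m] {μ : Measure X} {H : X → ℝ} (hH : Measurable H) {U : Set X}
    {W : Set (ℝ × Z)} (hW : MeasurableSet W) {Ψ : ℝ × Z → X}
    {J : ℝ × Z → ℝ} (hΨ : AEMeasurable Ψ ((volume.prod m).restrict W))
    (hJ : AEMeasurable J ((volume.prod m).restrict W)) (hJ0 : ∀ w ∈ W, 0 ≤ J w)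
    (hHΨ : ∀ w ∈ W, H (Ψ w) = w.1)
    (hμ : μ.restrict U =
      (((volume.prod m).restrict W).withDensity fun w ↦ ENNReal.ofReal (J w)).map Ψ)
    {ψ : X → ℝ} (hψ : Measurable ψ) (hψU : ∀ x ∉ U, ψ x = 0)
    {G : ℝ × Z → ℝ} (hG : Continuous G) (hGc : HasCompactSupport G)
    (hGψ : G =ᵐ[volume.prod m] W.indicator fun w ↦ J w * ψ (Ψ w)) (E : ℝ) :
    HasDerivAt (fun t ↦ ∫ x in {x | H x < t}, ψ x ∂μ) (∫ z, G (E, z) ∂m) E := by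
  have : SigmaFinite m := inferInstance
  have hGi : Integrable G (volume.prod m) := hG.integrable_of_hasCompactSupport hGc
  set k : ℝ → ℝ := fun s ↦ ∫ z, G (s, z) ∂m with hk
  have hkc : Continuous k := by
    have hS : IsCompact (Prod.snd '' tsupport G) := hGc.image continuous_snd
    have h1 := continuous_parametric_integral_of_continuous (μ := m)
      (f := fun s z ↦ G (s, z)) (by simpa [Function.uncurry_def] using hG) hS
    convert h1 using 2 with s
    refine (setIntegral_eq_integral_of_forall_compl_eq_zero fun z hz ↦ ?_).symm
    exact image_eq_zero_of_notMem_tsupport fun h ↦ hz ⟨_, h, rfl⟩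
  have hki : Integrable k := hGi.integral_prod_left
  -- pull back under `Ψ`, where `H < t` becomes `s < t`, and apply Fubini
  have hmain : (fun t ↦ ∫ x in {x | H x < t}, ψ x ∂μ) = fun t ↦ ∫ s in Set.Iio t, k s := by
    ext t
    have hHt : MeasurableSet {x | H x < t} := measurableSet_lt hH measurable_const
    have hgm : Measurable ({x | H x < t}.indicator ψ) := hψ.indicator hHt
    have hac := withDensity_absolutelyContinuous ((volume.prod m).restrict W)
      (fun w ↦ ENNReal.ofReal (J w))
    calc ∫ x in {x | H x < t}, ψ x ∂μ = ∫ x, {x | H x < t}.indicator ψ x ∂μ :=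
          (integral_indicator hHt).symm
      _ = ∫ x in U, {x | H x < t}.indicator ψ x ∂μ :=
          (setIntegral_eq_integral_of_forall_compl_eq_zero fun x hx ↦ by
            simp [Set.indicator_apply, hψU x hx]).symm
      _ = ∫ w in W, J w * {x | H x < t}.indicator ψ (Ψ w) ∂(volume.prod m) := by
          rw [hμ, integral_map (hΨ.mono_ac hac) hgm.aestronglyMeasurable,
            integral_withDensity_eq_integral_toReal_smul₀ hJ.ennreal_ofReal
              (Filter.Eventually.of_forall fun _ ↦ ENNReal.ofReal_lt_top)]
          refine setIntegral_congr_fun hW fun w hw ↦ ?_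
          simp [ENNReal.toReal_ofReal (hJ0 w hw)]
      _ = ∫ w, W.indicator (fun w ↦ J w * {x | H x < t}.indicator ψ (Ψ w)) w
            ∂(volume.prod m) := (integral_indicator hW).symm
      _ = ∫ w, (Set.Iio t ×ˢ Set.univ).indicator G w ∂(volume.prod m) := by
          refine integral_congr_ae ?_
          filter_upwards [hGψ] with w hw
          by_cases hwW : w ∈ W
          · by_cases hwt : w.1 < t
            · simp [Set.indicator_apply, hwW, hwt, hw, hHΨ w hwW]
            · simp [Set.indicator_apply, hwW, hwt, hHΨ w hwW]
          · by_cases hwt : w.1 < t <;> simp [Set.indicator_apply, hwW, hwt, hw]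
      _ = ∫ w in Set.Iio t ×ˢ Set.univ, G w ∂(volume.prod m) :=
          integral_indicator (measurableSet_Iio.prod MeasurableSet.univ)
      _ = ∫ s in Set.Iio t, k s := by
          rw [setIntegral_prod _ hGi.integrableOn]
          simp [hk]
  rw [hmain]
  exact hasDerivAt_setIntegral_Iio hkc hki E

/-- A homeomorphism between open sets which preserves `μ` and `H` preserves the level measure. -/
lemma IsLevelMeasureOn.measure_image_eq {μ : Measure X} {H : X → ℝ} (hHm : Measurable H) {E : ℝ}
    {R : Set X}
    {ν : Measure X} (hν : IsLevelMeasureOn μ H E R ν) (f : OpenPartialHomeomorph X X)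
    (hf₁ : f.source ⊆ R) (hf₂ : f.target ⊆ R) (hH : ∀ x ∈ f.source, H (f x) = H x)
    (hμ : ∀ A ⊆ f.source, MeasurableSet A → μ (f '' A) = μ A) {A : Set X} (hA : MeasurableSet A)
    (hAf : A ⊆ f.source) : ν (f '' A) = ν A := by
  have hsm := f.open_source.measurableSet
  have htm := f.open_target.measurableSet
  have hae : ∀ m : Measure X, AEMeasurable f (m.restrict f.source) :=
    fun m ↦ f.continuousOn.aemeasurable hsm
  have hmapapp : ∀ (m : Measure X) (B : Set X), MeasurableSet B →
      ((m.restrict f.source).map f) B = m (f.source ∩ f ⁻¹' B) := fun m B hB ↦ by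
    rw [Measure.map_apply_of_aemeasurable (hae m) hB,
      Measure.restrict_apply₀ ((hae m).nullMeasurable hB), Set.inter_comm]
  have hμmap : (μ.restrict f.source).map f = μ.restrict f.target := by
    ext B hB
    rw [hmapapp μ B hB, Measure.restrict_apply hB,
      ← hμ _ Set.inter_subset_left (f.continuousOn.measurableSet_inter_preimage hsm hB),
      Set.inter_comm B, f.image_source_inter_eq']
    congr 1
    ext y
    constructor
    · rintro ⟨hy, hyB⟩
      exact ⟨hy, by simpa [f.right_inv hy] using hyB⟩
    · rintro ⟨hy, hyB⟩
      exact ⟨hy, by simpa [f.right_inv hy] using hyB⟩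
  -- the image of `ν` under `f` is a level measure on `f.target`, hence equal to `ν` there
  have hlev : IsLevelMeasureOn μ H E f.target ((ν.restrict f.source).map f) := by
    refine ⟨?_, ?_, ?_⟩
    · rw [hmapapp ν _ htm.compl]
      have : f.source ∩ f ⁻¹' f.targetᶜ = ∅ := by
        ext x
        simp only [Set.mem_inter_iff, Set.mem_preimage, Set.mem_compl_iff, Set.mem_empty_iff_false,
          iff_false, not_and, not_not]
        exact fun hx ↦ f.map_source hx
      rw [this, measure_empty]
    · intro C hC hCt
      rw [hmapapp ν C hC.measurableSet, ← f.symm_image_eq_source_inter_preimage hCt]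
      exact hν.finite_on_compacts _ (hC.image_of_continuousOn (f.continuousOn_symm.mono hCt))
        ((Set.image_mono hCt).trans (f.symm_image_target_eq_source.subset.trans hf₁))
    · intro ψ hψ hψc hψt
      have hK : IsCompact (f.symm '' tsupport ψ) :=
        hψc.image_of_continuousOn (f.continuousOn_symm.mono hψt)
      have hKs : f.symm '' tsupport ψ ⊆ f.source :=
        (Set.image_mono hψt).trans f.symm_image_target_eq_source.subset
      have h0 : ∀ x ∈ f.source, x ∉ f.symm '' tsupport ψ → (ψ ∘ f) x = 0 := by
        intro x hx hxK
        exact image_eq_zero_of_notMem_tsupport (f := ψ) fun h ↦ hxK ⟨f x, h, f.left_inv hx⟩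
      have hd := hν.hasDerivAt (f.source.indicator (ψ ∘ f))
        (continuous_indicator_of_isCompact f.open_source hK hKs
          (hψ.comp_continuousOn f.continuousOn) h0)
        (hasCompactSupport_indicator hK h0)
        ((tsupport_indicator_subset hK h0).trans (hKs.trans hf₁))
      rw [integral_indicator hsm] at hd
      rw [integral_map (hae ν) hψ.measurable.aestronglyMeasurable]
      refine hd.congr_of_eventuallyEq (Filter.Eventually.of_forall fun t ↦ ?_)
      have hHt : MeasurableSet {x | H x < t} := measurableSet_lt hHm measurable_const
      have hgm : Measurable ({x | H x < t}.indicator ψ) := hψ.measurable.indicator hHt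
      calc ∫ x in {x | H x < t}, ψ x ∂μ = ∫ x, {x | H x < t}.indicator ψ x ∂μ :=
            (integral_indicator hHt).symm
        _ = ∫ x in f.target, {x | H x < t}.indicator ψ x ∂μ :=
            (setIntegral_eq_integral_of_forall_compl_eq_zero fun x hx ↦ by
              simp [Set.indicator_apply,
                image_eq_zero_of_notMem_tsupport fun h ↦ hx (hψt h)]).symm
        _ = ∫ x in f.source, {x | H x < t}.indicator ψ (f x) ∂μ := by
            rw [← hμmap, integral_map (hae μ) hgm.aestronglyMeasurable]
        _ = ∫ x in f.source, {x | H x < t}.indicator (f.source.indicator (ψ ∘ f)) x ∂μ := by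
            refine setIntegral_congr_fun hsm fun x hx ↦ ?_
            simp [Set.indicator_apply, hx, hH x hx]
        _ = ∫ x, {x | H x < t}.indicator (f.source.indicator (ψ ∘ f)) x ∂μ :=
            setIntegral_eq_integral_of_forall_compl_eq_zero fun x hx ↦ by
              simp [Set.indicator_apply, hx]
        _ = ∫ x in {x | H x < t}, f.source.indicator (ψ ∘ f) x ∂μ := integral_indicator hHt
  have heq := (hν.restrict f.open_target hf₂).unique f.open_target hlev
  have hAm := f.measurableSet_image hA hAf
  have h1 : ν (f '' A) = (ν.restrict f.target) (f '' A) := by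
    rw [Measure.restrict_apply hAm, Set.inter_eq_left.2]
    exact (Set.image_mono hAf).trans f.image_source_eq_target.subset
  rw [h1, heq, hmapapp ν _ hAm]
  congr 1
  ext x
  constructor
  · rintro ⟨hx, y, hy, hxy⟩
    rwa [← f.injOn (hAf hy) hx hxy]
  · exact fun hx ↦ ⟨hAf hx, x, hx, rfl⟩

end LevelMeasure

/-! ### Straightening a function near a regular point -/

section Straightening

variable {F : Type*} [NormedAddCommGroup F] [NormedSpace ℝ F] [FiniteDimensional ℝ F]

lemma contDiff_det : ContDiff ℝ ∞ (fun A : F →L[ℝ] F ↦ A.det) := by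
  let b := Module.finBasis ℝ F
  have h : (fun A : F →L[ℝ] F ↦ A.det) =
      fun A : F →L[ℝ] F ↦ ∑ σ : Equiv.Perm (Fin (finrank ℝ F)), ((Equiv.Perm.sign σ : ℤ) : ℝ) *
        ∏ i, LinearMap.toMatrix b b (A : F →ₗ[ℝ] F) (σ i) i := by
    ext A
    rw [ContinuousLinearMap.det, ← LinearMap.det_toMatrix b, Matrix.det_apply']
  rw [h]
  refine ContDiff.sum fun σ _ ↦ contDiff_const.mul (contDiff_prod fun i _ ↦ ?_)
  simp only [LinearMap.toMatrix_apply]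
  have h1 : ContDiff ℝ ∞ fun A : F →L[ℝ] F ↦
      (b.coord (σ i)).toContinuousLinearMap (A (b i)) :=
    (ContinuousLinearMap.contDiff _).comp (contDiff_id.clm_apply contDiff_const)
  exact h1

/-- A nonzero linear form is the first component of some linear coordinate system. -/
lemma exists_continuousLinearEquiv_fst_eq {d : ℕ} (hd : finrank ℝ F = d + 1) {φ : F →L[ℝ] ℝ}
    (hφ : φ ≠ 0) : ∃ A : F ≃L[ℝ] ℝ × EuclideanSpace ℝ (Fin d), ∀ y, (A y).1 = φ y := by
  obtain ⟨v, hv⟩ : ∃ v, φ v = 1 := by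
    obtain ⟨w, hw⟩ := DFunLike.ne_iff.1 hφ
    exact ⟨(φ w)⁻¹ • w, by rw [map_smul, smul_eq_mul, inv_mul_cancel₀ hw]⟩
  have hker : finrank ℝ φ.ker = d := by
    have h1 := (φ : F →ₗ[ℝ] ℝ).finrank_range_add_finrank_ker
    have h2 : LinearMap.range (φ : F →ₗ[ℝ] ℝ) = ⊤ :=
      LinearMap.range_eq_top.2 fun s ↦ ⟨s • v, by simp [hv]⟩
    rw [h2, finrank_top, finrank_self, hd] at h1
    have : finrank ℝ (LinearMap.ker (φ : F →ₗ[ℝ] ℝ)) = d := by omega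
    exact this
  let u : φ.ker ≃ₗ[ℝ] EuclideanSpace ℝ (Fin d) :=
    LinearEquiv.ofFinrankEq _ _ (by rw [hker, finrank_euclideanSpace_fin])
  let A : F ≃ₗ[ℝ] ℝ × EuclideanSpace ℝ (Fin d) :=
    { toFun := fun y ↦ (φ y, u ⟨y - φ y • v, by simp [hv]⟩)
      map_add' := fun x y ↦ by
        ext1
        · simp
        · rw [Prod.snd_add, ← map_add]
          refine congrArg u (Subtype.ext ?_)
          simp only [map_add, Submodule.coe_add]
          module
      map_smul' := fun c y ↦ by
        ext1
        · simp
        · rw [RingHom.id_apply, Prod.smul_snd]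
          refine Eq.trans (congrArg u (Subtype.ext ?_)) (map_smul u c _)
          simp only [map_smul, smul_eq_mul, Submodule.coe_smul]
          module
      invFun := fun w ↦ w.1 • v + u.symm w.2
      left_inv := fun y ↦ by simp
      right_inv := fun w ↦ by
        have h0 : φ (u.symm w.2 : F) = 0 := (u.symm w.2).2
        ext1
        · simp [hv, h0]
        · simp [hv, h0] }
  exact ⟨A.toContinuousLinearEquiv, fun y ↦ rfl⟩

variable [MeasurableSpace F] [BorelSpace F]

/-- Near a point where the derivative of a smooth function `h` does not vanish, `h` is the first
coordinate of a smooth coordinate system, in which Haar measure has a positive smooth density. -/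
lemma exists_straightening {d : ℕ} (hd : finrank ℝ F = d + 1) (m : Measure F)
    [m.IsAddHaarMeasure] {h : F → ℝ} {T : Set F} (hT : IsOpen T) (hh : ContDiffOn ℝ ∞ h T)
    {y₀ : F} (hy₀ : y₀ ∈ T) (hne : fderiv ℝ h y₀ ≠ 0) :
    ∃ (e : OpenPartialHomeomorph F (ℝ × EuclideanSpace ℝ (Fin d)))
      (J : ℝ × EuclideanSpace ℝ (Fin d) → ℝ),
      y₀ ∈ e.source ∧ e.source ⊆ T ∧ (∀ y ∈ e.source, (e y).1 = h y) ∧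
      (∀ w ∈ e.target, ContDiffAt ℝ ∞ e.symm w) ∧
      (∀ w ∈ e.target, Function.Injective (fderiv ℝ e.symm w)) ∧
      ContDiffOn ℝ ∞ J e.target ∧ (∀ w, 0 ≤ J w) ∧
      ∀ A ⊆ e.source, MeasurableSet A → m A = ∫⁻ w in e '' A, ENNReal.ofReal (J w) := by
  obtain ⟨A, hA⟩ := exists_continuousLinearEquiv_fst_eq hd hne
  -- replace the first of the linear coordinates `A` by `h`; the derivative at `y₀` does not change
  let G : F → ℝ × EuclideanSpace ℝ (Fin d) := fun y ↦ (h y, (A y).2)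
  have hG : ∀ y ∈ T, ContDiffAt ℝ ∞ G y := fun y hy ↦
    (hh.contDiffAt (hT.mem_nhds hy)).prodMk (A.contDiff.snd.contDiffAt)
  have hG₀ : HasFDerivAt G (A : F →L[ℝ] ℝ × EuclideanSpace ℝ (Fin d)) y₀ := by
    have h1 := ((hh.contDiffAt (hT.mem_nhds hy₀)).differentiableAt (by simp)).hasFDerivAt.prodMk
      (((ContinuousLinearMap.snd ℝ ℝ (EuclideanSpace ℝ (Fin d))).comp
        (A : F →L[ℝ] ℝ × EuclideanSpace ℝ (Fin d))).hasFDerivAt (x := y₀))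
    have h2 : (A : F →L[ℝ] ℝ × EuclideanSpace ℝ (Fin d)) = (fderiv ℝ h y₀).prod
        ((ContinuousLinearMap.snd ℝ ℝ (EuclideanSpace ℝ (Fin d))).comp
          (A : F →L[ℝ] ℝ × EuclideanSpace ℝ (Fin d))) := by
      ext1 v
      exact Prod.ext (hA v) rfl
    rw [h2]
    exact h1
  let e₀ := (hG y₀ hy₀).toOpenPartialHomeomorph G hG₀ (by simp)
  have he₀ : ⇑e₀ = G := rfl
  -- restrict to the open set where the derivative is invertible
  have hGc : ContinuousOn (fderiv ℝ G) T :=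
    ContDiffOn.continuousOn_fderiv_of_isOpen (fun y hy ↦ (hG y hy).contDiffWithinAt) hT (by simp)
  let S : Set F := T ∩ fderiv ℝ G ⁻¹'
    Set.range ((↑) : (F ≃L[ℝ] ℝ × EuclideanSpace ℝ (Fin d)) →
      F →L[ℝ] ℝ × EuclideanSpace ℝ (Fin d))
  have hS : IsOpen S := hGc.isOpen_inter_preimage hT ContinuousLinearEquiv.isOpen
  let e := e₀.restrOpen S hS
  have hes : e.source = e₀.source ∩ S := e₀.restrOpen_source S hS
  have heG : ∀ y, e y = G y := fun y ↦ rfl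
  have hsymm : ∀ w ∈ e.target, ContDiffAt ℝ ∞ e.symm w ∧
      Function.Injective (fderiv ℝ e.symm w) := by
    intro w hw
    have hmem : e.symm w ∈ e.source := e.map_target hw
    rw [hes] at hmem
    obtain ⟨L, hL⟩ := hmem.2.2
    have hd : HasFDerivAt e (L : F →L[ℝ] ℝ × EuclideanSpace ℝ (Fin d)) (e.symm w) := by
      rw [hL]
      exact ((hG _ hmem.2.1).differentiableAt (by simp)).hasFDerivAt
    refine ⟨e.contDiffAt_symm hw hd (hG _ hmem.2.1), ?_⟩
    rw [(e.hasFDerivAt_symm hw hd).fderiv]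
    exact L.symm.injective
  -- the Jacobian determinant, read in the linear coordinates
  let τ : ℝ × EuclideanSpace ℝ (Fin d) → ℝ × EuclideanSpace ℝ (Fin d) := fun w ↦ A (e.symm w)
  have hτ : ∀ w ∈ e.target, ContDiffAt ℝ ∞ τ w := fun w hw ↦
    A.contDiff.contDiffAt.comp w (hsymm w hw).1
  have hτd : ∀ w ∈ e.target, fderiv ℝ τ w =
      (A : F →L[ℝ] ℝ × EuclideanSpace ℝ (Fin d)).comp (fderiv ℝ e.symm w) := fun w hw ↦
    ((A : F →L[ℝ] ℝ × EuclideanSpace ℝ (Fin d)).hasFDerivAt.comp w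
      ((hsymm w hw).1.differentiableAt (by simp)).hasFDerivAt).fderiv
  have hdet : ∀ w ∈ e.target, (fderiv ℝ τ w).det ≠ 0 := by
    intro w hw
    have hinj : Function.Injective (fderiv ℝ τ w) := by
      rw [hτd w hw]
      exact A.injective.comp (hsymm w hw).2
    exact (LinearMap.bot_lt_ker_of_det_eq_zero.mt
      (by rw [LinearMap.ker_eq_bot.2 hinj]; exact lt_irrefl _))
  have : (volume : Measure (ℝ × EuclideanSpace ℝ (Fin d))).IsAddHaarMeasure :=
    Measure.prod.instIsAddHaarMeasure _ _
  -- in the linear coordinates, the given Haar measure is a multiple of Lebesgue measure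
  let κ := (m.map A).addHaarScalarFactor volume
  have hmA : m.map A = κ • volume := by
    have : (m.map A).IsAddHaarMeasure := A.isAddHaarMeasure_map m
    exact Measure.isAddLeftInvariant_eq_smul _ _
  refine ⟨e, fun w ↦ κ * |(fderiv ℝ τ w).det|, ?_, ?_, ?_, fun w hw ↦ (hsymm w hw).1,
    fun w hw ↦ (hsymm w hw).2, ?_, fun w ↦ by positivity, ?_⟩
  · rw [hes]
    refine ⟨(hG y₀ hy₀).mem_toOpenPartialHomeomorph_source hG₀ (by simp), hy₀, A, ?_⟩
    exact hG₀.fderiv.symm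
  · rw [hes]
    exact Set.inter_subset_right.trans Set.inter_subset_left
  · intro y hy
    rfl
  · intro w hw
    refine ContDiffAt.contDiffWithinAt (contDiffAt_const.mul ?_)
    refine (contDiffAt_abs (hdet w hw)).comp w (contDiff_det.contDiffAt.comp w ?_)
    exact (hτ w hw).fderiv_right (by simp)
  · intro B hB hBm
    have hτinj : Set.InjOn τ e.target := fun x hx y hy hxy ↦ e.symm.injOn hx hy (A.injective hxy)
    have hBt : e '' B ⊆ e.target := (Set.image_mono hB).trans e.image_source_eq_target.subset
    have heB : MeasurableSet (e '' B) := e.measurableSet_image hBm hB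
    have h1 : A '' B = τ '' (e '' B) := by
      rw [Set.image_image]
      refine Set.image_congr fun y hy ↦ ?_
      simp [τ, e.left_inv (hB hy)]
    have h2 : m B = (m.map A) (A '' B) := by
      exact ((A.toHomeomorph.measurableEmbedding.map_apply m (A '' B)).trans
        (congrArg m (Set.preimage_image_eq _ A.injective))).symm
    rw [h2, hmA, h1, Measure.smul_apply, ← lintegral_abs_det_fderiv_eq_addHaar_image volume heB
      (fun w hw ↦ ((hτ w (hBt hw)).differentiableAt (by simp)).hasFDerivAt.hasFDerivWithinAt)
      (hτinj.mono hBt)]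
    simp_rw [ENNReal.ofReal_mul (NNReal.coe_nonneg κ), ENNReal.ofReal_coe_nnreal]
    rw [lintegral_const_mul' _ _ ENNReal.coe_ne_top]
    rfl

end Straightening

/-! ### Local existence of level measures -/

section Manifold

variable {F : Type*} [NormedAddCommGroup F] [NormedSpace ℝ F] [FiniteDimensional ℝ F]
  {K : Type*} [TopologicalSpace K] (I : ModelWithCorners ℝ F K) [I.Boundaryless]
  {X : Type*} [TopologicalSpace X] [ChartedSpace K X] [IsManifold I ∞ X]

variable {I} in
lemma contDiffOn_comp_extChartAt_symm {H : X → ℝ} (hH : ContMDiff I 𝓘(ℝ, ℝ) ∞ H) (c : X) :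
    ContDiffOn ℝ ∞ (H ∘ (extChartAt I c).symm) (extChartAt I c).target := fun y hy ↦
  (contMDiffAt_iff_contDiffAt.1
    (hH.contMDiffAt.comp y (contMDiffAt_extChartAt_symm I hy))).contDiffWithinAt

lemma mfderiv_extChartAt_symm_injective {c : X} {y : F} (hy : y ∈ (extChartAt I c).target) :
    Function.Injective (mfderiv 𝓘(ℝ, F) I (extChartAt I c).symm y) :=
  Function.LeftInverse.injective
    (mfderiv_extChartAt_apply_mfderiv_extChartAt_symm I hy)

variable {I} in
lemma fderiv_comp_extChartAt_symm {H : X → ℝ} (hH : ContMDiff I 𝓘(ℝ, ℝ) ∞ H) {c : X} {y : F}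
    (hy : y ∈ (extChartAt I c).target) (v : F) :
    fderiv ℝ (H ∘ (extChartAt I c).symm) y v =
      (mfderiv I 𝓘(ℝ, ℝ) H ((extChartAt I c).symm y)
        (mfderiv 𝓘(ℝ, F) I (extChartAt I c).symm y v) : ℝ) := by
  have h := mfderiv_comp y (hH.contMDiffAt.mdifferentiableAt (by simp))
    (mdifferentiableAt_extChartAt_symm_of_mem I hy)
  rw [← mfderiv_eq_fderiv, h]
  rfl

variable {I} in
/-- The derivative of a function along a tangent vector, in coordinates. -/
lemma mfderiv_apply_eq_fderiv {H : X → ℝ} (hH : ContMDiff I 𝓘(ℝ, ℝ) ∞ H) {c x : X}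
    (hx : x ∈ (extChartAt I c).source) (v : TangentSpace I x) :
    (mfderiv I 𝓘(ℝ, ℝ) H x v : ℝ) = fderiv ℝ (H ∘ (extChartAt I c).symm) (extChartAt I c x)
      (mfderiv I 𝓘(ℝ, F) (extChartAt I c) x v) := by
  have hd : DifferentiableAt ℝ (H ∘ (extChartAt I c).symm) (extChartAt I c x) :=
    ((contDiffOn_comp_extChartAt_symm hH c).contDiffAt
      ((isOpen_extChartAt_target c).mem_nhds ((extChartAt I c).map_source hx))).differentiableAt
      (by simp)
  have h1 := mfderiv_comp x hd.mdifferentiableAt (mdifferentiableAt_extChartAt_of_mem I hx)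
  have h2 : mfderiv I 𝓘(ℝ, ℝ) ((H ∘ (extChartAt I c).symm) ∘ extChartAt I c) x =
      mfderiv I 𝓘(ℝ, ℝ) H x := by
    apply Filter.EventuallyEq.mfderiv_eq
    filter_upwards [(isOpen_extChartAt_source c).mem_nhds hx] with z hz
    exact congrArg H ((extChartAt I c).left_inv hz)
  rw [h2, mfderiv_eq_fderiv] at h1
  exact DFunLike.congr_fun h1 v

variable {I} in
/-- In any chart, a point is regular if and only if the derivative of the coordinate expression of
the function does not vanish. -/
lemma mem_regularSet_iff {H : X → ℝ} (hH : ContMDiff I 𝓘(ℝ, ℝ) ∞ H) {c x : X}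
    (hx : x ∈ (extChartAt I c).source) :
    x ∈ regularSet I H ↔ fderiv ℝ (H ∘ (extChartAt I c).symm) (extChartAt I c x) ≠ 0 := by
  rw [regularSet, Set.mem_ofPred_eq, not_iff_not]
  constructor
  · intro h
    ext v
    rw [fderiv_comp_extChartAt_symm hH ((extChartAt I c).map_source hx),
      (extChartAt I c).left_inv hx, h]
    rfl
  · intro h
    refine ContinuousLinearMap.ext fun v ↦ ?_
    have h1 := mfderiv_apply_eq_fderiv hH hx v
    rw [h] at h1
    exact h1

variable {I} in
lemma isOpen_regularSet {H : X → ℝ} (hH : ContMDiff I 𝓘(ℝ, ℝ) ∞ H) :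
    IsOpen (regularSet I H) := by
  rw [isOpen_iff_mem_nhds]
  intro x hx
  have hc : ContinuousOn (fderiv ℝ (H ∘ (extChartAt I x).symm)) (extChartAt I x).target :=
    (contDiffOn_comp_extChartAt_symm hH x).continuousOn_fderiv_of_isOpen
      (isOpen_extChartAt_target x) (by simp)
  have hS := hc.isOpen_inter_preimage (isOpen_extChartAt_target x) (isOpen_ne (x := 0))
  have hS' := (continuousOn_extChartAt (I := I) x).isOpen_inter_preimage
    (isOpen_extChartAt_source x) hS
  refine Filter.mem_of_superset (hS'.mem_nhds ⟨mem_extChartAt_source x,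
    mem_extChartAt_target x, ?_⟩) ?_
  · exact (mem_regularSet_iff hH (mem_extChartAt_source x)).1 hx
  · rintro z ⟨hz, -, hz'⟩
    exact (mem_regularSet_iff hH hz).2 hz'

variable [T2Space X] [LocallyCompactSpace X] [SecondCountableTopology X] [MeasurableSpace X]
  [BorelSpace X] [MeasurableSpace F] [BorelSpace F]

variable {I} in
lemma isFiniteMeasureOnCompacts_of_forall_chart (m : Measure F) [m.IsAddHaarMeasure]
    {μ : Measure X} (hμ : ∀ (c : X), ∀ A ⊆ (extChartAt I c).source, MeasurableSet A →
      μ A = m (extChartAt I c '' A)) : IsFiniteMeasureOnCompacts μ := by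
  refine ⟨fun C hC ↦ hC.measure_lt_top_of_nhdsWithin fun x hx ↦ ?_⟩
  obtain ⟨L, hL, hxL, hLs⟩ := exists_compact_between (isCompact_singleton (x := x))
    (isOpen_extChartAt_source (I := I) x) (by simp)
  refine ⟨L, mem_nhdsWithin_of_mem_nhds (mem_interior_iff_mem_nhds.1 (hxL rfl)), ?_⟩
  rw [hμ x L hLs hL.measurableSet]
  exact (hL.image_of_continuousOn ((continuousOn_extChartAt x).mono hLs)).measure_lt_top

variable {I} in
/-- Near a regular point, the measure induced on a level set exists and is given, in a smooth
parametrization of the level set, by a smooth density. -/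
lemma exists_isLevelMeasureOn_nhds (m : Measure F) [m.IsAddHaarMeasure] {μ : Measure X}
    (hμ : ∀ (c : X), ∀ A ⊆ (extChartAt I c).source, MeasurableSet A →
      μ A = m (extChartAt I c '' A)) {d : ℕ} (hd : finrank ℝ F = d + 1) {H : X → ℝ}
    (hH : ContMDiff I 𝓘(ℝ, ℝ) ∞ H) (E : ℝ) {x : X} (hx : x ∈ regularSet I H) :
    ∃ (U : Set X) (W : Set (EuclideanSpace ℝ (Fin d)))
    (φ : EuclideanSpace ℝ (Fin d) → X) (φinv : X → EuclideanSpace ℝ (Fin d))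
    (f : EuclideanSpace ℝ (Fin d) → ℝ),
    IsOpen U ∧ x ∈ U ∧ U ⊆ regularSet I H ∧ IsOpen W ∧
    ContMDiffOn (𝓡 d) I ∞ φ W ∧
    (∀ w ∈ W, Function.Injective (mfderiv (𝓡 d) I φ w)) ∧
    φ '' W = regularLevel I H E ∩ U ∧
    ContinuousOn φinv (regularLevel I H E ∩ U) ∧ (∀ w ∈ W, φinv (φ w) = w) ∧
    ContDiffOn ℝ ∞ f W ∧ (∀ w ∈ W, 0 ≤ f w) ∧
    IsLevelMeasureOn μ H E U
      (((volume.restrict W).withDensity (fun w ↦ ENNReal.ofReal (f w))).map φ) := by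
  have hReg := isOpen_regularSet hH
  have hT := (continuousOn_extChartAt_symm (I := I) x).isOpen_inter_preimage
    (isOpen_extChartAt_target x) hReg
  obtain ⟨e, J, he₁, he₂, he₃, he₄, he₅, hJ, hJ0, hem⟩ := exists_straightening hd m hT
    ((contDiffOn_comp_extChartAt_symm hH x).mono Set.inter_subset_left)
    (y₀ := extChartAt I x x)
    ⟨mem_extChartAt_target x, by
      rwa [Set.mem_preimage, (extChartAt I x).left_inv (mem_extChartAt_source x)]⟩
    ((mem_regularSet_iff hH (mem_extChartAt_source x)).1 hx)
  -- local coordinates on the manifold of which `H` is the first one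
  let g : OpenPartialHomeomorph X (ℝ × EuclideanSpace ℝ (Fin d)) := (chartHomeo I x).trans e
  have hgs : ∀ z, z ∈ g.source ↔ z ∈ (extChartAt I x).source ∧ extChartAt I x z ∈ e.source :=
    fun z ↦ by simp [g]
  have hgt : ∀ w, w ∈ g.target ↔ w ∈ e.target ∧ e.symm w ∈ (extChartAt I x).target :=
    fun w ↦ by simp [g]
  have hgsymm : ∀ w, g.symm w = (extChartAt I x).symm (e.symm w) := fun w ↦ rfl
  have hg1 : ∀ z ∈ g.source, (g z).1 = H z := by
    intro z hz
    have h1 := he₃ _ ((hgs z).1 hz).2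
    rw [Function.comp_apply, (extChartAt I x).left_inv ((hgs z).1 hz).1] at h1
    exact h1
  have hH1 : ∀ w ∈ g.target, H (g.symm w) = w.1 := fun w hw ↦ by
    rw [← hg1 _ (g.map_target hw), g.right_inv hw]
  have hgr : g.source ⊆ regularSet I H := by
    intro z hz
    have h1 := (he₂ ((hgs z).1 hz).2).2
    rwa [Set.mem_preimage, (extChartAt I x).left_inv ((hgs z).1 hz).1] at h1
  have hgμ : ∀ A ⊆ g.source, MeasurableSet A → μ A = ∫⁻ w in g '' A, ENNReal.ofReal (J w) := by
    intro A hA hAm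
    have hAs : A ⊆ (extChartAt I x).source := fun z hz ↦ ((hgs z).1 (hA hz)).1
    have hAi : MeasurableSet (extChartAt I x '' A) := (chartHomeo I x).measurableSet_image hAm hAs
    rw [hμ x A hAs hAm, hem _ (by rintro _ ⟨z, hz, rfl⟩; exact ((hgs z).1 (hA hz)).2) hAi,
      Set.image_image]
    rfl
  have hJg : ContDiffOn ℝ ∞ J g.target := hJ.mono fun w hw ↦ ((hgt w).1 hw).1
  have hgtm := g.open_target.measurableSet
  have hμmap : μ.restrict g.source = ((volume.restrict g.target).withDensity
      fun w ↦ ENNReal.ofReal (J w)).map g.symm := by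
    ext A hA
    have hac := withDensity_absolutelyContinuous (volume.restrict g.target)
      fun w ↦ ENNReal.ofReal (J w)
    have hae : AEMeasurable g.symm (volume.restrict g.target) :=
      g.continuousOn_symm.aemeasurable hgtm
    have hnull : NullMeasurableSet (g.symm ⁻¹' A) (volume.restrict g.target) :=
      hae.nullMeasurable hA
    rw [Measure.restrict_apply hA, Measure.map_apply_of_aemeasurable (hae.mono_ac hac) hA,
      withDensity_apply₀ _ hnull, Measure.restrict_restrict₀ hnull,
      hgμ _ Set.inter_subset_right (hA.inter g.open_source.measurableSet), Set.inter_comm A,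
      g.image_source_inter_eq', Set.inter_comm]
  -- the slice with first coordinate `E` parametrizes the level set
  let i : EuclideanSpace ℝ (Fin d) → ℝ × EuclideanSpace ℝ (Fin d) := fun z ↦ (E, z)
  have hi : ContDiff ℝ ∞ i := contDiff_const.prodMk contDiff_id
  have hid : ∀ z v, fderiv ℝ i z v = (0, v) := fun z v ↦ by
    have h1 : HasFDerivAt i
        ((0 : EuclideanSpace ℝ (Fin d) →L[ℝ] ℝ).prod (ContinuousLinearMap.id ℝ _)) z :=
      (hasFDerivAt_const E z).prodMk (hasFDerivAt_id z)
    rw [h1.fderiv]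
    rfl
  let W : Set (EuclideanSpace ℝ (Fin d)) := i ⁻¹' g.target
  have hW : IsOpen W := g.open_target.preimage hi.continuous
  let φ : EuclideanSpace ℝ (Fin d) → X := fun z ↦ g.symm (i z)
  let f : EuclideanSpace ℝ (Fin d) → ℝ := fun z ↦ J (i z)
  have hφc : ContinuousOn φ W := g.continuousOn_symm.comp hi.continuous.continuousOn fun z hz ↦ hz
  have hfd : ContDiffOn ℝ ∞ f W := hJg.comp hi.contDiffOn fun z hz ↦ hz
  have hφW : φ '' W = regularLevel I H E ∩ g.source := by
    ext z
    constructor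
    · rintro ⟨w, hw, rfl⟩
      have h1 := g.map_target hw
      exact ⟨⟨hH1 _ hw, hgr h1⟩, h1⟩
    · rintro ⟨⟨hzE, -⟩, hz⟩
      have h1 : i (g z).2 = g z := Prod.ext (by rw [hg1 z hz]; exact hzE.symm) rfl
      refine ⟨(g z).2, ?_, ?_⟩
      · show i (g z).2 ∈ g.target
        rw [h1]
        exact g.map_source hz
      · show g.symm (i (g z).2) = z
        rw [h1, g.left_inv hz]
  have hφinv : ∀ w ∈ W, (g (φ w)).2 = w := fun w hw ↦ by
    show (g (g.symm (i w))).2 = w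
    rw [g.right_inv hw]
  have hφae : AEMeasurable φ (volume.restrict W) := hφc.aemeasurable hW.measurableSet
  have hac := withDensity_absolutelyContinuous (volume.restrict W)
      fun w ↦ ENNReal.ofReal (f w)
  have hφapp : ∀ A, MeasurableSet A → (((volume.restrict W).withDensity
      (fun w ↦ ENNReal.ofReal (f w))).map φ) A = ∫⁻ w in W ∩ φ ⁻¹' A, ENNReal.ofReal (f w) := by
    intro A hA
    have hnull : NullMeasurableSet (φ ⁻¹' A) (volume.restrict W) := hφae.nullMeasurable hA
    rw [Measure.map_apply_of_aemeasurable (hφae.mono_ac hac) hA,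
      withDensity_apply₀ _ hnull, Measure.restrict_restrict₀ hnull, Set.inter_comm]
  refine ⟨g.source, W, φ, fun z ↦ (g z).2, f, g.open_source, ?_, hgr, hW, ?_, ?_, hφW, ?_,
    hφinv, hfd, fun w _ ↦ hJ0 _, ⟨?_, ?_, ?_⟩⟩
  · exact (hgs x).2 ⟨mem_extChartAt_source x, he₁⟩
  · intro w hw
    have hw' := (hgt _).1 hw
    refine ContMDiffAt.contMDiffWithinAt ?_
    exact ContMDiffAt.comp (I' := 𝓘(ℝ, F)) (f := e.symm ∘ i) w
      (contMDiffAt_extChartAt_symm I hw'.2) ((he₄ _ hw'.1).comp w hi.contDiffAt).contMDiffAt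
  · intro w hw
    have hw' := (hgt _).1 hw
    have hde : DifferentiableAt ℝ e.symm (i w) := (he₄ _ hw'.1).differentiableAt (by simp)
    have hdi : DifferentiableAt ℝ i w := hi.contDiffAt.differentiableAt (by simp)
    have h1 : mfderiv (𝓡 d) I φ w = (mfderiv 𝓘(ℝ, F) I (extChartAt I x).symm (e.symm (i w))).comp
        (mfderiv (𝓡 d) 𝓘(ℝ, F) (e.symm ∘ i) w) :=
      mfderiv_comp w (mdifferentiableAt_extChartAt_symm_of_mem I hw'.2)
        (hde.comp w hdi).mdifferentiableAt
    rw [h1, mfderiv_eq_fderiv, fderiv_comp w hde hdi]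
    refine (mfderiv_extChartAt_symm_injective I hw'.2).comp ((he₅ _ hw'.1).comp ?_)
    intro u v huv
    have h2 := ((hid w u).symm.trans huv).trans (hid w v)
    exact (Prod.ext_iff.1 h2).2
  · exact continuous_snd.comp_continuousOn (g.continuousOn.mono Set.inter_subset_right)
  · rw [hφapp _ g.open_source.measurableSet.compl]
    have : W ∩ φ ⁻¹' g.sourceᶜ = ∅ := by
      ext w
      simp only [Set.mem_inter_iff, Set.mem_preimage, Set.mem_compl_iff, Set.mem_empty_iff_false,
        iff_false, not_and, not_not]
      exact fun hw ↦ g.map_target hw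
    rw [this, Measure.restrict_empty, lintegral_zero_measure]
  · intro C hC hCs
    rw [hφapp C hC.measurableSet]
    have hL : IsCompact ((fun z ↦ (g z).2) '' (C ∩ {z | H z = E})) :=
      (hC.inter_right (isClosed_eq hH.continuous continuous_const)).image_of_continuousOn
        (continuous_snd.comp_continuousOn (g.continuousOn.mono (Set.inter_subset_left.trans hCs)))
    have hLW : ((fun z ↦ (g z).2) '' (C ∩ {z | H z = E})) ⊆ W := by
      rintro _ ⟨z, ⟨hz, hzE⟩, rfl⟩
      have h1 : i (g z).2 = g z := Prod.ext (by rw [hg1 z (hCs hz)]; exact hzE.symm) rfl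
      show i (g z).2 ∈ g.target
      rw [h1]
      exact g.map_source (hCs hz)
    refine (lintegral_mono_set ?_).trans_lt
      ((hfd.continuousOn.mono hLW).integrableOn_compact hL).lintegral_lt_top
    rintro w ⟨hw, hwC⟩
    exact ⟨φ w, ⟨hwC, hH1 _ hw⟩, hφinv w hw⟩
  · intro ψ hψ hψc hψs
    have hK : IsCompact (g '' tsupport ψ) :=
      hψc.image_of_continuousOn (g.continuousOn.mono hψs)
    have hKt : g '' tsupport ψ ⊆ g.target :=
      (Set.image_mono hψs).trans g.image_source_eq_target.subset
    have h0 : ∀ w ∈ g.target, w ∉ g '' tsupport ψ → J w * ψ (g.symm w) = 0 := by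
      intro w hw hwK
      rw [image_eq_zero_of_notMem_tsupport (f := ψ) fun h ↦ hwK ⟨g.symm w, h, g.right_inv hw⟩,
        mul_zero]
    have hd := hasDerivAt_setIntegral_of_map_eq (m := (volume : Measure (EuclideanSpace ℝ (Fin d))))
      hH.continuous.measurable (μ := μ)
      (U := g.source) (W := g.target) hgtm (Ψ := g.symm) (J := J)
      (g.continuousOn_symm.aemeasurable hgtm)
      (hJg.continuousOn.aemeasurable hgtm) (fun w _ ↦ hJ0 w) hH1 hμmap hψ.measurable
      (fun x hx ↦ image_eq_zero_of_notMem_tsupport fun h ↦ hx (hψs h))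
      (G := g.target.indicator fun w ↦ J w * ψ (g.symm w))
      (continuous_indicator_of_isCompact g.open_target hK hKt
        (hJg.continuousOn.mul (hψ.comp_continuousOn g.continuousOn_symm)) h0)
      (hasCompactSupport_indicator hK h0) Filter.EventuallyEq.rfl E
    convert hd using 1
    rw [integral_map (hφae.mono_ac hac) hψ.measurable.aestronglyMeasurable,
      integral_withDensity_eq_integral_toReal_smul₀
        (hfd.continuousOn.aemeasurable hW.measurableSet).ennreal_ofReal
        (Filter.Eventually.of_forall fun _ ↦ ENNReal.ofReal_lt_top),
      ← integral_indicator hW.measurableSet]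
    refine integral_congr_ae (Filter.Eventually.of_forall fun w ↦ ?_)
    by_cases hw : w ∈ W
    · have hw' : (E, w) ∈ g.target := hw
      simp [hw, hw', ENNReal.toReal_ofReal (hJ0 _), f, φ, i]
    · have hw' : (E, w) ∉ g.target := hw
      simp [hw, hw']

end Manifold

/-! ### Flows of Lipschitz vector fields -/

section Flow

open scoped NNReal

variable {F : Type*} [NormedAddCommGroup F] [NormedSpace ℝ F] [CompleteSpace F]
  {v : F → F} {K L : ℝ≥0}

lemma eq_of_hasDerivAt_of_lipschitzWith (hv : LipschitzWith K v) {f g : ℝ → F}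
    (hf : ∀ t, HasDerivAt f (v (f t)) t) (hg : ∀ t, HasDerivAt g (v (g t)) t) {t₀ : ℝ}
    (h : f t₀ = g t₀) : f = g :=
  ODE_solution_unique_univ (v := fun _ ↦ v) (s := fun _ ↦ Set.univ) (K := K) (t₀ := t₀)
    (fun _ ↦ hv.lipschitzOnWith) (fun t ↦ ⟨hf t, trivial⟩) (fun t ↦ ⟨hg t, trivial⟩) h

/-- A bounded Lipschitz vector field on a Banach space has a global flow. -/
lemma exists_flow_of_lipschitzWith (hv : LipschitzWith K v) (hL : ∀ x, ‖v x‖ ≤ L) :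
    ∃ Φ : ℝ → F → F, (∀ x, Φ 0 x = x) ∧
      ∀ x t, HasDerivAt (fun s ↦ Φ s x) (v (Φ t x)) t := by
  -- Picard-Lindelöf on `(-(n + 1), n + 1)`; by uniqueness the solutions fit together
  have h1 : ∀ (n : ℕ) (x : F), ∃ α : ℝ → F, α 0 = x ∧
      ∀ t ∈ Set.Ioo (-(n + 1) : ℝ) (n + 1), HasDerivAt α (v (α t)) t := by
    intro n x
    have hn : (0 : ℝ) ≤ n := Nat.cast_nonneg n
    let t₀ : Set.Icc (-(n + 1) : ℝ) (n + 1) := ⟨0, by constructor <;> linarith⟩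
    have hpl : IsPicardLindelof (fun _ ↦ v) t₀ x (L * (n + 1)) 0 L K :=
      { lipschitzOnWith := fun _ _ ↦ hv.lipschitzOnWith
        continuousOn := fun _ _ ↦ continuousOn_const
        norm_le := fun _ _ y _ ↦ hL y
        mul_max_le := by simp [t₀] }
    obtain ⟨α, hα0, hα⟩ := hpl.exists_eq_forall_mem_Icc_hasDerivWithinAt₀
    exact ⟨α, hα0, fun t ht ↦ (hα t (Set.Ioo_subset_Icc_self ht)).hasDerivAt
      (Icc_mem_nhds ht.1 ht.2)⟩
  choose α hα0 hα using h1
  have hcoh : ∀ (m n : ℕ) (x : F) (t : ℝ), m ≤ n → |t| < m + 1 → α m x t = α n x t := by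
    intro m n x t hmn ht
    have hmn' : (m : ℝ) ≤ n := Nat.cast_le.2 hmn
    have hm : (0 : ℝ) ≤ m := Nat.cast_nonneg m
    refine ODE_solution_unique_of_mem_Ioo (v := fun _ ↦ v) (s := fun _ ↦ Set.univ) (K := K)
      (a := -(m + 1)) (b := m + 1) (t₀ := 0) (fun _ _ ↦ hv.lipschitzOnWith)
      (by constructor <;> linarith) (fun s hs ↦ ⟨hα m x s hs, trivial⟩)
      (fun s hs ↦ ⟨hα n x s ⟨by linarith [hs.1], by linarith [hs.2]⟩, trivial⟩)
      (by rw [hα0, hα0]) (abs_lt.1 ht)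
  refine ⟨fun t x ↦ α ⌈|t|⌉₊ x t, fun x ↦ by simp [hα0], fun x t ↦ ?_⟩
  have hlt : ∀ s : ℝ, |s| < ⌈|s|⌉₊ + 1 := fun s ↦ (Nat.le_ceil _).trans_lt (lt_add_one _)
  have h2 := hα (⌈|t|⌉₊ + 1) x t (by
    rw [Set.mem_Ioo, ← abs_lt]
    push_cast
    linarith [hlt t])
  have h3 : v (α ⌈|t|⌉₊ x t) = v (α (⌈|t|⌉₊ + 1) x t) := by
    rw [hcoh _ (⌈|t|⌉₊ + 1) x t (Nat.le_succ _) (hlt t)]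
  simp only [h3]
  refine h2.congr_of_eventuallyEq ?_
  have h4 : ∀ᶠ s : ℝ in 𝓝 t, |s| < |t| + 1 :=
    (continuous_abs.tendsto t).eventually (gt_mem_nhds (lt_add_one _))
  filter_upwards [h4] with s hs
  refine hcoh _ _ x s ?_ (hlt s)
  rw [← Nat.ceil_add_one (abs_nonneg t)]
  exact Nat.ceil_mono hs.le

/-- Grönwall's estimate for two trajectories, forwards and backwards in time. -/
lemma dist_le_mul_exp_of_hasDerivAt (hv : LipschitzWith K v) {f g : ℝ → F}
    (hf : ∀ t, HasDerivAt f (v (f t)) t) (hg : ∀ t, HasDerivAt g (v (g t)) t) (t : ℝ) :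
    dist (f t) (g t) ≤ dist (f 0) (g 0) * Real.exp (K * |t|) := by
  have key : ∀ {v : F → F} {f g : ℝ → F}, LipschitzWith K v → (∀ t, HasDerivAt f (v (f t)) t) →
      (∀ t, HasDerivAt g (v (g t)) t) → ∀ t, 0 ≤ t →
        dist (f t) (g t) ≤ dist (f 0) (g 0) * Real.exp (K * t) := by
    intro v f g hv hf hg t ht
    have h := dist_le_of_trajectories_ODE (v := fun _ ↦ v) (a := 0) (b := t) (fun _ ↦ hv)
      (continuous_iff_continuousAt.2 fun s ↦ (hf s).continuousAt).continuousOn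
      (fun s _ ↦ (hf s).hasDerivWithinAt)
      (continuous_iff_continuousAt.2 fun s ↦ (hg s).continuousAt).continuousOn
      (fun s _ ↦ (hg s).hasDerivWithinAt) le_rfl t ⟨ht, le_rfl⟩
    simpa using h
  rcases le_total 0 t with ht | ht
  · rw [abs_of_nonneg ht]
    exact key hv hf hg t ht
  · rw [abs_of_nonpos ht]
    have hneg : ∀ {f : ℝ → F}, (∀ t, HasDerivAt f (v (f t)) t) →
        ∀ t, HasDerivAt (fun s ↦ f (-s)) ((-v) (f (-t))) t := fun hf t ↦ by
      have h := (hf (-t)).scomp t (hasDerivAt_neg t)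
      rw [neg_one_smul] at h
      exact h
    have h := key (v := -v) (f := fun s ↦ f (-s)) (g := fun s ↦ g (-s))
      (by simpa using hv.neg) (hneg hf) (hneg hg) (-t) (by linarith)
    simpa using h

end Flow

/-! ### Liouville's theorem for compactly supported Hamiltonians -/

section VolumePreserving

open scoped NNReal

variable {F : Type*} [NormedAddCommGroup F] [NormedSpace ℝ F] [FiniteDimensional ℝ F]
  [MeasurableSpace F] [BorelSpace F] (m : Measure F) [m.IsAddHaarMeasure]

/-- A Hamiltonian vector field `x ↦ J (dh x)`, with `J` antisymmetric, is divergence free in the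
weak sense, even when tested against functions that are merely Lipschitz. -/
lemma integral_fderiv_apply_hamiltonian_eq_zero (J : (F →L[ℝ] ℝ) →L[ℝ] F)
    (hJ : ∀ α β : F →L[ℝ] ℝ, α (J β) = - β (J α)) {h : F → ℝ} (hh : ContDiff ℝ ∞ h)
    (hhc : HasCompactSupport h) {G : F → ℝ} {C : ℝ≥0} (hG : LipschitzWith C G) :
    ∫ x, fderiv ℝ G x (J (fderiv ℝ h x)) ∂m = 0 := by
  let b := Module.finBasis ℝ F
  let β : Fin (finrank ℝ F) → F →L[ℝ] ℝ := fun i ↦ (b.coord i).toContinuousLinearMap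
  have hβ : ∀ i x, β i x = b.repr x i := fun i x ↦ rfl
  have hdual : ∀ α : F →L[ℝ] ℝ, α = ∑ j, α (b j) • β j := by
    intro α
    ext x
    have h1 := congrArg α (b.sum_repr x).symm
    rw [map_sum] at h1
    rw [h1, sum_apply]
    refine Finset.sum_congr rfl fun j _ ↦ ?_
    rw [map_smul, smul_eq_mul, mul_comm]
    rfl
  let D : Fin (finrank ℝ F) → F → ℝ := fun j x ↦ fderiv ℝ h x (b j)
  have hDd : ∀ j, ContDiff ℝ ∞ (D j) := fun j ↦
    (hh.fderiv_right (m := ∞) (by simp)).clm_apply contDiff_const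
  have hDc : ∀ j, HasCompactSupport (D j) := fun j ↦ hhc.fderiv_apply ℝ (b j)
  have hexp : ∀ x, fderiv ℝ G x (J (fderiv ℝ h x)) =
      ∑ i, ∑ j, β i (J (β j)) * (D j x * fderiv ℝ G x (b i)) := by
    intro x
    have h1 : J (fderiv ℝ h x) = ∑ i, (β i (J (fderiv ℝ h x))) • b i := (b.sum_repr _).symm
    have h2 : ∀ i, β i (J (fderiv ℝ h x)) = ∑ j, D j x * β i (J (β j)) := fun i ↦ by
      conv_lhs => rw [hdual (fderiv ℝ h x)]
      simp [D]
    rw [h1, map_sum]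
    refine Finset.sum_congr rfl fun i _ ↦ ?_
    rw [map_smul, h2, smul_eq_mul, Finset.sum_mul]
    exact Finset.sum_congr rfl fun j _ ↦ by ring
  -- Rademacher's theorem turns derivatives of the Lipschitz function `G` into line derivatives,
  -- which can be integrated by parts
  have hae : ∀ i j, (fun x ↦ D j x * fderiv ℝ G x (b i)) =ᵐ[m]
      fun x ↦ lineDeriv ℝ G x (b i) * D j x := fun i j ↦ by
    filter_upwards [hG.ae_differentiableAt] with x hx
    rw [hx.lineDeriv_eq_fderiv, mul_comm]
  have hint : ∀ i j, Integrable (fun x ↦ D j x * fderiv ℝ G x (b i)) m := fun i j ↦ by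
    refine Integrable.congr ?_ (hae i j).symm
    exact Integrable.bdd_mul (c := C * ‖b i‖) ((hDd j).continuous.integrable_of_hasCompactSupport (hDc j))
      (aestronglyMeasurable_lineDeriv hG.continuous m)
      (Filter.Eventually.of_forall fun x ↦ norm_lineDeriv_le_of_lipschitz ℝ hG)
  let S : Fin (finrank ℝ F) → Fin (finrank ℝ F) → ℝ := fun i j ↦
    ∫ x, fderiv ℝ (fderiv ℝ h) x (b i) (b j) * G x ∂m
  have hS : ∀ i j, ∫ x, D j x * fderiv ℝ G x (b i) ∂m = - S i j := by
    intro i j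
    obtain ⟨C', hC'⟩ := (hDd j).lipschitzWith_of_hasCompactSupport (hDc j) (by simp)
    rw [integral_congr_ae (hae i j), hG.integral_lineDeriv_mul_eq hC' (hDc j), ← integral_neg]
    refine integral_congr_ae (Filter.Eventually.of_forall fun x ↦ ?_)
    have hd : DifferentiableAt ℝ (fderiv ℝ h) x :=
      ((hh.fderiv_right (m := ∞) (by simp)).differentiable (by simp)) x
    have h1 : fderiv ℝ (D j) x (b i) = fderiv ℝ (fderiv ℝ h) x (b i) (b j) := by
      have h2 := (hd.hasFDerivAt.clm_apply (hasFDerivAt_const (b j) x)).fderiv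
      have h3 : fderiv ℝ (D j) x = _ := h2
      rw [h3]
      simp
    simp only [((hDd j).differentiable (by simp) x).lineDeriv_eq_fderiv, map_neg, h1, neg_mul]
  have hsymm : ∀ i j, S i j = S j i := by
    intro i j
    refine integral_congr_ae (Filter.Eventually.of_forall fun x ↦ ?_)
    have h1 := (hh.contDiffAt (x := x)).isSymmSndFDerivAt (by
      rw [minSmoothness_of_isRCLikeNormedField]
      exact WithTop.coe_le_coe.2 le_top)
    simp only
    rw [h1.eq (b i) (b j)]
  simp_rw [hexp]
  rw [integral_finsetSum _ fun i _ ↦ integrable_finsetSum _ fun j _ ↦ (hint i j).const_mul _]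
  simp_rw [integral_finsetSum _ fun j _ ↦ (hint _ j).const_mul _, integral_const_mul, hS]
  -- a contraction of an antisymmetric with a symmetric matrix
  have h5 : ∑ i, ∑ j, β i (J (β j)) * -S i j = -∑ i, ∑ j, β i (J (β j)) * -S i j := by
    conv_lhs => rw [Finset.sum_comm]
    rw [← Finset.sum_neg_distrib]
    refine Finset.sum_congr rfl fun i _ ↦ ?_
    rw [← Finset.sum_neg_distrib]
    refine Finset.sum_congr rfl fun j _ ↦ ?_
    rw [hJ (β j) (β i), hsymm j i]
    ring
  linarith

/-- The flow of a compactly supported Hamiltonian vector field preserves Lebesgue measure. -/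
lemma measurePreserving_hamiltonian_flow (J : (F →L[ℝ] ℝ) →L[ℝ] F)
    (hJ : ∀ α β : F →L[ℝ] ℝ, α (J β) = - β (J α)) {h : F → ℝ} (hh : ContDiff ℝ ∞ h)
    (hhc : HasCompactSupport h) {K : ℝ≥0} (hK : LipschitzWith K fun x ↦ J (fderiv ℝ h x))
    {L : ℝ≥0} (hL : ∀ x, ‖J (fderiv ℝ h x)‖ ≤ L)
    {Φ : ℝ → F ≃ₜ F} (hΦ0 : ∀ x, Φ 0 x = x)
    (hΦ : ∀ x t, HasDerivAt (fun s ↦ Φ s x) (J (fderiv ℝ h (Φ t x))) t) (t : ℝ) :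
    MeasurePreserving (Φ t) m m := by
  set v : F → F := fun x ↦ J (fderiv ℝ h x) with hv
  have hadd : ∀ s t x, Φ (t + s) x = Φ t (Φ s x) := by
    intro s t x
    have h1 := eq_of_hasDerivAt_of_lipschitzWith hK (f := fun r ↦ Φ (r + s) x)
      (g := fun r ↦ Φ r (Φ s x)) (fun r ↦ (hΦ x (r + s)).comp_add_const r s) (hΦ (Φ s x))
      (t₀ := 0) (by simp [hΦ0])
    exact congrFun h1 t
  have hlip : ∀ t, LipschitzWith (Real.exp (K * |t|)).toNNReal (Φ t) := fun t ↦
    LipschitzWith.of_dist_le_mul fun x y ↦ by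
      have h1 := dist_le_mul_exp_of_hasDerivAt hK (hΦ x) (hΦ y) t
      rw [hΦ0, hΦ0] at h1
      rwa [Real.coe_toNNReal _ (Real.exp_pos _).le, mul_comm]
  have hvc : HasCompactSupport v := (hhc.fderiv ℝ).comp_left (g := J) (map_zero J)
  have hfix : ∀ x ∉ tsupport v, ∀ t, Φ t x = x := by
    intro x hx t
    have hx0 : v x = 0 := image_eq_zero_of_notMem_tsupport hx
    have h1 := eq_of_hasDerivAt_of_lipschitzWith hK (f := fun r ↦ Φ r x)
      (g := fun _ ↦ x) (hΦ x) (fun r ↦ by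
        rw [hx0]
        exact hasDerivAt_const r x) (t₀ := 0) (hΦ0 x)
    exact congrFun h1 t
  -- the derivative at time `0`, where differentiating under the integral is justified by
  -- Rademacher's theorem and the bound `C L` on the Lipschitz constant of `s ↦ G (Φ s x)`
  have hder0 : ∀ {G : F → ℝ} {C : ℝ≥0}, LipschitzWith C G → HasCompactSupport G →
      HasDerivAt (fun s ↦ ∫ x, G (Φ s x) ∂m) 0 0 := by
    intro G C hG hGc
    have hGi : Integrable G m := hG.continuous.integrable_of_hasCompactSupport hGc
    have h1 := hasDerivAt_integral_of_dominated_loc_of_lip (μ := m) (F := fun s x ↦ G (Φ s x))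
      (F' := fun x ↦ fderiv ℝ G x (v x)) (x₀ := 0) (s := Set.univ)
      (bound := (tsupport v).indicator fun _ ↦ (C * L : ℝ)) Filter.univ_mem
      (Filter.Eventually.of_forall fun s ↦
        (hG.continuous.comp (Φ s).continuous).aestronglyMeasurable)
      (by simpa [hΦ0] using hGi)
      (by
        have hvm : Measurable v := hK.continuous.measurable
        have h2 : Measurable (fderiv ℝ G) := measurable_fderiv ℝ G
        exact (isBoundedBilinearMap_apply.continuous.measurable.comp
          (h2.prodMk hvm)).aestronglyMeasurable)
      (Filter.Eventually.of_forall fun x ↦ by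
        by_cases hx : x ∈ tsupport v
        · rw [Set.indicator_of_mem hx]
          have h3 : LipschitzWith L fun s ↦ Φ s x := by
            refine lipschitzWith_of_nnnorm_deriv_le (fun s ↦ (hΦ x s).differentiableAt) fun s ↦ ?_
            rw [(hΦ x s).deriv]
            exact hL _
          have h4 : Real.nnabs (C * L : ℝ) = C * L := by
            rw [← NNReal.coe_mul, Real.nnabs_coe]
          rw [h4]
          exact (hG.comp h3).lipschitzOnWith
        · rw [Set.indicator_of_notMem hx]
          simp only [hfix x hx]
          exact (LipschitzWith.const _).lipschitzOnWith.weaken zero_le)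
      ((integrable_indicator_iff (isClosed_tsupport v).measurableSet).2
        (integrableOn_const hvc.measure_lt_top.ne))
      (by
        filter_upwards [hG.ae_differentiableAt] with x hx
        have h5 := hΦ x 0
        rw [hΦ0] at h5
        have hx' : HasFDerivAt G (fderiv ℝ G x) (Φ 0 x) := by
          rw [hΦ0]
          exact hx.hasFDerivAt
        exact hx'.comp_hasDerivAt 0 h5)
    rw [integral_fderiv_apply_hamiltonian_eq_zero m J hJ hh hhc hG] at h1
    exact h1.2
  -- by the group property, the derivative at time `r` is the derivative at time `0` for the
  -- function `G ∘ Φ r`, which is again Lipschitz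
  have hconst : ∀ {G : F → ℝ} {C : ℝ≥0}, LipschitzWith C G → HasCompactSupport G →
      ∫ x, G (Φ t x) ∂m = ∫ x, G x ∂m := by
    intro G C hG hGc
    have hder : ∀ r, HasDerivAt (fun s ↦ ∫ x, G (Φ s x) ∂m) 0 r := by
      intro r
      have h1 := hder0 (hG.comp (hlip r)) (hGc.comp_homeomorph (Φ r))
      have h2 : (fun s ↦ ∫ x, G (Φ s x) ∂m) = fun s ↦ ∫ x, (G ∘ Φ r) (Φ (s - r) x) ∂m := by
        ext s
        refine integral_congr_ae (Filter.Eventually.of_forall fun x ↦ ?_)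
        simp only [Function.comp_apply, ← hadd]
        congr 3
        ring
      rw [h2]
      have h3 : HasDerivAt (fun s ↦ ∫ x, (G ∘ Φ r) (Φ s x) ∂m) 0 (r - r) := by
        simpa using h1
      exact h3.comp_sub_const r r
    have h1 := is_const_of_deriv_eq_zero (fun r ↦ (hder r).differentiableAt)
      (fun r ↦ (hder r).deriv) t 0
    simpa [hΦ0] using h1
  refine ⟨(Φ t).continuous.measurable, ?_⟩
  have hfin : ∀ C, IsCompact C → (m.map (Φ t)) C < ⊤ := fun C hC ↦ by
    rw [Measure.map_apply (Φ t).continuous.measurable hC.measurableSet]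
    exact ((Φ t).isCompact_preimage.2 hC).measure_lt_top
  have h1 := Measure.restrict_eq_of_forall_isCompact isOpen_univ (ν₁ := m.map (Φ t)) (ν₂ := m)
    (fun C hC _ ↦ hfin C hC) fun C hC _ ↦ ?_
  · simpa using h1
  -- thickened indicators are Lipschitz approximations of the indicator function of a compact set
  let δ : ℕ → ℝ := fun n ↦ 1 / ((n : ℝ) + 1)
  have hδ : ∀ n, 0 < δ n := fun n ↦ by positivity
  have hδ1 : ∀ n, δ n ≤ 1 := fun n ↦ by
    rw [div_le_one (by positivity)]
    linarith [Nat.cast_nonneg (α := ℝ) n]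
  let f : ℕ → F → ℝ := fun n x ↦ thickenedIndicator (hδ n) C x
  have hf : ∀ n, LipschitzWith (δ n).toNNReal⁻¹ (f n) := fun n ↦ by
    refine LipschitzWith.of_dist_le_mul fun x y ↦ ?_
    exact (lipschitzWith_thickenedIndicator (hδ n) C).dist_le_mul x y
  have hKc : IsCompact (Metric.cthickening 1 C) := hC.cthickening
  have hf0 : ∀ n, ∀ x ∉ Metric.cthickening 1 C, f n x = 0 := fun n x hx ↦ by
    have h2 : x ∉ Metric.thickening (δ n) C := fun hx' ↦ hx
      ((Metric.thickening_subset_cthickening _ _).trans (Metric.cthickening_mono (hδ1 n) C) hx')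
    have h3 := thickenedIndicator_zero (hδ n) C h2
    exact congrArg NNReal.toReal h3
  have h01 : ∀ n x, f n x ∈ Set.Icc (0 : ℝ) 1 := fun n x ↦
    ⟨NNReal.coe_nonneg _, by exact_mod_cast thickenedIndicator_le_one (hδ n) C x⟩
  have hlim : ∀ x, Filter.Tendsto (fun n ↦ f n x) Filter.atTop
      (𝓝 (C.indicator (fun _ ↦ (1 : ℝ)) x)) := fun x ↦ by
    have h2 := thickenedIndicator_tendsto_indicator_closure hδ
      tendsto_one_div_add_atTop_nhds_zero_nat C
    have h3 := NNReal.tendsto_coe.2 ((tendsto_pi_nhds.1 h2) x)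
    rw [hC.isClosed.closure_eq] at h3
    convert h3 using 2
    by_cases hx : x ∈ C <;> simp [hx]
  have h2 := tendsto_integral_of_tendsto_indicator (ν := m.map (Φ t)) hC.measurableSet
    hKc.measurableSet (hfin _ hKc) (fun n ↦ (hf n).continuous.measurable) h01 hf0 hlim
  have h3 := tendsto_integral_of_tendsto_indicator (ν := m) hC.measurableSet
    hKc.measurableSet hKc.measure_lt_top (fun n ↦ (hf n).continuous.measurable) h01 hf0 hlim
  have h4 : ∀ n, ∫ x, f n x ∂(m.map (Φ t)) = ∫ x, f n x ∂m := fun n ↦ by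
    rw [integral_map (Φ t).continuous.measurable.aemeasurable
      (hf n).continuous.aestronglyMeasurable]
    exact hconst (hf n) (HasCompactSupport.intro hKc (hf0 n))
  simp_rw [h4] at h2
  exact (measureReal_eq_measureReal_iff (hfin C hC).ne hC.measure_lt_top.ne).1
    (tendsto_nhds_unique h2 h3)

end VolumePreserving

/-! ### Hamiltonian flows on manifolds -/

section ManifoldFlow

open scoped NNReal

variable {F : Type*} [NormedAddCommGroup F] [NormedSpace ℝ F] [FiniteDimensional ℝ F]
  {K : Type*} [TopologicalSpace K] {I : ModelWithCorners ℝ F K} [I.Boundaryless]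
  {X : Type*} [TopologicalSpace X] [ChartedSpace K X] [IsManifold I ∞ X]

variable (I) in
/-- In every chart, the vector field `Y` is `J (dH)`, for a fixed linear map `J` from covectors to
vectors of the model space. For an antisymmetric `J` this expresses that `Y` is the Hamiltonian
vector field of `H`, in charts which are canonical coordinates. -/
def IsHamiltonianInCharts (J : (F →L[ℝ] ℝ) →L[ℝ] F) (H : X → ℝ)
    (Y : ∀ x : X, TangentSpace I x) : Prop :=
  ∀ c : X, ∀ x ∈ (extChartAt I c).source,
    (mfderiv I 𝓘(ℝ, F) (extChartAt I c) x (Y x) : F) =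
      J (fderiv ℝ (H ∘ (extChartAt I c).symm) (extChartAt I c x))

variable {J : (F →L[ℝ] ℝ) →L[ℝ] F} {H : X → ℝ} {Y : ∀ x : X, TangentSpace I x}

lemma IsHamiltonianInCharts.neg (hY : IsHamiltonianInCharts I J H Y) :
    IsHamiltonianInCharts I (-J) H ((-1 : ℝ) • Y) := fun c x hx ↦ by
  have h1 : (mfderiv I 𝓘(ℝ, F) (extChartAt I c) x ((-1 : ℝ) • Y x) : F) =
    (-1 : ℝ) • (mfderiv I 𝓘(ℝ, F) (extChartAt I c) x (Y x) : F) := map_smul _ _ _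
  refine h1.trans ?_
  rw [hY c x hx]
  exact neg_one_smul ℝ (J _)

/-- An integral curve of the Hamiltonian vector field, seen in a chart. -/
lemma IsHamiltonianInCharts.hasDerivWithinAt (hY : IsHamiltonianInCharts I J H Y) {γ : ℝ → X}
    {s : Set ℝ} (hγ : IsMIntegralCurveOn γ Y s) {t : ℝ} (ht : t ∈ s) {c : X}
    (hc : γ t ∈ (extChartAt I c).source) :
    HasDerivWithinAt (extChartAt I c ∘ γ)
      (J (fderiv ℝ (H ∘ (extChartAt I c).symm) (extChartAt I c (γ t)))) s t := by
  have h := (mdifferentiableAt_extChartAt_of_mem I hc).hasMFDerivAt.comp_hasMFDerivWithinAt t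
    (hγ t ht)
  rw [← hY c _ hc]
  have h2 : HasFDerivWithinAt (extChartAt I c ∘ γ) (_ : ℝ →L[ℝ] F) s t :=
    hasMFDerivWithinAt_iff_hasFDerivWithinAt.1 h
  refine h2.hasDerivWithinAt.congr_deriv ?_
  change (mfderiv I 𝓘(ℝ, F) (extChartAt I c) (γ t) ((1 : ℝ) • Y (γ t)) : F) = _
  rw [one_smul]

/-- A trajectory in a chart gives an integral curve on the manifold. -/
lemma IsHamiltonianInCharts.hasMFDerivAt (hY : IsHamiltonianInCharts I J H Y) {β : ℝ → F} {t : ℝ}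
    {c : X} (hc : β t ∈ (extChartAt I c).target)
    (hβ : HasDerivAt β (J (fderiv ℝ (H ∘ (extChartAt I c).symm) (β t))) t) :
    HasMFDerivAt 𝓘(ℝ, ℝ) I ((extChartAt I c).symm ∘ β) t
      ((1 : ℝ →L[ℝ] ℝ).smulRight (Y (((extChartAt I c).symm ∘ β) t))) := by
  have hs := (extChartAt I c).map_target hc
  have h := (mdifferentiableAt_extChartAt_symm_of_mem I hc).hasMFDerivAt.comp t
    (hasMFDerivAt_iff_hasFDerivAt.2 hβ.hasFDerivAt)
  have h1 : (mfderiv 𝓘(ℝ, F) I (extChartAt I c).symm (β t)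
      (J (fderiv ℝ (H ∘ (extChartAt I c).symm) (β t))) : TangentSpace I _) =
      Y ((extChartAt I c).symm (β t)) := by
    have h2 := hY c _ hs
    rw [(extChartAt I c).right_inv hc] at h2
    rw [← h2]
    have h3 := mfderiv_extChartAt_symm_apply_mfderiv_extChartAt I hs
      (Y ((extChartAt I c).symm (β t)))
    rwa [(extChartAt I c).right_inv hc] at h3
  refine h.congr_mfderiv ?_
  refine ContinuousLinearMap.ext_ring ?_
  symm
  change (1 : ℝ) • Y ((extChartAt I c).symm (β t)) =
    mfderiv 𝓘(ℝ, F) I (extChartAt I c).symm (β t)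
      ((1 : ℝ) • (J (fderiv ℝ (H ∘ (extChartAt I c).symm) (β t))))
  rw [one_smul, one_smul]
  exact h1.symm

/-- Near a point, the function `H` agrees in the chart with a smooth function of compact support
on the model space, whose Hamiltonian vector field is bounded and Lipschitz. -/
lemma exists_hamiltonian_cutoff (J : (F →L[ℝ] ℝ) →L[ℝ] F) (hH : ContMDiff I 𝓘(ℝ, ℝ) ∞ H)
    {x : X} {O : Set X} (hO : IsOpen O) (hx : x ∈ O) :
    ∃ r > 0, Metric.closedBall (extChartAt I x x) r ⊆
      (extChartAt I x).target ∩ (extChartAt I x).symm ⁻¹' O ∧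
      ∃ h : F → ℝ, ContDiff ℝ ∞ h ∧ HasCompactSupport h ∧
        (∀ y ∈ Metric.ball (extChartAt I x x) r,
          fderiv ℝ h y = fderiv ℝ (H ∘ (extChartAt I x).symm) y) ∧
        ∃ A B : ℝ≥0, LipschitzWith A (fun y ↦ J (fderiv ℝ h y)) ∧
          ∀ y, ‖J (fderiv ℝ h y)‖ ≤ B := by
  set y₀ := extChartAt I x x
  have hT : IsOpen ((extChartAt I x).target ∩ (extChartAt I x).symm ⁻¹' O) :=
    (continuousOn_extChartAt_symm x).isOpen_inter_preimage (isOpen_extChartAt_target x) hO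
  obtain ⟨R, hR, hRT⟩ := Metric.isOpen_iff.1 hT y₀
    ⟨mem_extChartAt_target x, by rwa [Set.mem_preimage, extChartAt_to_inv]⟩
  -- cut `H` off in the chart by a bump function equal to `1` near the point
  let χ : ContDiffBump y₀ := ⟨R / 3, R / 2, by positivity, by linarith⟩
  have hsub : Metric.closedBall y₀ (R / 2) ⊆
      (extChartAt I x).target ∩ (extChartAt I x).symm ⁻¹' O :=
    (Metric.closedBall_subset_ball (by linarith)).trans hRT
  have hh : ContDiff ℝ ∞ (fun y ↦ χ y * (H ∘ (extChartAt I x).symm) y) := by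
    rw [contDiff_iff_contDiffAt]
    intro y
    by_cases hy : y ∈ (extChartAt I x).target
    · exact χ.contDiffAt.mul ((contDiffOn_comp_extChartAt_symm hH x).contDiffAt
        ((isOpen_extChartAt_target x).mem_nhds hy))
    · have hy' : y ∉ tsupport χ := fun h ↦ hy (hsub (by rwa [χ.tsupport_eq] at h)).1
      refine contDiffAt_const (c := (0 : ℝ)) |>.congr_of_eventuallyEq ?_
      filter_upwards [notMem_tsupport_iff_eventuallyEq.1 hy'] with z hz
      rw [hz]
      simp
  have hhc : HasCompactSupport (fun y ↦ χ y * (H ∘ (extChartAt I x).symm) y) :=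
    χ.hasCompactSupport.mul_right
  have hv1 : ContDiff ℝ ∞ (fun y ↦ J (fderiv ℝ (fun y ↦ χ y * (H ∘ (extChartAt I x).symm) y) y)) :=
    J.contDiff.comp (hh.fderiv_right (m := ∞) (by simp))
  have hv2 : HasCompactSupport
      (fun y ↦ J (fderiv ℝ (fun y ↦ χ y * (H ∘ (extChartAt I x).symm) y) y)) :=
    (hhc.fderiv (𝕜 := ℝ)).comp_left (g := J) (map_zero J)
  refine ⟨R / 3, by positivity, (Metric.closedBall_subset_closedBall (by linarith)).trans hsub, _,
    hh, hhc, fun y hy ↦ ?_, ?_⟩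
  · refine Filter.EventuallyEq.fderiv_eq ?_
    filter_upwards [χ.eventuallyEq_one_of_mem_ball hy] with z hz
    rw [hz]
    simp
  · obtain ⟨A, hA⟩ := hv1.lipschitzWith_of_hasCompactSupport hv2 (by simp)
    obtain ⟨B, hB⟩ := hv2.exists_bound_of_continuous hv1.continuous
    exact ⟨A, B.toNNReal, hA, fun y ↦ (hB y).trans (Real.le_coe_toNNReal B)⟩

/-- Uniqueness of integral curves. The set of times up to which two curves agree is closed, and open
to the right, by uniqueness for the Lipschitz vector field of a cut off Hamiltonian. -/
lemma IsHamiltonianInCharts.eqOn_Icc [T2Space X] (hY : IsHamiltonianInCharts I J H Y)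
    (hH : ContMDiff I 𝓘(ℝ, ℝ) ∞ H) {γ γ' : ℝ → X} {T : ℝ}
    (hγ : IsMIntegralCurveOn γ Y (Set.Icc 0 T)) (hγ' : IsMIntegralCurveOn γ' Y (Set.Icc 0 T))
    (h0 : γ 0 = γ' 0) : ∀ t ∈ Set.Icc 0 T, γ t = γ' t := by
  have hcl : IsClosed ({t | γ t = γ' t} ∩ Set.Icc 0 T) := by
    rw [Set.inter_comm]
    exact (hγ.continuousOn.prodMk hγ'.continuousOn).preimage_isClosed_of_isClosed isClosed_Icc
      isClosed_diagonal
  refine fun t ht ↦ hcl.Icc_subset_of_forall_mem_nhdsWithin h0 ?_ ht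
  rintro t ⟨hteq, ht⟩
  obtain ⟨r, hr, hsub, h, hh, hhc, hheq, A, B, hA, hB⟩ :=
    exists_hamiltonian_cutoff J hH isOpen_univ (Set.mem_univ (γ t))
  set c := γ t
  set U : Set X := (extChartAt I c).source ∩ extChartAt I c ⁻¹' Metric.ball (extChartAt I c c) r
  have hU : IsOpen U := (continuousOn_extChartAt c).isOpen_inter_preimage
    (isOpen_extChartAt_source c) Metric.isOpen_ball
  have hcU : c ∈ U := ⟨mem_extChartAt_source c, Metric.mem_ball_self hr⟩
  have htc : t ∈ Set.Icc 0 T := ⟨ht.1, ht.2.le⟩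
  have hIcc : ∀ s ∈ Set.Ico 0 T, Set.Icc 0 T ∈ 𝓝[≥] s := fun s hs ↦
    Filter.mem_of_superset (Icc_mem_nhdsGE hs.2) (Set.Icc_subset_Icc_left hs.1)
  have hev : ∀ᶠ s in 𝓝[≥] t, γ s ∈ U ∧ γ' s ∈ U := by
    have h1 := (hγ.continuousWithinAt htc).mono_of_mem_nhdsWithin (hIcc t ht)
    have h2 := (hγ'.continuousWithinAt htc).mono_of_mem_nhdsWithin (hIcc t ht)
    have h1' : ∀ᶠ s in 𝓝[≥] t, γ s ∈ U := h1 (hU.mem_nhds hcU)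
    have h2' : ∀ᶠ s in 𝓝[≥] t, γ' s ∈ U :=
      h2 (hU.mem_nhds (by rw [← show γ t = γ' t from hteq]; exact hcU))
    exact h1'.and h2'
  obtain ⟨b, hb, hbU⟩ := mem_nhdsGE_iff_exists_Icc_subset.1 hev
  obtain ⟨b', hb', hbb', hb'T⟩ : ∃ b', t < b' ∧ b' ≤ b ∧ b' ≤ T :=
    ⟨min b T, lt_min hb ht.2, min_le_left _ _, min_le_right _ _⟩
  have key : ∀ γ : ℝ → X, IsMIntegralCurveOn γ Y (Set.Icc 0 T) → (∀ s ∈ Set.Icc t b', γ s ∈ U) →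
      ContinuousOn (extChartAt I c ∘ γ) (Set.Icc t b') ∧ ∀ s ∈ Set.Ico t b',
        HasDerivWithinAt (extChartAt I c ∘ γ) (J (fderiv ℝ h ((extChartAt I c ∘ γ) s)))
          (Set.Ici s) s := by
    intro γ hγ hγU
    have hIT : Set.Icc t b' ⊆ Set.Icc 0 T := Set.Icc_subset_Icc ht.1 hb'T
    refine ⟨(continuousOn_extChartAt c).comp (hγ.continuousOn.mono hIT) fun s hs ↦ (hγU s hs).1,
      fun s hs ↦ ?_⟩
    have hs' : s ∈ Set.Icc t b' := Set.Ico_subset_Icc_self hs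
    have h1 := hY.hasDerivWithinAt hγ (hIT hs') (hγU s hs').1
    rw [← hheq _ (hγU s hs').2] at h1
    exact h1.mono_of_mem_nhdsWithin (hIcc s ⟨ht.1.trans hs.1, hs.2.trans_le hb'T⟩)
  have hγU : ∀ s ∈ Set.Icc t b', γ s ∈ U := fun s hs ↦ (hbU ⟨hs.1, hs.2.trans hbb'⟩).1
  have hγU' : ∀ s ∈ Set.Icc t b', γ' s ∈ U := fun s hs ↦ (hbU ⟨hs.1, hs.2.trans hbb'⟩).2
  obtain ⟨k1, k2⟩ := key γ hγ hγU
  obtain ⟨k1', k2'⟩ := key γ' hγ' hγU'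
  have heq := ODE_solution_unique_of_mem_Icc_right
    (v := fun _ y ↦ J (fderiv ℝ h y)) (s := fun _ ↦ Set.univ) (K := A)
    (fun _ _ ↦ hA.lipschitzOnWith) k1 k2 (fun _ _ ↦ trivial) k1' k2' (fun _ _ ↦ trivial)
    (congrArg (extChartAt I c) hteq)
  refine Filter.mem_of_superset (Ioc_mem_nhdsGT hb') fun s hs ↦ ?_
  have hs' : s ∈ Set.Icc t b' := Set.Ioc_subset_Icc_self hs
  exact (extChartAt I c).injOn (hγU s hs').1 (hγU' s hs').1 (heq hs')

lemma IsMIntegralCurveOn.reverse {γ : ℝ → X} {T : ℝ}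
    (hγ : IsMIntegralCurveOn γ Y (Set.uIcc 0 T)) :
    IsMIntegralCurveOn (γ ∘ (· * (-1))) ((-1 : ℝ) • Y) (Set.uIcc 0 (-T)) := by
  refine (hγ.comp_mul (-1)).mono fun s hs ↦ ?_
  rw [Set.mem_ofPred_eq]
  rw [Set.mem_uIcc] at hs ⊢
  rcases hs with hs | hs
  · right; constructor <;> linarith [hs.1, hs.2]
  · left; constructor <;> linarith [hs.1, hs.2]

/-- Two integral curves with the same initial point agree, also backwards in time. -/
lemma IsHamiltonianInCharts.eqOn_uIcc [T2Space X] (hY : IsHamiltonianInCharts I J H Y)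
    (hH : ContMDiff I 𝓘(ℝ, ℝ) ∞ H) {γ γ' : ℝ → X} {T : ℝ}
    (hγ : IsMIntegralCurveOn γ Y (Set.uIcc 0 T)) (hγ' : IsMIntegralCurveOn γ' Y (Set.uIcc 0 T))
    (h0 : γ 0 = γ' 0) : ∀ t ∈ Set.uIcc 0 T, γ t = γ' t := by
  rcases le_total 0 T with hT | hT
  · rw [Set.uIcc_of_le hT] at hγ hγ' ⊢
    exact hY.eqOn_Icc hH hγ hγ' h0
  · have h1 := hγ.reverse
    have h2 := hγ'.reverse
    rw [Set.uIcc_of_le (neg_nonneg.2 hT)] at h1 h2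
    have h := hY.neg.eqOn_Icc hH h1 h2 (by simpa using h0)
    intro t ht
    rw [Set.uIcc_of_ge hT] at ht
    simpa using h (-t) ⟨by linarith [ht.2], by linarith [ht.1]⟩

lemma FlowsTo.unique [T2Space X] (hY : IsHamiltonianInCharts I J H Y)
    (hH : ContMDiff I 𝓘(ℝ, ℝ) ∞ H) {t : ℝ} {x y y' : X} (h : FlowsTo I Y t x y)
    (h' : FlowsTo I Y t x y') : y = y' := by
  obtain ⟨γ, h0, ht, hγ⟩ := h
  obtain ⟨γ', h0', ht', hγ'⟩ := h'
  rw [← ht, ← ht']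
  exact hY.eqOn_uIcc hH hγ hγ' (h0.trans h0'.symm) t Set.right_mem_uIcc

lemma FlowsTo.symm {t : ℝ} {x y : X} (h : FlowsTo I Y t x y) : FlowsTo I Y (-t) y x := by
  obtain ⟨γ, h0, ht, hγ⟩ := h
  refine ⟨γ ∘ (· + t), by simpa using ht, by simpa using h0, (hγ.comp_add t).mono fun s hs ↦ ?_⟩
  rw [Set.mem_ofPred_eq]
  rw [Set.mem_uIcc] at hs ⊢
  rcases hs with hs | hs
  · right; constructor <;> linarith [hs.1, hs.2]
  · left; constructor <;> linarith [hs.1, hs.2]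

lemma FlowsTo.injective [T2Space X] (hY : IsHamiltonianInCharts I J H Y)
    (hH : ContMDiff I 𝓘(ℝ, ℝ) ∞ H) {t : ℝ} {x x' y : X} (h : FlowsTo I Y t x y)
    (h' : FlowsTo I Y t x' y) : x = x' :=
  h.symm.unique hY hH h'.symm

/-- `H` is constant along the integral curves of its Hamiltonian vector field. -/
lemma FlowsTo.apply_eq (hJ : ∀ α β : F →L[ℝ] ℝ, α (J β) = - β (J α))
    (hY : IsHamiltonianInCharts I J H Y)
    (hH : ContMDiff I 𝓘(ℝ, ℝ) ∞ H) {t : ℝ} {x y : X} (h : FlowsTo I Y t x y) : H y = H x := by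
  obtain ⟨γ, rfl, rfl, hγ⟩ := h
  have hJ0 : ∀ α : F →L[ℝ] ℝ, α (J α) = 0 := fun α ↦ by linarith [hJ α α]
  have hd : ∀ s ∈ Set.uIcc 0 t, HasDerivWithinAt (H ∘ γ) 0 (Set.uIcc 0 t) s := by
    intro s hs
    have hc := mem_extChartAt_source (I := I) (γ s)
    have h1 := (hH.contMDiffAt.mdifferentiableAt (x := γ s) (by simp)).hasMFDerivAt
      |>.comp_hasMFDerivWithinAt s (hγ s hs)
    have h2 : HasFDerivWithinAt (H ∘ γ) (_ : ℝ →L[ℝ] ℝ) (Set.uIcc 0 t) s :=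
      hasMFDerivWithinAt_iff_hasFDerivWithinAt.1 h1
    refine h2.hasDerivWithinAt.congr_deriv ?_
    change (mfderiv I 𝓘(ℝ, ℝ) H (γ s) ((1 : ℝ) • Y (γ s)) : ℝ) = 0
    rw [one_smul]
    exact (mfderiv_apply_eq_fderiv hH hc (Y (γ s))).trans
      ((congrArg _ (hY _ _ hc)).trans (hJ0 _))
  have h1 := (convex_uIcc 0 t).norm_image_sub_le_of_norm_hasDerivWithin_le (f := H ∘ γ)
    (f' := fun _ ↦ 0) (C := 0) hd (by simp) Set.left_mem_uIcc Set.right_mem_uIcc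
  rw [zero_mul] at h1
  exact sub_eq_zero.1 (norm_le_zero_iff.1 h1)

/-- Critical points of `H` are fixed by the flow; hence regular points flow to regular points. -/
lemma FlowsTo.mem_regularSet [T2Space X] (hY : IsHamiltonianInCharts I J H Y)
    (hH : ContMDiff I 𝓘(ℝ, ℝ) ∞ H) {t : ℝ} {x y : X} (h : FlowsTo I Y t x y)
    (hx : x ∈ regularSet I H) : y ∈ regularSet I H := by
  by_contra hy
  have hc := mem_extChartAt_source (I := I) y
  have hY0 : Y y = 0 := by
    rw [mem_regularSet_iff hH hc, not_not] at hy
    have h1 := hY y y hc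
    rw [hy, map_zero] at h1
    have h2 := mfderiv_extChartAt_symm_apply_mfderiv_extChartAt I hc (Y y)
    exact h2.symm.trans ((congrArg _ h1).trans (map_zero _))
  have hconst : FlowsTo I Y (-t) y y := by
    refine ⟨fun _ ↦ y, rfl, rfl, fun s _ ↦ ?_⟩
    have h3 := (hasMFDerivAt_const (I := 𝓘(ℝ, ℝ)) (I' := I) y s).hasMFDerivWithinAt
      (s := Set.uIcc 0 (-t))
    refine h3.congr_mfderiv (ContinuousLinearMap.ext_ring ?_)
    change (0 : TangentSpace I y) = (1 : ℝ) • Y y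
    rw [hY0, smul_zero]
  rw [hconst.unique hY hH h.symm] at hy
  exact hy hx

lemma FlowsTo.of_curve {γ : ℝ → X} {T a b : ℝ} (hγ : IsMIntegralCurveOn γ Y (Set.uIcc 0 T))
    (ha : a ∈ Set.uIcc 0 T) (hb : b ∈ Set.uIcc 0 T) : FlowsTo I Y (b - a) (γ a) (γ b) := by
  refine ⟨γ ∘ (· + a), by simp, by simp, (hγ.comp_add a).mono fun s hs ↦ ?_⟩
  have h1 : s + a ∈ Set.uIcc a b := by
    rw [Set.mem_uIcc] at hs ⊢
    rcases hs with hs | hs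
    · left; constructor <;> linarith [hs.1, hs.2]
    · right; constructor <;> linarith [hs.1, hs.2]
  exact Set.uIcc_subset_uIcc ha hb h1

end ManifoldFlow

/-! ### Invariance of level measures under the flow -/

section Invariance

open scoped NNReal

variable {F : Type*} [NormedAddCommGroup F] [NormedSpace ℝ F] [FiniteDimensional ℝ F]
  [MeasurableSpace F] [BorelSpace F]
  {K : Type*} [TopologicalSpace K] {I : ModelWithCorners ℝ F K} [I.Boundaryless]
  {X : Type*} [TopologicalSpace X] [ChartedSpace K X] [IsManifold I ∞ X]
  [T2Space X] [SecondCountableTopology X] [MeasurableSpace X] [BorelSpace X]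
  {J : (F →L[ℝ] ℝ) →L[ℝ] F} {H : X → ℝ} {Y : ∀ x : X, TangentSpace I x}

/-- The flow for small times, near a point, is a partial homeomorphism preserving the measure. -/
lemma exists_flowBox (m : Measure F) [m.IsAddHaarMeasure] {μ : Measure X}
    (hμ : ∀ (c : X), ∀ A ⊆ (extChartAt I c).source, MeasurableSet A →
      μ A = m (extChartAt I c '' A))
    (hJ : ∀ α β : F →L[ℝ] ℝ, α (J β) = - β (J α)) (hY : IsHamiltonianInCharts I J H Y)
    (hH : ContMDiff I 𝓘(ℝ, ℝ) ∞ H) {x : X} {O : Set X} (hO : IsOpen O) (hx : x ∈ O) :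
    ∃ U : Set X, IsOpen U ∧ x ∈ U ∧ ∃ ε > 0, ∀ s : ℝ, |s| ≤ ε →
      ∃ f : OpenPartialHomeomorph X X, U ⊆ f.source ∧ f.source ⊆ O ∧ f.target ⊆ O ∧
        (∀ z ∈ f.source, FlowsTo I Y s z (f z)) ∧
        ∀ A ⊆ f.source, MeasurableSet A → μ (f '' A) = μ A := by
  obtain ⟨r, hr, hsub, h, hh, hhc, hheq, A, B, hA, hB⟩ := exists_hamiltonian_cutoff J hH hO hx
  obtain ⟨Φ₀, hΦ0, hΦ⟩ := exists_flow_of_lipschitzWith hA hB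
  have hadd : ∀ s t x, Φ₀ (t + s) x = Φ₀ t (Φ₀ s x) := by
    intro s t x
    have h1 := eq_of_hasDerivAt_of_lipschitzWith hA (f := fun r ↦ Φ₀ (r + s) x)
      (g := fun r ↦ Φ₀ r (Φ₀ s x)) (fun r ↦ (hΦ x (r + s)).comp_add_const r s) (hΦ (Φ₀ s x))
      (t₀ := 0) (by simp [hΦ0])
    exact congrFun h1 t
  have hcont : ∀ t, Continuous (Φ₀ t) := fun t ↦ by
    refine (LipschitzWith.of_dist_le_mul (K := (Real.exp (A * |t|)).toNNReal)
      fun x y ↦ ?_).continuous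
    have := dist_le_mul_exp_of_hasDerivAt hA (hΦ x) (hΦ y) t
    rw [hΦ0, hΦ0] at this
    rw [Real.coe_toNNReal _ (Real.exp_pos _).le]
    linarith
  let Φ : ℝ → F ≃ₜ F := fun t ↦
    { toFun := Φ₀ t
      invFun := Φ₀ (-t)
      left_inv := fun x ↦ by rw [← hadd, neg_add_cancel, hΦ0]
      right_inv := fun x ↦ by rw [← hadd, add_neg_cancel, hΦ0]
      continuous_toFun := hcont t
      continuous_invFun := hcont (-t) }
  have hmp := measurePreserving_hamiltonian_flow m J hJ hh hhc hA hB (Φ := Φ) hΦ0 hΦ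
  -- for times up to `r / (4 (B + 1))`, points move by at most `r / 4`, so trajectories that start
  -- in the ball of radius `r / 2` stay where the cut off Hamiltonian coincides with `H`
  have hdisp : ∀ t y, dist (Φ₀ t y) y ≤ B * |t| := by
    intro t y
    have h1 := (convex_uIcc 0 t).norm_image_sub_le_of_norm_hasDerivWithin_le
      (f := fun s ↦ Φ₀ s y) (C := B) (fun s _ ↦ (hΦ y s).hasDerivWithinAt) (fun s _ ↦ hB _)
      Set.left_mem_uIcc Set.right_mem_uIcc
    rw [hΦ0, sub_zero, Real.norm_eq_abs] at h1
    rwa [dist_eq_norm]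
  set y₀ := extChartAt I x x with hy₀
  have hUo : IsOpen ((extChartAt I x).source ∩ extChartAt I x ⁻¹' Metric.ball y₀ (r / 2)) :=
    (continuousOn_extChartAt x).isOpen_inter_preimage (isOpen_extChartAt_source x)
      Metric.isOpen_ball
  set U := (extChartAt I x).source ∩ extChartAt I x ⁻¹' Metric.ball y₀ (r / 2) with hU
  refine ⟨U, hUo, ⟨mem_extChartAt_source x, Metric.mem_ball_self (by positivity)⟩,
    r / (4 * (B + 1)), by positivity, fun s hs ↦ ?_⟩
  have hball : ∀ y ∈ Metric.ball y₀ (r / 2), ∀ t, |t| ≤ |s| → Φ₀ t y ∈ Metric.ball y₀ r := by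
    intro y hy t ht
    have h1 := hdisp t y
    have hB0 : (0 : ℝ) ≤ B := B.2
    have h2 : B * |t| < r / 2 := by
      have h4 : (B : ℝ) * |t| ≤ B * (r / (4 * (B + 1))) :=
        mul_le_mul_of_nonneg_left (ht.trans hs) hB0
      have h5 : B * (r / (4 * (B + 1))) ≤ r / 4 := by
        rw [mul_div_assoc', div_le_div_iff₀ (by positivity) (by positivity)]
        nlinarith
      linarith
    rw [Metric.mem_ball] at hy ⊢
    linarith [dist_triangle (Φ₀ t y) y y₀]
  have hball0 : ∀ z ∈ U, ∀ t, |t| ≤ |s| → Φ₀ t (extChartAt I x z) ∈ Metric.ball y₀ r :=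
    fun z hz ↦ hball _ hz.2
  have hbt : ∀ y ∈ Metric.ball y₀ r, y ∈ (extChartAt I x).target ∧ (extChartAt I x).symm y ∈ O :=
    fun y hy ↦ hsub (Metric.ball_subset_closedBall hy)
  let e := chartHomeo I x
  let f := (e.trans ((Φ s).toOpenPartialHomeomorph.trans e.symm)).restrOpen U hUo
  have hfs : f.source = U := by
    ext z
    constructor
    · intro hz
      exact hz.2
    · intro hz
      exact ⟨⟨hz.1, trivial, (hbt _ (hball0 z hz s le_rfl)).1⟩, hz⟩
  have hf : ∀ z, f z = (extChartAt I x).symm (Φ₀ s (extChartAt I x z)) := fun z ↦ rfl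
  refine ⟨f, hfs.ge, ?_, ?_, ?_, ?_⟩
  · rw [hfs]
    intro z hz
    have h1 := (hbt _ (hball0 z hz 0 (by simp))).2
    rwa [hΦ0, (extChartAt I x).left_inv hz.1] at h1
  · rw [← f.image_source_eq_target, hfs]
    rintro _ ⟨z, hz, rfl⟩
    exact (hbt _ (hball0 z hz s le_rfl)).2
  · rw [hfs]
    intro z hz
    refine ⟨(extChartAt I x).symm ∘ fun t ↦ Φ₀ t (extChartAt I x z), ?_, rfl, fun t ht ↦ ?_⟩
    · change (extChartAt I x).symm (Φ₀ 0 (extChartAt I x z)) = z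
      rw [hΦ0, (extChartAt I x).left_inv hz.1]
    · have hts : |t| ≤ |s| := by
        have := Set.abs_sub_left_of_mem_uIcc ht
        simpa using this
      have hb := hball0 z hz t hts
      refine (hY.hasMFDerivAt (hbt _ hb).1 ?_).hasMFDerivWithinAt
      rw [← hheq _ hb]
      exact hΦ _ t
  · rw [hfs]
    intro C hC hCm
    have hfC : f '' C = (extChartAt I x).symm '' (Φ₀ s '' (extChartAt I x '' C)) := by
      rw [Set.image_image, Set.image_image]
      rfl
    have hCt : Φ₀ s '' (extChartAt I x '' C) ⊆ (extChartAt I x).target := by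
      rintro _ ⟨_, ⟨z, hz, rfl⟩, rfl⟩
      exact (hbt _ (hball0 z (hC hz) s le_rfl)).1
    rw [hμ x (f '' C) ?_ (f.measurableSet_image hCm (by rwa [hfs])),
      hμ x C (fun z hz ↦ (hC hz).1) hCm, hfC, (extChartAt I x).image_symm_image_of_subset_target hCt]
    · have h1 := (hmp s).measure_preimage_emb (Φ s).measurableEmbedding
        (Φ₀ s '' (extChartAt I x '' C))
      rw [← h1]
      congr 1
      exact Set.preimage_image_eq _ (Φ s).injective
    · rw [hfC]
      rintro _ ⟨y, hy, rfl⟩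
      exact (extChartAt I x).map_target (hCt hy)

variable (I Y) in
/-- `f` is the flow of `Y` for time `τ` on an open subset of `R`, and preserves `ν`. -/
structure IsFlowStep (ν : Measure X) (R : Set X) (τ : ℝ) (f : OpenPartialHomeomorph X X) :
    Prop where
  source_subset : f.source ⊆ R
  flowsTo : ∀ z ∈ f.source, FlowsTo I Y τ z (f z)
  measure_image : ∀ A ⊆ f.source, MeasurableSet A → ν (f '' A) = ν A

variable (I Y) in
/-- The set of points of `R` near which the flow for time `τ` is a measure preserving partial
homeomorphism. -/
def flowStepSet (ν : Measure X) (R : Set X) (τ : ℝ) : Set X :=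
  {x | ∃ f, IsFlowStep I Y ν R τ f ∧ x ∈ f.source}

variable (I Y) in
/-- The set of points from which `m` flow steps of time `τ` are possible. -/
def iterFlowStepSet (ν : Measure X) (R : Set X) (τ : ℝ) : ℕ → Set X
  | 0 => Set.univ
  | m + 1 => {x | ∃ f, IsFlowStep I Y ν R τ f ∧ x ∈ f.source ∧ f x ∈ iterFlowStepSet ν R τ m}

lemma isOpen_iterFlowStepSet (ν : Measure X) (R : Set X) (τ : ℝ) (m : ℕ) :
    IsOpen (iterFlowStepSet I Y ν R τ m) := by
  induction m with
  | zero => exact isOpen_univ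
  | succ m ih =>
    have : iterFlowStepSet I Y ν R τ (m + 1) = ⋃ f, ⋃ (_ : IsFlowStep I Y ν R τ f),
        f.source ∩ f ⁻¹' iterFlowStepSet I Y ν R τ m := by
      ext x
      simp only [iterFlowStepSet, Set.mem_ofPred_eq, Set.mem_iUnion, Set.mem_inter_iff,
        Set.mem_preimage, exists_prop]
    rw [this]
    exact isOpen_iUnion fun f ↦ isOpen_iUnion fun _ ↦
      f.continuousOn.isOpen_inter_preimage f.open_source ih

variable {ν : Measure X} {R : Set X} {τ : ℝ}

/-- One step of the flow maps Borel sets to Borel sets of the same measure. -/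
lemma measure_flow_step (hY : IsHamiltonianInCharts I J H Y) (hH : ContMDiff I 𝓘(ℝ, ℝ) ∞ H)
    {A : Set X} (hA : MeasurableSet A) (hAs : ∀ x ∈ A, ∃ f, IsFlowStep I Y ν R τ f ∧ x ∈ f.source) :
    MeasurableSet {y | ∃ x ∈ A, FlowsTo I Y τ x y} ∧
      ν {y | ∃ x ∈ A, FlowsTo I Y τ x y} = ν A := by
  -- countably many flow steps cover `A`; apply each of them to a piece of a partition of `A`
  obtain ⟨T, hTc, hT⟩ := TopologicalSpace.isOpen_iUnion_countable
    (fun f : {f // IsFlowStep I Y ν R τ f} ↦ f.1.source) fun f ↦ f.1.open_source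
  have hcov : A ⊆ ⋃ f ∈ T, f.1.source := by
    rw [hT]
    intro x hx
    obtain ⟨f, hf, hxf⟩ := hAs x hx
    exact Set.mem_iUnion.2 ⟨⟨f, hf⟩, hxf⟩
  rcases T.eq_empty_or_nonempty with rfl | hne
  · have hA0 : A = ∅ := Set.subset_empty_iff.1 (by simpa using hcov)
    subst hA0
    simp
  obtain ⟨f, rfl⟩ := hTc.exists_eq_range hne
  let D : ℕ → Set X := fun n ↦ A ∩ disjointed (fun n ↦ (f n).1.source) n
  have hDm : ∀ n, MeasurableSet (D n) := fun n ↦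
    hA.inter (MeasurableSet.disjointed (fun n ↦ (f n).1.open_source.measurableSet) n)
  have hDs : ∀ n, D n ⊆ (f n).1.source := fun n ↦
    Set.inter_subset_right.trans (disjointed_subset _ n)
  have hDd : Pairwise (Function.onFun Disjoint D) := fun i j hij ↦
    ((disjoint_disjointed _ hij).mono Set.inter_subset_right Set.inter_subset_right)
  have hDu : ⋃ n, D n = A := by
    rw [← Set.inter_iUnion, iUnion_disjointed]
    refine Set.inter_eq_left.2 fun x hx ↦ ?_
    simpa using hcov hx
  have himg : {y | ∃ x ∈ A, FlowsTo I Y τ x y} = ⋃ n, (f n).1 '' D n := by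
    ext y
    rw [Set.mem_iUnion]
    constructor
    · rintro ⟨x, hx, hxy⟩
      rw [← hDu, Set.mem_iUnion] at hx
      obtain ⟨n, hn⟩ := hx
      exact ⟨n, x, hn, ((f n).2.flowsTo x (hDs n hn)).unique hY hH hxy⟩
    · rintro ⟨n, x, hx, rfl⟩
      exact ⟨x, hx.1, (f n).2.flowsTo x (hDs n hx)⟩
  have hm : ∀ n, MeasurableSet ((f n).1 '' D n) := fun n ↦
    (f n).1.measurableSet_image (hDm n) (hDs n)
  refine himg ▸ ⟨MeasurableSet.iUnion hm, ?_⟩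
  rw [measure_iUnion _ hm, ← hDu, measure_iUnion hDd hDm]
  · exact tsum_congr fun n ↦ (f n).2.measure_image _ (hDs n) (hDm n)
  · intro i j hij
    refine Set.disjoint_left.2 ?_
    rintro _ ⟨x, hx, rfl⟩ ⟨x', hx', hxx'⟩
    have h1 := (f i).2.flowsTo x (hDs i hx)
    have h2 := (f j).2.flowsTo x' (hDs j hx')
    rw [hxx'] at h2
    have := h1.injective hY hH h2
    subst this
    exact Set.disjoint_left.1 (hDd hij) hx hx'

lemma FlowsTo.split {m : ℕ} {x y : X} (h : FlowsTo I Y ((m + 1 : ℕ) * τ) x y) :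
    ∃ z, FlowsTo I Y τ x z ∧ FlowsTo I Y (m * τ) z y := by
  obtain ⟨γ, rfl, rfl, hγ⟩ := h
  have hm : (0 : ℝ) ≤ m := Nat.cast_nonneg m
  have hτ : τ ∈ Set.uIcc 0 (((m + 1 : ℕ) : ℝ) * τ) := by
    push_cast
    rw [Set.mem_uIcc]
    rcases le_total 0 τ with h | h
    · left; constructor <;> nlinarith
    · right; constructor <;> nlinarith
  refine ⟨γ τ, ?_, ?_⟩
  · simpa using FlowsTo.of_curve hγ Set.left_mem_uIcc hτ
  · have := FlowsTo.of_curve hγ hτ Set.right_mem_uIcc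
    convert this using 1
    push_cast
    ring

/-- Several steps of the flow map Borel sets to Borel sets of the same measure. -/
lemma measure_flow_iterate (hY : IsHamiltonianInCharts I J H Y) (hH : ContMDiff I 𝓘(ℝ, ℝ) ∞ H)
    (m : ℕ) {A : Set X} (hA : MeasurableSet A) (hAs : A ⊆ iterFlowStepSet I Y ν R τ m)
    (hAf : ∀ x ∈ A, ∃ y, FlowsTo I Y (m * τ) x y) :
    MeasurableSet {y | ∃ x ∈ A, FlowsTo I Y (m * τ) x y} ∧
      ν {y | ∃ x ∈ A, FlowsTo I Y (m * τ) x y} = ν A := by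
  induction m generalizing A with
  | zero =>
    have h0 : {y | ∃ x ∈ A, FlowsTo I Y ((0 : ℕ) * τ) x y} = A := by
      ext y
      constructor
      · rintro ⟨_, hx, γ, rfl, hy, -⟩
        have : γ 0 = y := by simpa using hy
        rwa [← this]
      · intro hy
        obtain ⟨z, γ, h0, hz, hγ⟩ := hAf y hy
        refine ⟨y, hy, γ, h0, ?_, hγ⟩
        simpa using h0
    rw [h0]
    exact ⟨hA, rfl⟩
  | succ m ih =>
    have hstep := measure_flow_step (ν := ν) (R := R) (τ := τ) hY hH hA fun x hx ↦ by
      obtain ⟨f, hf, hxf, -⟩ := hAs hx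
      exact ⟨f, hf, hxf⟩
    have h1 := ih hstep.1 (fun z hz ↦ ?_) (fun z hz ↦ ?_)
    · have himg : {y | ∃ x ∈ A, FlowsTo I Y ((m + 1 : ℕ) * τ) x y} =
          {y | ∃ z ∈ {z | ∃ x ∈ A, FlowsTo I Y τ x z}, FlowsTo I Y (m * τ) z y} := by
        ext y
        constructor
        · rintro ⟨x, hx, hxy⟩
          obtain ⟨z, h1, h2⟩ := hxy.split
          exact ⟨z, ⟨x, hx, h1⟩, h2⟩
        · rintro ⟨z, ⟨x, hx, hxz⟩, hzy⟩
          obtain ⟨y', hy'⟩ := hAf x hx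
          obtain ⟨z', h1, h2⟩ := hy'.split
          obtain rfl := h1.unique hY hH hxz
          obtain rfl := h2.unique hY hH hzy
          exact ⟨x, hx, hy'⟩
      rw [himg, ← hstep.2]
      exact h1
    · obtain ⟨x, hx, hxz⟩ := hz
      obtain ⟨f, hf, hxf, hfx⟩ := hAs hx
      rwa [← (hf.flowsTo x hxf).unique hY hH hxz]
    · obtain ⟨x, hx, hxz⟩ := hz
      obtain ⟨y, hy⟩ := hAf x hx
      obtain ⟨z', h1, h2⟩ := hy.split
      obtain rfl := h1.unique hY hH hxz
      exact ⟨y, h2⟩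

/-- If a step of time `τ` is possible from every point of a trajectory of length `m τ`, then `m`
steps are possible from its initial point. The induction starts at the end of the trajectory. -/
lemma FlowsTo.mem_iterFlowStepSet (hY : IsHamiltonianInCharts I J H Y)
    (hH : ContMDiff I 𝓘(ℝ, ℝ) ∞ H) {m : ℕ} {γ : ℝ → X} {T : ℝ}
    (hγ : IsMIntegralCurveOn γ Y (Set.uIcc 0 T)) (hT : T = m * τ)
    (h : ∀ t ∈ Set.uIcc 0 T, γ t ∈ flowStepSet I Y ν R τ) :
    γ 0 ∈ iterFlowStepSet I Y ν R τ m := by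
  have key : ∀ k ≤ m, γ ((m - k : ℝ) * τ) ∈ iterFlowStepSet I Y ν R τ k := by
    intro k
    induction k with
    | zero => exact fun _ ↦ trivial
    | succ k ih =>
      intro hk
      have hmem : ∀ j : ℕ, j ≤ m → (m - j : ℝ) * τ ∈ Set.uIcc 0 T := by
        intro j hj
        have h1 : (0 : ℝ) ≤ m - j := sub_nonneg.2 (by exact_mod_cast hj)
        have h2 : (m - j : ℝ) ≤ m := by linarith [(Nat.cast_nonneg j : (0 : ℝ) ≤ j)]
        rw [hT, Set.mem_uIcc]
        rcases le_total 0 τ with h | h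
        · left; constructor <;> nlinarith
        · right; constructor <;> nlinarith
      obtain ⟨f, hf, hxf⟩ := h _ (hmem (k + 1) hk)
      refine ⟨f, hf, hxf, ?_⟩
      have h1 := FlowsTo.of_curve hγ (hmem (k + 1) hk) (hmem k (by omega))
      have h2 : ((m : ℝ) - k) * τ - (m - (k + 1 : ℕ)) * τ = τ := by push_cast; ring
      rw [h2] at h1
      rw [(hf.flowsTo _ hxf).unique hY hH h1]
      exact ih (by omega)
  simpa using key m le_rfl

/-- The measure induced on a level set is invariant under the Hamiltonian flow. The flow for a
fixed time is decomposed into flow steps; the set on which `m` steps suffice is open. -/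
theorem isInvariantUnderFlow_of_isLevelMeasureOn [LocallyCompactSpace X] (m : Measure F)
    [m.IsAddHaarMeasure] {μ : Measure X}
    (hμ : ∀ (c : X), ∀ A ⊆ (extChartAt I c).source, MeasurableSet A →
      μ A = m (extChartAt I c '' A))
    (hJ : ∀ α β : F →L[ℝ] ℝ, α (J β) = - β (J α)) (hY : IsHamiltonianInCharts I J H Y)
    (hH : ContMDiff I 𝓘(ℝ, ℝ) ∞ H) {E : ℝ} {ν : Measure X}
    (hν : IsLevelMeasureOn μ H E (regularSet I H) ν) :
    IsInvariantUnderFlow I Y (regularLevel I H E) ν := by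
  have hflow : ∀ (t : ℝ) (x y : X), x ∈ regularLevel I H E → FlowsTo I Y t x y →
      y ∈ regularLevel I H E := fun t x y hx hxy ↦
    ⟨(hxy.apply_eq hJ hY hH).trans hx.1, hxy.mem_regularSet hY hH hx.2⟩
  refine ⟨hflow, fun t A hA hAS hAf ↦ ?_⟩
  have hbox : ∀ x ∈ regularSet I H, ∃ U : Set X, IsOpen U ∧ x ∈ U ∧ ∃ ε > 0, ∀ s : ℝ, |s| ≤ ε →
      U ⊆ flowStepSet I Y ν (regularSet I H) s := by
    intro x hx
    obtain ⟨U, hU, hxU, ε, hε, h⟩ := exists_flowBox m hμ hJ hY hH (isOpen_regularSet hH) hx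
    refine ⟨U, hU, hxU, ε, hε, fun s hs z hz ↦ ?_⟩
    obtain ⟨f, hUf, hf1, hf2, hf3, hf4⟩ := h s hs
    exact ⟨f, ⟨hf1, hf3, fun A hAf hA ↦ hν.measure_image_eq hH.continuous.measurable f hf1 hf2
      (fun x hx ↦ (hf3 x hx).apply_eq hJ hY hH) hf4 hA hAf⟩, hUf hz⟩
  -- the open set of the points from which `n + 1` steps of time `t / (n + 1)` are possible
  let Q : ℕ → Set X := fun n ↦
    iterFlowStepSet I Y ν (regularSet I H) (t / (n + 1 : ℕ)) (n + 1)
  have hQ : A ⊆ ⋃ n, Q n := by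
    intro x hx
    obtain ⟨y, hxy⟩ := hAf x hx
    obtain ⟨γ, h0, hty, hγ⟩ := id hxy
    have hreg : ∀ s ∈ Set.uIcc 0 t, γ s ∈ regularSet I H := by
      intro s hs
      have h1 := FlowsTo.of_curve hγ Set.left_mem_uIcc hs
      rw [h0] at h1
      exact h1.mem_regularSet hY hH (hAS hx).2
    -- the trajectory is compact, so one step size suffices for all of its points
    have hcpt : IsCompact (γ '' Set.uIcc 0 t) := isCompact_uIcc.image_of_continuousOn
      hγ.continuousOn
    have hfin : ∃ ε > 0, ∀ s : ℝ, |s| ≤ ε →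
        γ '' Set.uIcc 0 t ⊆ flowStepSet I Y ν (regularSet I H) s := by
      refine hcpt.induction_on (p := fun C ↦ ∃ ε > 0, ∀ s : ℝ, |s| ≤ ε →
        C ⊆ flowStepSet I Y ν (regularSet I H) s) ⟨1, one_pos, fun _ _ ↦ Set.empty_subset _⟩
        ?_ ?_ ?_
      · rintro C C' hCC' ⟨ε, hε, h⟩
        exact ⟨ε, hε, fun s hs ↦ hCC'.trans (h s hs)⟩
      · rintro C C' ⟨ε, hε, h⟩ ⟨ε', hε', h'⟩
        exact ⟨min ε ε', lt_min hε hε', fun s hs ↦ Set.union_subset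
          (h s (hs.trans (min_le_left _ _))) (h' s (hs.trans (min_le_right _ _)))⟩
      · rintro _ ⟨s, hs, rfl⟩
        obtain ⟨U, hU, hxU, ε, hε, h⟩ := hbox _ (hreg s hs)
        exact ⟨U, mem_nhdsWithin_of_mem_nhds (hU.mem_nhds hxU), ε, hε, h⟩
    obtain ⟨ε, hε, h⟩ := hfin
    obtain ⟨n, hn⟩ := exists_nat_gt (|t| / ε)
    have hn1 : |t / (n + 1 : ℕ)| ≤ ε := by
      have hpos : (0 : ℝ) < (n + 1 : ℕ) := by positivity
      rw [abs_div, abs_of_pos hpos, div_le_iff₀ hpos]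
      rw [div_lt_iff₀ hε] at hn
      push_cast
      nlinarith
    refine Set.mem_iUnion.2 ⟨n, ?_⟩
    have h2 := FlowsTo.mem_iterFlowStepSet (ν := ν) (R := regularSet I H) (τ := t / (n + 1 : ℕ))
      (m := n + 1) hY hH hγ (by field_simp) fun s hs ↦ h _ hn1 ⟨s, hs, rfl⟩
    rwa [h0] at h2
  -- the images of the disjoint pieces are disjoint, since the flow is injective
  let D : ℕ → Set X := fun n ↦ A ∩ disjointed Q n
  have hDm : ∀ n, MeasurableSet (D n) := fun n ↦
    hA.inter (MeasurableSet.disjointed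
      (fun n ↦ (isOpen_iterFlowStepSet ν _ _ (n + 1)).measurableSet) n)
  have hDu : ⋃ n, D n = A := by
    rw [← Set.inter_iUnion, iUnion_disjointed]
    exact Set.inter_eq_left.2 hQ
  have hDd : Pairwise (Function.onFun Disjoint D) := fun i j hij ↦
    ((disjoint_disjointed _ hij).mono Set.inter_subset_right Set.inter_subset_right)
  have hit : ∀ n, MeasurableSet {y | ∃ x ∈ D n, FlowsTo I Y t x y} ∧
      ν {y | ∃ x ∈ D n, FlowsTo I Y t x y} = ν (D n) := by
    intro n
    have hcancel : ((n + 1 : ℕ) : ℝ) * (t / (n + 1 : ℕ)) = t := by field_simp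
    have h1 := measure_flow_iterate (ν := ν) (R := regularSet I H) (τ := t / (n + 1 : ℕ)) hY hH
      (n + 1) (hDm n) (Set.inter_subset_right.trans (disjointed_subset _ n))
      (by rw [hcancel]; exact fun x hx ↦ hAf x hx.1)
    rwa [hcancel] at h1
  have himg : {y | ∃ x ∈ A, FlowsTo I Y t x y} = ⋃ n, {y | ∃ x ∈ D n, FlowsTo I Y t x y} := by
    ext y
    simp only [Set.mem_iUnion, Set.mem_ofPred_eq]
    constructor
    · rintro ⟨x, hx, hxy⟩
      rw [← hDu, Set.mem_iUnion] at hx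
      obtain ⟨n, hn⟩ := hx
      exact ⟨n, x, hn, hxy⟩
    · rintro ⟨n, x, hx, hxy⟩
      exact ⟨x, hx.1, hxy⟩
  rw [himg, measure_iUnion _ fun n ↦ (hit n).1]
  · conv_rhs => rw [← hDu, measure_iUnion hDd hDm]
    exact tsum_congr fun n ↦ (hit n).2
  · intro i j hij
    refine Set.disjoint_left.2 ?_
    rintro y ⟨x, hx, hxy⟩ ⟨x', hx', hxy'⟩
    obtain rfl := hxy.injective hY hH hxy'
    exact Set.disjoint_left.1 (hDd hij) hx hx'

end Invariance

/-! ### Canonical coordinates on the cotangent bundle -/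

section CotangentCharts

variable {N : ℕ} {M : Type*} [TopologicalSpace M] [ChartedSpace (EuclideanSpace ℝ (Fin N)) M]
  [IsManifold (𝓡 N) ∞ M]

lemma cotangent_extChartAt_source (c : CotangentBundle N M) :
    (extChartAt (cotangentModel N) c).source =
      {z | z.proj ∈ (extChartAt (𝓡 N) c.proj).source} := by
  rw [FiberBundle.extChartAt]
  ext z
  simp only [PartialEquiv.trans_source, PartialEquiv.prod_source, PartialEquiv.refl_source,
    Set.mem_inter_iff, Set.mem_preimage, Set.mem_prod, Set.mem_univ, and_true,
    Trivialization.mem_source]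
  refine ⟨fun h ↦ h.2, fun h ↦ ⟨⟨?_, trivial⟩, h⟩⟩
  rw [Set.mem_ofPred_eq, extChartAt_source] at h
  exact h

lemma cotangent_extChartAt_fst (c z : CotangentBundle N M) :
    (extChartAt (cotangentModel N) c z).1 = extChartAt (𝓡 N) c.proj z.proj := by
  rw [FiberBundle.extChartAt]
  rfl

/-- The canonical momentum coordinates of a covector `p` at `q`: the pullback of `p` under the
inverse of the chart of the base. -/
lemma cotangent_extChartAt_snd {c z : CotangentBundle N M}
    (hz : z.proj ∈ (extChartAt (𝓡 N) c.proj).source) (a : EuclideanSpace ℝ (Fin N)) :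
    (extChartAt (cotangentModel N) c z).2 a =
      z.snd (mfderiv 𝓘(ℝ, EuclideanSpace ℝ (Fin N)) (𝓡 N) (extChartAt (𝓡 N) c.proj).symm
        (extChartAt (𝓡 N) c.proj z.proj) a) := by
  rw [FiberBundle.extChartAt]
  have h1 : (trivializationAt (EuclideanSpace ℝ (Fin N)) (TangentSpace (𝓡 N)) c.proj).symmL ℝ
      z.proj = mfderivWithin 𝓘(ℝ, EuclideanSpace ℝ (Fin N)) (𝓡 N) (extChartAt (𝓡 N) c.proj).symm
        (Set.range (𝓡 N)) (extChartAt (𝓡 N) c.proj z.proj) :=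
    TangentBundle.symmL_trivializationAt (by rwa [extChartAt_source] at hz)
  rw [(𝓡 N).range_eq_univ, mfderivWithin_univ] at h1
  refine (DFunLike.congr_fun (Bundle.Trivial.continuousLinearMapAt_trivialization ℝ M ℝ z.proj)
    (z.snd ((trivializationAt (EuclideanSpace ℝ (Fin N)) (TangentSpace (𝓡 N)) c.proj).symmL ℝ
      z.proj a))).trans ?_
  exact congrArg z.snd (DFunLike.congr_fun h1 a)

lemma cotangent_extChartAt_target (c : CotangentBundle N M) :
    (extChartAt (cotangentModel N) c).target =
      (extChartAt (𝓡 N) c.proj).target ×ˢ Set.univ := by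
  rw [FiberBundle.extChartAt_target]
  congr 1
  refine Set.inter_eq_left.2 fun y hy ↦ ⟨?_, trivial⟩
  have := (extChartAt (𝓡 N) c.proj).map_target hy
  rw [extChartAt_source] at this
  exact this

lemma cotangent_extChartAt_symm_proj {c : CotangentBundle N M}
    {y : EuclideanSpace ℝ (Fin N) × (EuclideanSpace ℝ (Fin N) →L[ℝ] ℝ)}
    (hy : y ∈ (extChartAt (cotangentModel N) c).target) :
    ((extChartAt (cotangentModel N) c).symm y).proj = (extChartAt (𝓡 N) c.proj).symm y.1 := by
  have h1 := (extChartAt (cotangentModel N) c).map_target hy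
  rw [cotangent_extChartAt_source] at h1
  have h2 := cotangent_extChartAt_fst c ((extChartAt (cotangentModel N) c).symm y)
  rw [(extChartAt (cotangentModel N) c).right_inv hy] at h2
  rw [h2, (extChartAt (𝓡 N) c.proj).left_inv h1]

lemma continuous_cotangent_proj : Continuous fun z : CotangentBundle N M ↦ z.proj :=
  FiberBundle.continuous_proj (EuclideanSpace ℝ (Fin N) →L[ℝ] ℝ)
    (fun q : M ↦ TangentSpace (𝓡 N) q →L[ℝ] ℝ)

instance [T2Space M] : T2Space (CotangentBundle N M) := by
  refine (t2Space_iff _).2 fun z z' hne ↦ ?_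
  by_cases h : z.proj = z'.proj
  · have hz : z ∈ (extChartAt (cotangentModel N) z).source := mem_extChartAt_source z
    have hz' : z' ∈ (extChartAt (cotangentModel N) z).source := by
      rw [cotangent_extChartAt_source] at hz ⊢
      rwa [Set.mem_ofPred_eq, ← h]
    obtain ⟨u, v, hu, hv, hzu, hzv, huv⟩ := t2_separation
      (fun he ↦ hne ((extChartAt (cotangentModel N) z).injOn hz hz' he))
    refine ⟨_, _, (continuousOn_extChartAt z).isOpen_inter_preimage
      (isOpen_extChartAt_source (I := cotangentModel N) z) hu,
      (continuousOn_extChartAt z).isOpen_inter_preimage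
      (isOpen_extChartAt_source (I := cotangentModel N) z) hv, ⟨hz, hzu⟩, ⟨hz', hzv⟩, ?_⟩
    exact (huv.preimage _).mono Set.inter_subset_right Set.inter_subset_right
  · obtain ⟨u, v, hu, hv, hzu, hzv, huv⟩ := t2_separation h
    exact ⟨_, _, hu.preimage continuous_cotangent_proj, hv.preimage continuous_cotangent_proj,
      hzu, hzv, huv.preimage _⟩

instance [SecondCountableTopology M] : SecondCountableTopology (CotangentBundle N M) := by
  obtain ⟨s, hs, hsu⟩ := TopologicalSpace.countable_cover_nhds
    (fun x : M ↦ chart_source_mem_nhds (EuclideanSpace ℝ (Fin N)) x)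
  have : SecondCountableTopology
      (ModelProd (EuclideanSpace ℝ (Fin N)) (EuclideanSpace ℝ (Fin N) →L[ℝ] ℝ)) :=
    inferInstanceAs (SecondCountableTopology
      (EuclideanSpace ℝ (Fin N) × (EuclideanSpace ℝ (Fin N) →L[ℝ] ℝ)))
  refine ChartedSpace.secondCountable_of_countable_cover
    (ModelProd (EuclideanSpace ℝ (Fin N)) (EuclideanSpace ℝ (Fin N) →L[ℝ] ℝ))
    (s := (fun q : M ↦ (⟨q, 0⟩ : CotangentBundle N M)) '' s) ?_ (hs.image _)
  refine Set.eq_univ_of_forall fun z ↦ ?_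
  have hz : z.proj ∈ ⋃ x ∈ s, (chartAt (EuclideanSpace ℝ (Fin N)) x).source := by
    rw [hsu]; trivial
  simp only [Set.mem_iUnion] at hz
  obtain ⟨x, hx, hzx⟩ := hz
  simp only [Set.mem_iUnion]
  refine ⟨⟨x, 0⟩, ⟨x, hx, rfl⟩, ?_⟩
  rw [← extChartAt_source (cotangentModel N), cotangent_extChartAt_source, Set.mem_ofPred_eq,
    extChartAt_source]
  exact hzx

instance : LocallyCompactSpace (CotangentBundle N M) :=
  Manifold.locallyCompact_of_finiteDimensional (cotangentModel N)

end CotangentCharts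

/-! ### The symplectic form of the model space -/

section Symplectic

/-- The model space `ℝ^N × (ℝ^N)*` of the cotangent bundle. -/
abbrev PhaseSpace (N : ℕ) : Type :=
  EuclideanSpace ℝ (Fin N) × (EuclideanSpace ℝ (Fin N) →L[ℝ] ℝ)

variable {N : ℕ}

variable (N) in
/-- The tautological one-form `(u, π) ↦ π du` of the model space, as a linear function of the
base point. -/
def modelTautologicalForm : PhaseSpace N →L[ℝ] (PhaseSpace N →L[ℝ] ℝ) :=
  (ContinuousLinearMap.precomp ℝ (ContinuousLinearMap.fst ℝ (EuclideanSpace ℝ (Fin N))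
    (EuclideanSpace ℝ (Fin N) →L[ℝ] ℝ))).comp
    (ContinuousLinearMap.snd ℝ (EuclideanSpace ℝ (Fin N)) (EuclideanSpace ℝ (Fin N) →L[ℝ] ℝ))

@[simp] lemma modelTautologicalForm_apply (y v : PhaseSpace N) :
    modelTautologicalForm N y v = y.2 v.1 := rfl

/-- The canonical symplectic form `dp_i ∧ dq^i` of the model space. -/
def modelSymplecticForm (u v : PhaseSpace N) : ℝ := u.2 v.1 - v.2 u.1

variable (N) in
/-- The linear map that takes a covector `γ` of the model space to the vector `u` with
`ω (u, ·) = - γ`. -/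
def modelHamiltonianMap : (PhaseSpace N →L[ℝ] ℝ) →L[ℝ] PhaseSpace N :=
  (∑ i, (ContinuousLinearMap.apply ℝ ℝ
      ((0, continuousDualBasis (EuclideanSpace.basisFun (Fin N) ℝ).toBasis i) :
        PhaseSpace N)).smulRight ((EuclideanSpace.basisFun (Fin N) ℝ).toBasis i)).prod
    (ContinuousLinearMap.precomp ℝ (-ContinuousLinearMap.inl ℝ (EuclideanSpace ℝ (Fin N))
      (EuclideanSpace ℝ (Fin N) →L[ℝ] ℝ)))

lemma modelHamiltonianMap_fst (γ : PhaseSpace N →L[ℝ] ℝ) : (modelHamiltonianMap N γ).1 =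
    ∑ i, γ (0, continuousDualBasis (EuclideanSpace.basisFun (Fin N) ℝ).toBasis i) •
      (EuclideanSpace.basisFun (Fin N) ℝ).toBasis i := by
  simp only [modelHamiltonianMap, ContinuousLinearMap.prod_apply, sum_apply,
    ContinuousLinearMap.smulRight_apply, ContinuousLinearMap.apply_apply]

lemma modelHamiltonianMap_snd_apply (γ : PhaseSpace N →L[ℝ] ℝ) (b : EuclideanSpace ℝ (Fin N)) :
    (modelHamiltonianMap N γ).2 b = -γ (b, 0) :=
  map_neg γ (b, 0)

lemma continuousDualBasis_repr {ι : Type*} [Fintype ι] [DecidableEq ι] {V : Type*}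
    [AddCommGroup V] [Module ℝ V] [TopologicalSpace V] [IsTopologicalAddGroup V]
    [ContinuousSMul ℝ V] [T2Space V] [FiniteDimensional ℝ V] (b : Basis ι ℝ V)
    (β : V →L[ℝ] ℝ) (i : ι) : (continuousDualBasis b).repr β i = β (b i) := by
  simp [continuousDualBasis]

lemma modelSymplecticForm_hamiltonianMap (γ : PhaseSpace N →L[ℝ] ℝ) (v : PhaseSpace N) :
    modelSymplecticForm (modelHamiltonianMap N γ) v = - γ v := by
  obtain ⟨b, β⟩ := v
  have hβ := (continuousDualBasis (EuclideanSpace.basisFun (Fin N) ℝ).toBasis).sum_repr β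
  have h1 : γ (0, β) = ∑ i, β ((EuclideanSpace.basisFun (Fin N) ℝ).toBasis i) *
      γ (0, continuousDualBasis (EuclideanSpace.basisFun (Fin N) ℝ).toBasis i) := by
    have h2 : ((0 : EuclideanSpace ℝ (Fin N)), β) = ContinuousLinearMap.inr ℝ _ _ β := rfl
    rw [h2]
    conv_lhs => rw [← hβ]
    rw [map_sum, map_sum]
    refine Finset.sum_congr rfl fun i _ ↦ ?_
    rw [map_smul, map_smul, continuousDualBasis_repr]
    rfl
  have h3 : γ (b, β) = γ (b, 0) + γ (0, β) := by
    rw [← map_add]; simp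
  rw [h3, h1]
  rw [modelSymplecticForm, modelHamiltonianMap_fst, modelHamiltonianMap_snd_apply, map_sum,
    neg_add, sub_eq_add_neg]
  congr 2
  refine Finset.sum_congr rfl fun i _ ↦ ?_
  rw [map_smul, smul_eq_mul, mul_comm]

/-- The canonical symplectic form is nondegenerate. -/
lemma modelSymplecticForm_left_injective {u u' : PhaseSpace N}
    (h : ∀ v, modelSymplecticForm u v = modelSymplecticForm u' v) : u = u' := by
  refine Prod.ext ?_ ?_
  · have h1 : ∀ β : EuclideanSpace ℝ (Fin N) →L[ℝ] ℝ, β u.1 = β u'.1 := fun β ↦ by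
      simpa [modelSymplecticForm] using h (0, β)
    exact (SeparatingDual.eq_iff_forall_dual_eq (R := ℝ)).2 h1
  · ext b
    simpa [modelSymplecticForm] using h (b, 0)

lemma modelHamiltonianMap_antisymm (α β : PhaseSpace N →L[ℝ] ℝ) :
    α (modelHamiltonianMap N β) = - β (modelHamiltonianMap N α) := by
  rw [← modelSymplecticForm_hamiltonianMap, ← neg_inj, ← modelSymplecticForm_hamiltonianMap]
  simp only [modelSymplecticForm]
  ring

/-- A linear map preserving the symplectic form preserves the volume. -/
lemma abs_det_eq_one_of_modelSymplecticForm (T : PhaseSpace N →L[ℝ] PhaseSpace N)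
    (hT : ∀ u v, modelSymplecticForm (T u) (T v) = modelSymplecticForm u v) : |T.det| = 1 := by
  let B : LinearMap.BilinForm ℝ (PhaseSpace N) := LinearMap.mk₂ ℝ modelSymplecticForm
    (fun u u' v ↦ by simp [modelSymplecticForm]; ring)
    (fun c u v ↦ by simp [modelSymplecticForm]; ring)
    (fun u v v' ↦ by simp [modelSymplecticForm]; ring)
    (fun c u v ↦ by simp [modelSymplecticForm]; ring)
  have hB : ∀ u v, B u v = modelSymplecticForm u v := fun u v ↦ rfl
  let b := canonicalBasis N
  have hcomp : B.comp T.toLinearMap T.toLinearMap = B := by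
    refine LinearMap.ext fun u ↦ LinearMap.ext fun v ↦ ?_
    exact hT u v
  have hnd : B.Nondegenerate := by
    refine ⟨fun u hu ↦ ?_, fun v hv ↦ ?_⟩
    · refine modelSymplecticForm_left_injective fun v ↦ ?_
      rw [← hB, hu v]
      simp [modelSymplecticForm]
    · refine modelSymplecticForm_left_injective fun u ↦ ?_
      have h1 := hv u
      rw [hB] at h1
      simp only [modelSymplecticForm] at h1 ⊢
      simp only [Prod.snd_zero, Prod.fst_zero, map_zero]
      simp
      linarith
  -- if `S` is the matrix of the form, then `Tᵀ S T = S` and `det S ≠ 0`, so `(det T)² = 1`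
  have h1 := LinearMap.BilinForm.toMatrix_comp b b B T.toLinearMap T.toLinearMap
  rw [hcomp] at h1
  have h2 := congrArg Matrix.det h1
  rw [Matrix.det_mul, Matrix.det_mul, Matrix.det_transpose, LinearMap.det_toMatrix] at h2
  have h3 := (LinearMap.BilinForm.nondegenerate_iff_det_ne_zero b).1 hnd
  have h4 : (T.det) ^ 2 = 1 := by
    have h5 : T.det = LinearMap.det T.toLinearMap := rfl
    rw [h5]
    have h6 := mul_right_cancel₀ h3 (show (1 : ℝ) * _ = (LinearMap.det T.toLinearMap) ^ 2 * _ by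
      rw [one_mul]
      refine h2.trans ?_
      ring)
    exact h6.symm
  rcases sq_eq_one_iff.1 h4 with h | h <;> rw [h] <;> simp

variable {M : Type*} [TopologicalSpace M] [ChartedSpace (EuclideanSpace ℝ (Fin N)) M]
  [IsManifold (𝓡 N) ∞ M]

/-- In canonical coordinates, the tautological one-form is `p_i dq^i`. -/
lemma oneFormInChart_tautologicalForm {c : CotangentBundle N M} {y : PhaseSpace N}
    (hy : y ∈ (extChartAt (cotangentModel N) c).target) :
    oneFormInChart (cotangentModel N) tautologicalForm c y = modelTautologicalForm N y := by
  refine ContinuousLinearMap.ext fun v ↦ ?_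
  set z := (extChartAt (cotangentModel N) c).symm y with hz
  have hzs : z.proj ∈ (extChartAt (𝓡 N) c.proj).source := by
    have h1 := (extChartAt (cotangentModel N) c).map_target hy
    rwa [cotangent_extChartAt_source] at h1
  have hy1 : y.1 ∈ (extChartAt (𝓡 N) c.proj).target := by
    rw [cotangent_extChartAt_target] at hy
    exact hy.1
  have hzy : extChartAt (cotangentModel N) c z = y := (extChartAt (cotangentModel N) c).right_inv hy
  have hcoord : extChartAt (𝓡 N) c.proj z.proj = y.1 := by
    rw [← cotangent_extChartAt_fst, hzy]
  -- the projection of the inverse of the chart is the inverse of the chart of the base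
  have hproj : (fun z : CotangentBundle N M ↦ z.proj) ∘ (extChartAt (cotangentModel N) c).symm =ᶠ[𝓝 y]
      (extChartAt (𝓡 N) c.proj).symm ∘ Prod.fst := by
    filter_upwards [(isOpen_extChartAt_target c).mem_nhds hy] with w hw
    exact cotangent_extChartAt_symm_proj hw
  have hd1 : MDifferentiableAt (cotangentModel N) (𝓡 N) (fun z : CotangentBundle N M ↦ z.proj) z :=
    (contMDiffAt_proj (n := ∞) (fun q : M ↦ TangentSpace (𝓡 N) q →L[ℝ] ℝ)).mdifferentiableAt
      (by simp)
  have h1 := mfderiv_comp y hd1 (mdifferentiableAt_extChartAt_symm_of_mem (cotangentModel N) hy)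
  have h2 := mfderiv_comp (I := 𝓘(ℝ, PhaseSpace N)) (I' := 𝓘(ℝ, EuclideanSpace ℝ (Fin N)))
    y (f := Prod.fst)
    (mdifferentiableAt_extChartAt_symm_of_mem (𝓡 N) hy1) differentiableAt_fst.mdifferentiableAt
  have h3 := hproj.mfderiv_eq (I := 𝓘(ℝ, PhaseSpace N)) (I' := 𝓡 N)
  have h4 := DFunLike.congr_fun (h1.symm.trans (h3.trans h2)) v
  have h5 : (mfderiv 𝓘(ℝ, PhaseSpace N) 𝓘(ℝ, EuclideanSpace ℝ (Fin N)) Prod.fst y :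
      PhaseSpace N →L[ℝ] EuclideanSpace ℝ (Fin N)) v = v.1 := by
    rw [mfderiv_eq_fderiv, fderiv_fst]
    rfl
  have h6 : tautologicalForm z (mfderiv 𝓘(ℝ, PhaseSpace N) (cotangentModel N)
      (extChartAt (cotangentModel N) c).symm y v) =
      z.snd (mfderiv 𝓘(ℝ, EuclideanSpace ℝ (Fin N)) (𝓡 N) (extChartAt (𝓡 N) c.proj).symm
        y.1 v.1) := by
    refine congrArg z.snd (h4.trans ?_)
    exact congrArg (mfderiv 𝓘(ℝ, EuclideanSpace ℝ (Fin N)) (𝓡 N) (extChartAt (𝓡 N) c.proj).symm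
        y.1) h5
  refine h6.trans ?_
  have h7 := cotangent_extChartAt_snd hzs v.1
  rw [hcoord, hzy] at h7
  rw [modelTautologicalForm_apply]
  exact h7.symm

end Symplectic

/-! ### The symplectic form in canonical coordinates -/

/-- If a local diffeomorphism `τ` pulls back the linear one-form `L` to itself, then it preserves
its exterior derivative: the second derivatives of `τ` cancel. -/
lemma pullback_exteriorDerivative_eq {F : Type*} [NormedAddCommGroup F] [NormedSpace ℝ F]
    (L : F →L[ℝ] F →L[ℝ] ℝ) {τ : F → F} {y : F} (hτ : ContDiffAt ℝ ∞ τ y)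
    (h : ∀ w, ∀ᶠ z in 𝓝 y, L z w = L (τ z) (fderiv ℝ τ z w)) (u v : F) :
    L (fderiv ℝ τ y u) (fderiv ℝ τ y v) - L (fderiv ℝ τ y v) (fderiv ℝ τ y u) =
      L u v - L v u := by
  have hd1 : DifferentiableAt ℝ τ y := hτ.differentiableAt (by simp)
  have hd2 : DifferentiableAt ℝ (fderiv ℝ τ) y :=
    (hτ.fderiv_right (m := 1) (by exact WithTop.coe_le_coe.2 le_top)).differentiableAt (by simp)
  have hsymm := (hτ.isSymmSndFDerivAt
    (by rw [minSmoothness_of_isRCLikeNormedField]; exact WithTop.coe_le_coe.2 le_top)).eq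
  have key : ∀ u w : F, L u w = L (fderiv ℝ τ y u) (fderiv ℝ τ y w) +
      L (τ y) (fderiv ℝ (fderiv ℝ τ) y u w) := by
    intro u w
    have h1 : HasFDerivAt (fun z ↦ L z w) (L.flip w) y := (L.flip w).hasFDerivAt
    have h2 := (L.hasFDerivAt.comp y hd1.hasFDerivAt).clm_apply
      (hd2.hasFDerivAt.clm_apply (hasFDerivAt_const w y))
    -- differentiate the identity `L z w = L (τ z) (Dτ_z w)` in the direction `u`
    have h3 := (h2.congr_of_eventuallyEq (h w)).unique h1
    have h4 := DFunLike.congr_fun h3 u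
    simp only [add_apply, ContinuousLinearMap.comp_apply,
      ContinuousLinearMap.flip_apply, Function.comp_apply, zero_apply,
      map_zero, zero_add] at h4
    linarith
  have e1 := key u v
  have e2 := key v u
  rw [hsymm v u] at e2
  linarith

lemma Filter.EventuallyEq.fderiv_apply_apply {F : Type*} [NormedAddCommGroup F] [NormedSpace ℝ F]
    {L : F →L[ℝ] F →L[ℝ] ℝ} {a : F → F →L[ℝ] ℝ} {y : F} (h : a =ᶠ[𝓝 y] L) (u v : F) :
    fderiv ℝ a y u v = L u v := by
  rw [h.fderiv_eq, ContinuousLinearMap.fderiv]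

section SymplecticCharts

variable {N : ℕ} {M : Type*} [TopologicalSpace M] [ChartedSpace (EuclideanSpace ℝ (Fin N)) M]
  [IsManifold (𝓡 N) ∞ M]

/-- The coordinate changes between canonical coordinates are symplectic: the tautological one-form
has the same expression in both, and the second derivatives of the coordinate change cancel in its
exterior derivative. -/
lemma modelSymplecticForm_coordChange {c c' : CotangentBundle N M} {y : PhaseSpace N}
    (hy : y ∈ (extChartAt (cotangentModel N) c).target)
    (hy' : (extChartAt (cotangentModel N) c).symm y ∈ (extChartAt (cotangentModel N) c').source)
    (u v : PhaseSpace N) :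
    modelSymplecticForm
      (fderiv ℝ (extChartAt (cotangentModel N) c' ∘ (extChartAt (cotangentModel N) c).symm) y u)
      (fderiv ℝ (extChartAt (cotangentModel N) c' ∘ (extChartAt (cotangentModel N) c).symm) y v) =
    modelSymplecticForm u v := by
  set τ := extChartAt (cotangentModel N) c' ∘ (extChartAt (cotangentModel N) c).symm with hτ
  have hcd : ContDiffAt ℝ ∞ τ y := contDiffAt_coordChange (cotangentModel N) hy hy'
  have hO : IsOpen ((extChartAt (cotangentModel N) c).target ∩
      (extChartAt (cotangentModel N) c).symm ⁻¹' (extChartAt (cotangentModel N) c').source) :=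
    (continuousOn_extChartAt_symm c).isOpen_inter_preimage (isOpen_extChartAt_target c)
      (isOpen_extChartAt_source c')
  have hnat : ∀ w : PhaseSpace N, ∀ᶠ z in 𝓝 y,
      modelTautologicalForm N z w = modelTautologicalForm N (τ z) (fderiv ℝ τ z w) := by
    intro w
    filter_upwards [hO.mem_nhds ⟨hy, hy'⟩] with z hz
    have ht : τ z ∈ (extChartAt (cotangentModel N) c').target :=
      (extChartAt (cotangentModel N) c').map_source hz.2
    -- both sides are the tautological form on the same tangent vector of the cotangent bundle
    rw [← oneFormInChart_tautologicalForm hz.1, ← oneFormInChart_tautologicalForm ht]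
    have h1 := mfderiv_extChartAt_symm_eq_comp (cotangentModel N) hz.1 hz.2 w
    have h2 : (extChartAt (cotangentModel N) c').symm (τ z) =
        (extChartAt (cotangentModel N) c).symm z := (extChartAt (cotangentModel N) c').left_inv hz.2
    have h3 : ∀ x x' : CotangentBundle N M, x = x' → ∀ t : PhaseSpace N,
        (tautologicalForm x : PhaseSpace N →L[ℝ] ℝ) t =
          (tautologicalForm x' : PhaseSpace N →L[ℝ] ℝ) t := by
      rintro x _ rfl t
      rfl
    exact (congrArg (tautologicalForm ((extChartAt (cotangentModel N) c).symm z)) h1).trans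
      (h3 _ _ h2.symm _)
  exact pullback_exteriorDerivative_eq (modelTautologicalForm N) hcd hnat u v

/-- In all canonical coordinates, the canonical symplectic form is `dp_i ∧ dq^i`. -/
lemma symplecticForm_eq {c x : CotangentBundle N M}
    (hx : x ∈ (extChartAt (cotangentModel N) c).source) (u v : TangentSpace (cotangentModel N) x) :
    symplecticForm x u v = modelSymplecticForm
      (mfderiv (cotangentModel N) 𝓘(ℝ, PhaseSpace N) (extChartAt (cotangentModel N) c) x u)
      (mfderiv (cotangentModel N) 𝓘(ℝ, PhaseSpace N) (extChartAt (cotangentModel N) c) x v) := by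
  have hxx := mem_extChartAt_source (I := cotangentModel N) x
  have h1 : oneFormInChart (cotangentModel N) tautologicalForm x =ᶠ[𝓝
      (extChartAt (cotangentModel N) x x)] modelTautologicalForm N := by
    filter_upwards [(isOpen_extChartAt_target x).mem_nhds (mem_extChartAt_target x)] with y hy
    exact oneFormInChart_tautologicalForm hy
  have h2 : symplecticForm x u v = modelSymplecticForm
      (mfderiv (cotangentModel N) 𝓘(ℝ, PhaseSpace N) (extChartAt (cotangentModel N) x) x u)
      (mfderiv (cotangentModel N) 𝓘(ℝ, PhaseSpace N) (extChartAt (cotangentModel N) x) x v) := by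
    exact congrArg₂ (fun a b : ℝ ↦ a - b) (h1.fderiv_apply_apply _ _) (h1.fderiv_apply_apply _ _)
  rw [h2, ← fderiv_coordChange_apply_mfderiv_extChartAt (cotangentModel N) hxx hx u,
    ← fderiv_coordChange_apply_mfderiv_extChartAt (cotangentModel N) hxx hx v]
  refine (modelSymplecticForm_coordChange (mem_extChartAt_target x) ?_ _ _).symm
  rwa [extChartAt_to_inv]

lemma abs_det_coordChange_eq_one {c c' : CotangentBundle N M} {y : PhaseSpace N}
    (hy : y ∈ (extChartAt (cotangentModel N) c).target)
    (hy' : (extChartAt (cotangentModel N) c).symm y ∈ (extChartAt (cotangentModel N) c').source) :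
    |(fderiv ℝ (extChartAt (cotangentModel N) c' ∘
      (extChartAt (cotangentModel N) c).symm) y).det| = 1 :=
  abs_det_eq_one_of_modelSymplecticForm _ (modelSymplecticForm_coordChange hy hy')

/-- In canonical coordinates, a Hamiltonian vector field satisfies Hamilton's equations. -/
lemma isHamiltonianInCharts_of_isHamiltonianVectorField {H : CotangentBundle N M → ℝ}
    (hH : ContMDiff (cotangentModel N) 𝓘(ℝ, ℝ) ∞ H)
    {Y : ∀ x : CotangentBundle N M, TangentSpace (cotangentModel N) x}
    (hY : IsHamiltonianVectorField H Y) :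
    IsHamiltonianInCharts (cotangentModel N) (modelHamiltonianMap N) H Y := by
  intro c x hx
  refine modelSymplecticForm_left_injective fun v ↦ ?_
  rw [modelSymplecticForm_hamiltonianMap]
  have hs := mfderiv_extChartAt_apply_mfderiv_extChartAt_symm (cotangentModel N)
    ((extChartAt (cotangentModel N) c).map_source hx) v
  rw [(extChartAt (cotangentModel N) c).left_inv hx] at hs
  have h1 := hY x (mfderiv 𝓘(ℝ, PhaseSpace N) (cotangentModel N)
    (extChartAt (cotangentModel N) c).symm (extChartAt (cotangentModel N) c x) v)
  have h2 := mfderiv_apply_eq_fderiv hH hx (mfderiv 𝓘(ℝ, PhaseSpace N) (cotangentModel N)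
    (extChartAt (cotangentModel N) c).symm (extChartAt (cotangentModel N) c x) v)
  have h3 := symplecticForm_eq hx (Y x) (mfderiv 𝓘(ℝ, PhaseSpace N) (cotangentModel N)
    (extChartAt (cotangentModel N) c).symm (extChartAt (cotangentModel N) c x) v)
  have h4 := h3.symm.trans (h1.trans (congrArg Neg.neg h2))
  have h5 := congrArg (fun w : PhaseSpace N ↦ - fderiv ℝ (H ∘ (extChartAt (cotangentModel N) c).symm)
    (extChartAt (cotangentModel N) c x) w) hs
  have h6 := congrArg (fun w : PhaseSpace N ↦ modelSymplecticForm (mfderiv (cotangentModel N)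
    𝓘(ℝ, PhaseSpace N) (extChartAt (cotangentModel N) c) x (Y x)) w) hs
  exact h6.symm.trans (h4.trans h5)

lemma existsUnique_isHamiltonianVectorField {H : CotangentBundle N M → ℝ}
    (hH : ContMDiff (cotangentModel N) 𝓘(ℝ, ℝ) ∞ H) :
    ∃! Y : ∀ x : CotangentBundle N M, TangentSpace (cotangentModel N) x,
      IsHamiltonianVectorField H Y := by
  refine ⟨fun x ↦ mfderiv 𝓘(ℝ, PhaseSpace N) (cotangentModel N)
    (extChartAt (cotangentModel N) x).symm (extChartAt (cotangentModel N) x x)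
    (modelHamiltonianMap N (fderiv ℝ (H ∘ (extChartAt (cotangentModel N) x).symm)
      (extChartAt (cotangentModel N) x x))), ?_, ?_⟩
  · intro x w
    have hx := mem_extChartAt_source (I := cotangentModel N) x
    refine (symplecticForm_eq hx _ w).trans ?_
    have hs := mfderiv_extChartAt_apply_mfderiv_extChartAt_symm (cotangentModel N)
      ((extChartAt (cotangentModel N) x).map_source hx)
      (modelHamiltonianMap N (fderiv ℝ (H ∘ (extChartAt (cotangentModel N) x).symm)
        (extChartAt (cotangentModel N) x x)))
    rw [(extChartAt (cotangentModel N) x).left_inv hx] at hs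
    refine (congrArg (fun u : PhaseSpace N ↦ modelSymplecticForm u
      (mfderiv (cotangentModel N) 𝓘(ℝ, PhaseSpace N) (extChartAt (cotangentModel N) x) x w))
      hs).trans ?_
    refine (modelSymplecticForm_hamiltonianMap _ _).trans ?_
    exact congrArg Neg.neg (mfderiv_apply_eq_fderiv hH hx w).symm
  · intro Y hY
    funext x
    have hx := mem_extChartAt_source (I := cotangentModel N) x
    have h1 := isHamiltonianInCharts_of_isHamiltonianVectorField hH hY x x hx
    have h2 := mfderiv_extChartAt_symm_apply_mfderiv_extChartAt (cotangentModel N) hx (Y x)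
    rw [← h1]
    exact h2.symm

end SymplecticCharts

/-! ### The top exterior power of the symplectic form -/

section Wedge

variable {N : ℕ}

/-- The permutation of the index set of the canonical basis which permutes the index pairs
`(q^i, p_i)` by `x.1` and interchanges the two members of the pair `i` if `x.2 i` holds. -/
def pairPerm (x : Equiv.Perm (Fin N) × (Fin N → Bool)) : Equiv.Perm (Fin N ⊕ Fin N) :=
  Equiv.sumCongr x.1 x.1 * (Equiv.boolProdEquivSum (Fin N)).permCongr
    (Equiv.prodCongrLeft fun i ↦ if x.2 i then Equiv.boolNot else 1)

lemma pairPerm_inl (x : Equiv.Perm (Fin N) × (Fin N → Bool)) (i : Fin N) :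
    pairPerm x (Sum.inl i) = if x.2 i then Sum.inr (x.1 i) else Sum.inl (x.1 i) := by
  rcases h : x.2 i <;> simp [pairPerm, Equiv.permCongr_apply, h]

lemma pairPerm_inr (x : Equiv.Perm (Fin N) × (Fin N → Bool)) (i : Fin N) :
    pairPerm x (Sum.inr i) = if x.2 i then Sum.inl (x.1 i) else Sum.inr (x.1 i) := by
  rcases h : x.2 i <;> simp [pairPerm, Equiv.permCongr_apply, h]

lemma sign_pairPerm (x : Equiv.Perm (Fin N) × (Fin N → Bool)) :
    ((Equiv.Perm.sign (pairPerm x) : ℤ) : ℝ) = ∏ i, if x.2 i then -1 else 1 := by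
  have h1 : Equiv.Perm.sign (pairPerm x) = ∏ i, if x.2 i then -1 else 1 := by
    rw [pairPerm, Equiv.Perm.sign_mul, Equiv.Perm.sign_sumCongr, Equiv.Perm.sign_permCongr,
      Equiv.Perm.sign_prodCongrLeft]
    rw [Int.units_mul_self, one_mul]
    refine Finset.prod_congr rfl fun i _ ↦ ?_
    split_ifs
    · decide
    · exact Equiv.Perm.sign_one
  rw [h1]
  push_cast
  refine Finset.prod_congr rfl fun i _ ↦ ?_
  split_ifs <;> simp

lemma pairPerm_injective : Function.Injective (pairPerm (N := N)) := by
  rintro ⟨ρ, ε⟩ ⟨ρ', ε'⟩ h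
  have h1 : ∀ i, ρ i = ρ' i ∧ ε i = ε' i := by
    intro i
    have h2 := pairPerm_inl (ρ, ε) i
    rw [h, pairPerm_inl] at h2
    rcases h3 : ε i <;> rcases h4 : ε' i <;> simp_all
  exact Prod.ext (Equiv.ext fun i ↦ (h1 i).1) (funext fun i ↦ (h1 i).2)

/-- The permutations `pairPerm` are exactly those that map index pairs to index pairs. -/
lemma mem_range_pairPerm {σ : Equiv.Perm (Fin N ⊕ Fin N)}
    (h : ∀ i, σ (Sum.inr i) = (σ (Sum.inl i)).swap) : σ ∈ Set.range (pairPerm (N := N)) := by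
  let p : Fin N → Fin N := fun i ↦ (σ (Sum.inl i)).elim id id
  have hp : ∀ i, σ (Sum.inl i) = Sum.inl (p i) ∨ σ (Sum.inl i) = Sum.inr (p i) := by
    intro i
    rcases hi : σ (Sum.inl i) with a | a <;> simp [p, hi]
  have hinj : Function.Injective p := by
    intro i j hij
    have h1 : σ (Sum.inl i) = σ (Sum.inl j) ∨ σ (Sum.inl i) = σ (Sum.inr j) := by
      rw [h j]
      rcases hp i with hi | hi <;> rcases hp j with hj | hj <;> simp [hi, hj, hij]
    rcases h1 with h1 | h1
    · exact Sum.inl_injective (σ.injective h1)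
    · exact absurd (σ.injective h1) (by simp)
  refine ⟨(Equiv.ofBijective p (Finite.injective_iff_bijective.1 hinj),
    fun i ↦ (σ (Sum.inl i)).isRight), ?_⟩
  have hl : ∀ i, pairPerm (Equiv.ofBijective p (Finite.injective_iff_bijective.1 hinj),
      fun i ↦ (σ (Sum.inl i)).isRight) (Sum.inl i) = σ (Sum.inl i) := by
    intro i
    rw [pairPerm_inl]
    rcases hp i with hi | hi <;> simp [hi]
  refine Equiv.ext fun a ↦ ?_
  rcases a with i | i
  · exact hl i
  · rw [pairPerm_inr, h]
    rcases hp i with hi | hi <;> simp [hi]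

lemma canonicalBasis_inl (i : Fin N) : canonicalBasis N (Sum.inl i) =
    ((EuclideanSpace.basisFun (Fin N) ℝ).toBasis i, 0) := by
  refine Prod.ext ?_ ?_
  · exact Basis.prod_apply_inl_fst _ _ _
  · exact Basis.prod_apply_inl_snd _ _ _

lemma canonicalBasis_inr (i : Fin N) : canonicalBasis N (Sum.inr i) =
    (0, continuousDualBasis (EuclideanSpace.basisFun (Fin N) ℝ).toBasis i) := by
  refine Prod.ext ?_ ?_
  · exact Basis.prod_apply_inr_fst _ _ _
  · exact Basis.prod_apply_inr_snd _ _ _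

lemma continuousDualBasis_apply_self {ι : Type*} [Fintype ι] [DecidableEq ι] {V : Type*}
    [AddCommGroup V] [Module ℝ V] [TopologicalSpace V] [IsTopologicalAddGroup V]
    [ContinuousSMul ℝ V] [T2Space V] [FiniteDimensional ℝ V] (b : Basis ι ℝ V) (i j : ι) :
    continuousDualBasis b i (b j) = if j = i then 1 else 0 := by
  simp [continuousDualBasis, Finsupp.single_apply]

lemma modelSymplecticForm_canonicalBasis (a b : Fin N ⊕ Fin N) :
    modelSymplecticForm (canonicalBasis N a) (canonicalBasis N b) =
      if b = a.swap then (if a.isRight then 1 else -1) else 0 := by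
  rcases a with i | i <;> rcases b with j | j <;>
  simp only [canonicalBasis_inl, canonicalBasis_inr, modelSymplecticForm, map_zero,
    zero_apply, continuousDualBasis_apply_self, sub_zero, zero_sub, Sum.swap_inl, Sum.swap_inr,
    Sum.isRight_inl, Sum.isRight_inr, if_true, Sum.inl.injEq, Sum.inr.injEq, reduceCtorEq, if_false,
    sub_self, Bool.false_eq_true, eq_comm (a := i), neg_ite, neg_zero]

/-- Only the permutations that respect the pairs `(q^i, p_i)` contribute to the wedge power of the
canonical form; there are `2^N N!` of them, and they all contribute the same sign. -/
lemma wedgePow_modelSymplecticForm :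
    wedgePow (modelSymplecticForm (N := N)) (canonicalBasis N) = (-1) ^ N * N.factorial := by
  rw [wedgePow, ← Fintype.sum_of_injective pairPerm pairPerm_injective (fun _ ↦ (-1 : ℝ) ^ N)]
  · rw [Finset.sum_const, Finset.card_univ, Fintype.card_prod, Fintype.card_perm, Fintype.card_fun,
      Fintype.card_bool, Fintype.card_fin, nsmul_eq_mul]
    push_cast
    field_simp
  · intro σ hσ
    have h1 : ∃ i, σ (Sum.inr i) ≠ (σ (Sum.inl i)).swap := by
      by_contra! h
      exact hσ (mem_range_pairPerm h)
    obtain ⟨i, hi⟩ := h1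
    rw [Finset.prod_eq_zero (Finset.mem_univ i), mul_zero]
    rw [modelSymplecticForm_canonicalBasis, if_neg hi]
  · intro x
    rw [sign_pairPerm, ← Finset.prod_mul_distrib]
    have h1 : ∀ i, (if x.2 i then (-1 : ℝ) else 1) *
        modelSymplecticForm (canonicalBasis N (pairPerm x (Sum.inl i)))
          (canonicalBasis N (pairPerm x (Sum.inr i))) = -1 := by
      intro i
      rw [modelSymplecticForm_canonicalBasis, pairPerm_inl, pairPerm_inr]
      rcases h : x.2 i <;> simp
    rw [Finset.prod_congr rfl fun i _ ↦ h1 i]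
    simp

end Wedge

/-! ### The Liouville measure in canonical coordinates -/

section Liouville

variable {N : ℕ} {M : Type*} [TopologicalSpace M] [ChartedSpace (EuclideanSpace ℝ (Fin N)) M]
  [IsManifold (𝓡 N) ∞ M]

/-- The density `|Ω^N|` is constant in canonical coordinates. -/
lemma densityInChart_wedgePow {c : CotangentBundle N M} {y : PhaseSpace N}
    (hy : y ∈ (extChartAt (cotangentModel N) c).target) :
    densityInChart (cotangentModel N) (canonicalBasis N)
      (fun x w ↦ |wedgePow (symplecticForm x) w|) c y = N.factorial := by
  have hs := (extChartAt (cotangentModel N) c).map_target hy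
  have h1 : ∀ u v : PhaseSpace N, symplecticForm ((extChartAt (cotangentModel N) c).symm y)
      (mfderiv 𝓘(ℝ, PhaseSpace N) (cotangentModel N) (extChartAt (cotangentModel N) c).symm y u)
      (mfderiv 𝓘(ℝ, PhaseSpace N) (cotangentModel N) (extChartAt (cotangentModel N) c).symm y v) =
      modelSymplecticForm u v := by
    intro u v
    refine (symplecticForm_eq hs _ _).trans ?_
    exact congrArg₂ modelSymplecticForm
      (mfderiv_extChartAt_apply_mfderiv_extChartAt_symm (cotangentModel N) hy u)
      (mfderiv_extChartAt_apply_mfderiv_extChartAt_symm (cotangentModel N) hy v)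
  have h2 : wedgePow (symplecticForm ((extChartAt (cotangentModel N) c).symm y)) (fun i ↦
      mfderiv 𝓘(ℝ, PhaseSpace N) (cotangentModel N) (extChartAt (cotangentModel N) c).symm y
        (canonicalBasis N i)) = wedgePow (modelSymplecticForm (N := N)) (canonicalBasis N) := by
    simp only [wedgePow]
    refine congrArg (_ * ·) (Finset.sum_congr rfl fun σ _ ↦ congrArg (_ * ·)
      (Finset.prod_congr rfl fun i _ ↦ h1 _ _))
  refine (congrArg abs h2).trans ?_
  rw [wedgePow_modelSymplecticForm, abs_mul, abs_pow]
  simp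

/-- The Liouville measure is `N!` times the Lebesgue measure in canonical coordinates. -/
lemma liouvilleMeasure_apply [SecondCountableTopology M] (c : CotangentBundle N M)
    (A : Set (CotangentBundle N M)) (hAc : A ⊆ (extChartAt (cotangentModel N) c).source)
    (hA : MeasurableSet A) :
    liouvilleMeasure N M A = ((N.factorial : ENNReal) • (canonicalBasis N).addHaar)
      (extChartAt (cotangentModel N) c '' A) := by
  rw [liouvilleMeasure, densityMeasure_apply (cotangentModel N) (canonicalBasis N) _ ?_ c hA hAc]
  · rw [setLIntegral_congr_fun (g := fun _ ↦ (N.factorial : ENNReal))]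
    · rw [setLIntegral_const]
      rfl
    · exact ((chartHomeo (cotangentModel N) c).measurableSet_image hA hAc)
    · rintro _ ⟨x, hx, rfl⟩
      dsimp only
      rw [densityInChart_wedgePow ((extChartAt (cotangentModel N) c).map_source (hAc hx)),
        ENNReal.ofReal_natCast]
  · intro c c' y hy hy'
    rw [densityInChart_wedgePow hy, abs_det_coordChange_eq_one hy hy', one_mul,
      densityInChart_wedgePow ((extChartAt (cotangentModel N) c').map_source hy')]

instance : ((N.factorial : ENNReal) • (canonicalBasis N).addHaar).IsAddHaarMeasure :=
  Measure.IsAddHaarMeasure.smul _ (by exact_mod_cast N.factorial_ne_zero) (by simp)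

lemma map_restrict_liouvilleMeasure [SecondCountableTopology M] (c : CotangentBundle N M) :
    ((liouvilleMeasure N M).restrict (extChartAt (cotangentModel N) c).source).map
        (extChartAt (cotangentModel N) c) =
      (N.factorial : ENNReal) •
        (canonicalBasis N).addHaar.restrict (extChartAt (cotangentModel N) c).target := by
  have hsm : MeasurableSet (extChartAt (cotangentModel N) c).source :=
    (isOpen_extChartAt_source c).measurableSet
  have hae : AEMeasurable (extChartAt (cotangentModel N) c)
      ((liouvilleMeasure N M).restrict (extChartAt (cotangentModel N) c).source) :=
    (continuousOn_extChartAt c).aemeasurable hsm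
  refine Measure.ext fun B hB ↦ ?_
  have hms := (continuousOn_extChartAt (I := cotangentModel N) c).measurableSet_inter_preimage hsm hB
  rw [Measure.map_apply_of_aemeasurable hae hB, Measure.restrict_apply₀ (hae.nullMeasurable hB),
    Set.inter_comm, liouvilleMeasure_apply c _ Set.inter_subset_left hms, Measure.smul_apply,
    Measure.smul_apply, Measure.restrict_apply hB,
    (extChartAt (cotangentModel N) c).image_source_inter_eq', Set.inter_comm B]
  congr 2
  ext y
  constructor
  · rintro ⟨h1, h2⟩
    refine ⟨h1, ?_⟩
    have h3 : extChartAt (cotangentModel N) c ((extChartAt (cotangentModel N) c).symm y) ∈ B := h2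
    rwa [(extChartAt (cotangentModel N) c).right_inv h1] at h3
  · rintro ⟨h1, h2⟩
    refine ⟨h1, ?_⟩
    change extChartAt (cotangentModel N) c ((extChartAt (cotangentModel N) c).symm y) ∈ B
    rwa [(extChartAt (cotangentModel N) c).right_inv h1]

lemma finrank_phaseSpace : finrank ℝ (PhaseSpace N) = 2 * N := by
  rw [Module.finrank_eq_card_basis (canonicalBasis N)]
  simp [two_mul]

instance [T2Space M] [SecondCountableTopology M] : IsFiniteMeasureOnCompacts (liouvilleMeasure N M) :=
  isFiniteMeasureOnCompacts_of_forall_chart (I := cotangentModel N)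
    ((N.factorial : ENNReal) • (canonicalBasis N).addHaar) liouvilleMeasure_apply

end Liouville

/-! ### Gram determinants and dual norms -/

section Euclidean

open scoped RealInnerProductSpace

variable {V : Type*} [NormedAddCommGroup V] [InnerProductSpace ℝ V] [FiniteDimensional ℝ V]

/-- The volume of a parallelepiped is the square root of its Gram determinant. -/
lemma sqrt_det_gram {ι : Type*} [Fintype ι] [DecidableEq ι] (o : OrthonormalBasis ι ℝ V)
    (w : ι → V) : √(Matrix.of fun i j ↦ ⟪w i, w j⟫).det = |o.toBasis.det w| := by
  have h1 : (Matrix.of fun i j ↦ ⟪w i, w j⟫) =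
      (o.toBasis.toMatrix w).transpose * o.toBasis.toMatrix w := by
    ext i j
    rw [Matrix.of_apply, Matrix.mul_apply, ← o.sum_inner_mul_inner]
    refine Finset.sum_congr rfl fun k _ ↦ ?_
    rw [Matrix.transpose_apply, Basis.toMatrix_apply, Basis.toMatrix_apply,
      o.coe_toBasis_repr_apply, o.coe_toBasis_repr_apply, o.repr_apply_apply, o.repr_apply_apply,
      real_inner_comm]
  rw [h1, Matrix.det_mul, Matrix.det_transpose, Real.sqrt_mul_self_eq_abs]
  rfl

/-- The Haar measures normalized by two bases differ by the absolute value of the determinant of one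
basis with respect to the other. -/
lemma addHaar_eq_smul_addHaar {G ι : Type*} [Fintype ι] [DecidableEq ι] [NormedAddCommGroup G]
    [NormedSpace ℝ G] [MeasurableSpace G] [BorelSpace G] (b b' : Basis ι ℝ G) :
    b.addHaar = ENNReal.ofReal |b.det b'| • b'.addHaar := by
  have : FiniteDimensional ℝ G := b.finiteDimensional_of_finite
  have h1 := Measure.addHaarMeasure_unique b.addHaar b'.parallelepiped
  rw [← Measure.addHaar_parallelepiped b b', ← Basis.addHaar] at *
  exact h1

/-- Pulling back covectors by a linear isomorphism `T` from `ℝ^N` changes the Lebesgue measure by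
the square root of the Gram determinant of the images of the standard basis vectors. -/
lemma addHaar_image_precomp [MeasurableSpace (V →L[ℝ] ℝ)] [BorelSpace (V →L[ℝ] ℝ)] {N : ℕ}
    (T : EuclideanSpace ℝ (Fin N) ≃L[ℝ] V) (B : Set (V →L[ℝ] ℝ)) :
    (continuousDualBasis (EuclideanSpace.basisFun (Fin N) ℝ).toBasis).addHaar
        ((fun p : V →L[ℝ] ℝ ↦ p.comp (T : EuclideanSpace ℝ (Fin N) →L[ℝ] V)) '' B) =
      ENNReal.ofReal √(Matrix.of fun i j ↦ ⟪T (EuclideanSpace.basisFun (Fin N) ℝ i),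
        T (EuclideanSpace.basisFun (Fin N) ℝ j)⟫).det *
      (continuousDualBasis (stdOrthonormalBasis ℝ V).toBasis).addHaar B := by
  have hdim : finrank ℝ V = N := by
    rw [← T.toLinearEquiv.finrank_eq, finrank_euclideanSpace_fin]
  let o : OrthonormalBasis (Fin N) ℝ V := (stdOrthonormalBasis ℝ V).reindex (finCongr hdim)
  let e := (EuclideanSpace.basisFun (Fin N) ℝ).toBasis
  let Lu : (V →L[ℝ] ℝ) ≃L[ℝ] (EuclideanSpace ℝ (Fin N) →L[ℝ] ℝ) :=
    T.symm.arrowCongr (ContinuousLinearEquiv.refl ℝ ℝ)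
  have hLu : ∀ p, Lu p = p.comp (T : EuclideanSpace ℝ (Fin N) →L[ℝ] V) := fun p ↦ rfl
  -- `o` is the standard orthonormal basis with its indices renamed, so the measures agree
  have hre : (continuousDualBasis o.toBasis).addHaar =
      (continuousDualBasis (stdOrthonormalBasis ℝ V).toBasis).addHaar := by
    have : continuousDualBasis o.toBasis =
        (continuousDualBasis (stdOrthonormalBasis ℝ V).toBasis).reindex (finCongr hdim) := by
      refine Basis.eq_of_apply_eq fun i ↦ ?_
      refine ContinuousLinearMap.coe_injective (o.toBasis.ext fun j ↦ ?_)
      change continuousDualBasis o.toBasis i (o.toBasis j) = _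
      rw [continuousDualBasis_apply_self]
      change _ = (continuousDualBasis (stdOrthonormalBasis ℝ V).toBasis).reindex (finCongr hdim) i
        (o.toBasis j)
      rw [Basis.reindex_apply]
      have h2 : o.toBasis j = (stdOrthonormalBasis ℝ V).toBasis ((finCongr hdim).symm j) := by
        simp [o]
      rw [h2, continuousDualBasis_apply_self]
      simp
    rw [this, Basis.addHaar_reindex]
  have hdet : |(continuousDualBasis e).det ((continuousDualBasis o.toBasis).map Lu.toLinearEquiv)| =
      |o.toBasis.det fun i ↦ T (e i)| := by
    rw [Basis.det_apply, Basis.det_apply, ← Matrix.det_transpose]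
    congr 2
    ext i k
    rw [Matrix.transpose_apply, Basis.toMatrix_apply, Basis.toMatrix_apply,
      continuousDualBasis_repr]
    simp only [Basis.map_apply]
    change (continuousDualBasis o.toBasis i) (T (e k)) = _
    conv_lhs => rw [← o.toBasis.sum_repr (T (e k)), map_sum]
    simp only [map_smul, continuousDualBasis_apply_self, smul_eq_mul, mul_ite, mul_one, mul_zero,
      Finset.sum_ite_eq', Finset.mem_univ, if_true]
  have h1 := addHaar_eq_smul_addHaar (continuousDualBasis e)
    ((continuousDualBasis o.toBasis).map Lu.toLinearEquiv)
  rw [hdet, ← sqrt_det_gram, ← Basis.map_addHaar, hre] at h1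
  rw [h1, Measure.smul_apply, smul_eq_mul]
  congr 1
  · have h2 : MeasurableEmbedding Lu := Lu.toHomeomorph.measurableEmbedding
    rw [h2.map_apply]
    congr 1
    exact Set.preimage_image_eq B Lu.injective

lemma det_gram_pos {N : ℕ} (T : EuclideanSpace ℝ (Fin N) ≃L[ℝ] V) :
    0 < √(Matrix.of fun i j ↦ ⟪T (EuclideanSpace.basisFun (Fin N) ℝ i),
        T (EuclideanSpace.basisFun (Fin N) ℝ j)⟫).det := by
  have hdim : finrank ℝ V = N := by
    rw [← T.toLinearEquiv.finrank_eq, finrank_euclideanSpace_fin]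
  let o : OrthonormalBasis (Fin N) ℝ V := (stdOrthonormalBasis ℝ V).reindex (finCongr hdim)
  rw [sqrt_det_gram o]
  have h1 := o.toBasis.isUnit_det
    ((EuclideanSpace.basisFun (Fin N) ℝ).toBasis.map T.toLinearEquiv)
  refine abs_pos.2 ?_
  convert h1.ne_zero using 2
  ext i
  simp

/-- The dual norm of a covector in terms of the coordinate expression of the scalar product: if
`G` is the scalar product pulled back by `T`, then `‖p‖² = π (G⁻¹ π)` for `π = p ∘ T`. -/
lemma norm_sq_eq_inverse_gram {N : ℕ} (T : EuclideanSpace ℝ (Fin N) ≃L[ℝ] V)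
    (G : EuclideanSpace ℝ (Fin N) →L[ℝ] EuclideanSpace ℝ (Fin N) →L[ℝ] ℝ)
    (hG : ∀ a b, G a b = ⟪T a, T b⟫) :
    ∃ e : EuclideanSpace ℝ (Fin N) ≃L[ℝ] (EuclideanSpace ℝ (Fin N) →L[ℝ] ℝ),
      (e : EuclideanSpace ℝ (Fin N) →L[ℝ] (EuclideanSpace ℝ (Fin N) →L[ℝ] ℝ)) = G ∧
      ∀ p : V →L[ℝ] ℝ, ‖p‖ ^ 2 =
        (p.comp (T : EuclideanSpace ℝ (Fin N) →L[ℝ] V))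
          (e.symm (p.comp (T : EuclideanSpace ℝ (Fin N) →L[ℝ] V))) := by
  have hinj : Function.Injective G := by
    refine (injective_iff_map_eq_zero G).2 fun a ha ↦ ?_
    have h1 := hG a a
    rw [ha] at h1
    have h2 : T a = 0 := inner_self_eq_zero.1 h1.symm
    simpa using h2
  have hdim : finrank ℝ (EuclideanSpace ℝ (Fin N)) =
      finrank ℝ (EuclideanSpace ℝ (Fin N) →L[ℝ] ℝ) := by
    rw [finrank_euclideanSpace_fin, Module.finrank_eq_card_basis
      (continuousDualBasis (EuclideanSpace.basisFun (Fin N) ℝ).toBasis), Fintype.card_fin]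
  let e := (LinearEquiv.ofInjectiveOfFinrankEq G.toLinearMap hinj hdim).toContinuousLinearEquiv
  refine ⟨e, ContinuousLinearMap.ext fun a ↦ rfl, fun p ↦ ?_⟩
  -- the vector that represents the covector `p`
  let v : V := (InnerProductSpace.toDual ℝ V).symm p
  have hv : ∀ w, p w = ⟪v, w⟫ := fun w ↦ (InnerProductSpace.toDual_symm_apply).symm
  have h1 : e.symm (p.comp (T : EuclideanSpace ℝ (Fin N) →L[ℝ] V)) = T.symm v := by
    rw [e.symm_apply_eq]
    ext b
    change p (T b) = G (T.symm v) b
    rw [hG, T.apply_symm_apply, hv]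
  rw [h1]
  change _ = p (T (T.symm v))
  rw [T.apply_symm_apply, hv, real_inner_self_eq_norm_sq]
  simp [v]

end Euclidean

/-! ### Polar coordinates -/

section Polar

/-- Integration in polar coordinates. -/
lemma lintegral_eq_lintegral_toSphere {E : Type*} [NormedAddCommGroup E] [NormedSpace ℝ E]
    [FiniteDimensional ℝ E] [MeasurableSpace E] [BorelSpace E] [Nontrivial E] (μ : Measure E)
    [μ.IsAddHaarMeasure] {f : E → ENNReal} (hf : Measurable f) :
    ∫⁻ x, f x ∂μ = ∫⁻ z, (∫⁻ r in Set.Ioi (0 : ℝ),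
      ENNReal.ofReal (r ^ (finrank ℝ E - 1)) * f (r • z)) ∂(μ.toSphere.map Subtype.val) := by
  have hc : Measurable fun w : ℝ × E ↦ ENNReal.ofReal (w.1 ^ (finrank ℝ E - 1)) * f (w.1 • w.2) :=
    (ENNReal.measurable_ofReal.comp (measurable_fst.pow_const _)).mul
      (hf.comp (measurable_fst.smul measurable_snd))
  have hm : Measurable fun z : E ↦ ∫⁻ r in Set.Ioi (0 : ℝ),
      ENNReal.ofReal (r ^ (finrank ℝ E - 1)) * f (r • z) :=
    (hc.comp measurable_swap).lintegral_prod_right'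
  rw [lintegral_map hm measurable_subtype_coe]
  have h1 : ∫⁻ x, f x ∂μ = ∫⁻ x : ({0}ᶜ : Set E), f x ∂(μ.comap Subtype.val) := by
    rw [lintegral_subtype_comap (measurableSet_singleton _).compl, restrict_compl_singleton]
  have h2 := (Measure.measurePreserving_homeomorphUnitSphereProd μ).symm
    (homeomorphUnitSphereProd E).toMeasurableEquiv
  rw [h1]
  refine (h2.lintegral_comp (hf.comp measurable_subtype_coe)).symm.trans ?_
  rw [lintegral_prod _ (by
    exact ((hf.comp measurable_subtype_coe).comp h2.measurable).aemeasurable)]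
  refine lintegral_congr fun z ↦ ?_
  rw [Measure.volumeIoiPow, lintegral_withDensity_eq_lintegral_mul _
    (by fun_prop) (by
      exact (hf.comp measurable_subtype_coe).comp (h2.measurable.comp measurable_prodMk_left))]
  rw [← lintegral_subtype_comap measurableSet_Ioi]
  rfl

end Polar

/-! ### The metric in coordinates -/

section Frame

variable {N : ℕ} {M : Type*} [TopologicalSpace M] [ChartedSpace (EuclideanSpace ℝ (Fin N)) M]
  [IsManifold (𝓡 N) ∞ M]

/-- The coordinate frame of the chart at `c`: the linear map from `ℝ^N` to the tangent space at `q`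
that takes the standard basis to the coordinate vector fields. -/
def chartFrame (c q : M) : EuclideanSpace ℝ (Fin N) →L[ℝ] TangentSpace (𝓡 N) q :=
  (trivializationAt (EuclideanSpace ℝ (Fin N)) (TangentSpace (𝓡 N)) c).symmL ℝ q

lemma mfderiv_extChartAt_chartFrame {c q : M} (hq : q ∈ (extChartAt (𝓡 N) c).source)
    (a : EuclideanSpace ℝ (Fin N)) :
    mfderiv (𝓡 N) 𝓘(ℝ, EuclideanSpace ℝ (Fin N)) (extChartAt (𝓡 N) c) q (chartFrame c q a) = a := by
  rw [extChartAt_source] at hq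
  rw [← TangentBundle.continuousLinearMapAt_trivializationAt hq]
  exact (trivializationAt (EuclideanSpace ℝ (Fin N)) (TangentSpace (𝓡 N))
    c).continuousLinearMapAt_symmL hq a

lemma chartFrame_mfderiv_extChartAt {c q : M} (hq : q ∈ (extChartAt (𝓡 N) c).source)
    (v : TangentSpace (𝓡 N) q) :
    chartFrame c q
      (mfderiv (𝓡 N) 𝓘(ℝ, EuclideanSpace ℝ (Fin N)) (extChartAt (𝓡 N) c) q v) = v := by
  rw [extChartAt_source] at hq
  rw [← TangentBundle.continuousLinearMapAt_trivializationAt hq]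
  exact (trivializationAt (EuclideanSpace ℝ (Fin N)) (TangentSpace (𝓡 N))
    c).symmL_continuousLinearMapAt hq v

lemma mfderiv_extChartAt_symm_eq_chartFrame {c : M} {u : EuclideanSpace ℝ (Fin N)}
    (hu : u ∈ (extChartAt (𝓡 N) c).target) (a : EuclideanSpace ℝ (Fin N)) :
    mfderiv 𝓘(ℝ, EuclideanSpace ℝ (Fin N)) (𝓡 N) (extChartAt (𝓡 N) c).symm u a =
      chartFrame c ((extChartAt (𝓡 N) c).symm u) a := by
  have h1 := chartFrame_mfderiv_extChartAt ((extChartAt (𝓡 N) c).map_target hu)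
    (mfderiv 𝓘(ℝ, EuclideanSpace ℝ (Fin N)) (𝓡 N) (extChartAt (𝓡 N) c).symm u a)
  rw [← h1]
  exact congrArg _ (mfderiv_extChartAt_apply_mfderiv_extChartAt_symm (𝓡 N) hu a)

/-- The coordinate frame as a linear isomorphism. -/
def chartFrameEquiv {c q : M} (hq : q ∈ (extChartAt (𝓡 N) c).source) :
    EuclideanSpace ℝ (Fin N) ≃L[ℝ] TangentSpace (𝓡 N) q :=
  ContinuousLinearEquiv.equivOfInverse (chartFrame c q)
    (mfderiv (𝓡 N) 𝓘(ℝ, EuclideanSpace ℝ (Fin N)) (extChartAt (𝓡 N) c) q)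
    (mfderiv_extChartAt_chartFrame hq) (chartFrame_mfderiv_extChartAt hq)

/-- The canonical momentum coordinates of a covector are its values on the coordinate frame. -/
lemma cotangent_extChartAt_snd_eq (c z : CotangentBundle N M) :
    (extChartAt (cotangentModel N) c z).2 = z.snd.comp (chartFrame c.proj z.proj) := by
  refine ContinuousLinearMap.ext fun a ↦ ?_
  rw [FiberBundle.extChartAt]
  exact DFunLike.congr_fun (Bundle.Trivial.continuousLinearMapAt_trivialization ℝ M ℝ z.proj)
    (z.snd (chartFrame c.proj z.proj a))

lemma contMDiffOn_chartFrame (c : M) (a : EuclideanSpace ℝ (Fin N)) :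
    ContMDiffOn (𝓡 N) ((𝓡 N).prod 𝓘(ℝ, EuclideanSpace ℝ (Fin N))) ∞
      (fun q ↦ (⟨q, chartFrame c q a⟩ : TangentBundle (𝓡 N) M)) (extChartAt (𝓡 N) c).source := by
  have he : ∀ q ∈ (extChartAt (𝓡 N) c).source, (⟨q, chartFrame c q a⟩ : TangentBundle (𝓡 N) M) ∈
      (trivializationAt (EuclideanSpace ℝ (Fin N)) (TangentSpace (𝓡 N)) c).source := by
    intro q hq
    rw [extChartAt_source] at hq
    rw [Trivialization.mem_source]
    exact hq
  refine (Trivialization.contMDiffOn_iff (IB := 𝓡 N) he).2 ⟨contMDiffOn_id, ?_⟩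
  refine (contMDiffOn_const (c := a)).congr fun q hq ↦ ?_
  rw [extChartAt_source] at hq
  have h1 := (trivializationAt (EuclideanSpace ℝ (Fin N)) (TangentSpace (𝓡 N))
    c).continuousLinearMapAt_symmL (R := ℝ) hq a
  rw [Trivialization.continuousLinearMapAt_apply] at h1
  rw [Trivialization.coe_linearMapAt_of_mem _ hq] at h1
  exact h1

end Frame

section Metric

variable {N : ℕ} {M : Type*} [TopologicalSpace M] [ChartedSpace (EuclideanSpace ℝ (Fin N)) M]
  [IsManifold (𝓡 N) ∞ M] [RiemannianBundle (fun q : M ↦ TangentSpace (𝓡 N) q)]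

/-- The coordinate expression of the metric at `q` in the chart at `c`. -/
def chartMetric (c q : M) :
    EuclideanSpace ℝ (Fin N) →L[ℝ] EuclideanSpace ℝ (Fin N) →L[ℝ] ℝ :=
  (innerSL ℝ (E := TangentSpace (𝓡 N) q)).bilinearComp (chartFrame c q) (chartFrame c q)

/-- The coordinate expression `√(det g_ij)` of the Riemannian volume. -/
def chartVolume (c q : M) : ℝ :=
  √(Matrix.of fun i j : Fin N ↦ inner ℝ (chartFrame c q (EuclideanSpace.basisFun (Fin N) ℝ i))
    (chartFrame c q (EuclideanSpace.basisFun (Fin N) ℝ j))).det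

lemma chartVolume_pos {c q : M} (hq : q ∈ (extChartAt (𝓡 N) c).source) : 0 < chartVolume (N := N) c q :=
  det_gram_pos (V := TangentSpace (𝓡 N) q) (chartFrameEquiv hq)

/-- The dual norm in canonical coordinates. -/
lemma covectorNorm_sq_eq {c z : CotangentBundle N M}
    (hz : z.proj ∈ (extChartAt (𝓡 N) c.proj).source) :
    ∃ e : EuclideanSpace ℝ (Fin N) ≃L[ℝ] (EuclideanSpace ℝ (Fin N) →L[ℝ] ℝ),
      (e : EuclideanSpace ℝ (Fin N) →L[ℝ] (EuclideanSpace ℝ (Fin N) →L[ℝ] ℝ)) =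
        chartMetric (N := N) c.proj z.proj ∧
      covectorNorm (N := N) z.snd ^ 2 = (extChartAt (cotangentModel N) c z).2
        ((chartMetric (N := N) c.proj z.proj).inverse (extChartAt (cotangentModel N) c z).2) := by
  obtain ⟨e, he, h⟩ := norm_sq_eq_inverse_gram (V := TangentSpace (𝓡 N) z.proj)
    (chartFrameEquiv hz) (chartMetric (N := N) c.proj z.proj) (fun a b ↦ rfl)
  refine ⟨e, he, ?_⟩
  rw [← he, ContinuousLinearMap.inverse_equiv, cotangent_extChartAt_snd_eq]
  exact h z.snd

variable [IsContMDiffRiemannianBundle (𝓡 N) ∞ (EuclideanSpace ℝ (Fin N))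
    (fun q : M ↦ TangentSpace (𝓡 N) q)]

lemma contMDiffOn_inner_chartFrame (c : M) (a b : EuclideanSpace ℝ (Fin N)) :
    ContMDiffOn (𝓡 N) 𝓘(ℝ, ℝ) ∞
      (fun q : M ↦ (inner ℝ (chartFrame c q a) (chartFrame c q b) : ℝ))
      (extChartAt (𝓡 N) c).source :=
  ContMDiffOn.inner_bundle (contMDiffOn_chartFrame c a) (contMDiffOn_chartFrame c b)

lemma contMDiffOn_chartMetric (c : M) :
    ContMDiffOn (𝓡 N) 𝓘(ℝ, EuclideanSpace ℝ (Fin N) →L[ℝ] EuclideanSpace ℝ (Fin N) →L[ℝ] ℝ) ∞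
      (chartMetric (N := N) c) (extChartAt (𝓡 N) c).source := by
  have h1 : ContDiffOn ℝ ∞ (fun u ↦ chartMetric (N := N) c ((extChartAt (𝓡 N) c).symm u))
      (extChartAt (𝓡 N) c).target := by
    rw [contDiffOn_clm_apply]
    intro a
    rw [contDiffOn_clm_apply]
    intro b
    exact contMDiffOn_iff_contDiffOn.1 ((contMDiffOn_inner_chartFrame c a b).comp
      (contMDiffOn_extChartAt_symm c) fun u hu ↦ (extChartAt (𝓡 N) c).map_target hu)
  have h2 := h1.contMDiffOn.comp (contMDiffOn_extChartAt (I := 𝓡 N) (x := c) (n := ∞)) fun q hq ↦ by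
    rw [← extChartAt_source (𝓡 N)] at hq
    exact (extChartAt (𝓡 N) c).map_source hq
  rw [← extChartAt_source (𝓡 N)] at h2
  refine h2.congr fun q hq ↦ ?_
  simp only [Function.comp_apply]
  rw [(extChartAt (𝓡 N) c).left_inv hq]

lemma continuousOn_chartVolume (c : M) :
    ContinuousOn (chartVolume (N := N) c) (extChartAt (𝓡 N) c).source := by
  have h1 : ∀ i j : Fin N, ContinuousOn (fun q ↦
      (inner ℝ (chartFrame c q (EuclideanSpace.basisFun (Fin N) ℝ i))
        (chartFrame c q (EuclideanSpace.basisFun (Fin N) ℝ j)) : ℝ)) (extChartAt (𝓡 N) c).source :=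
    fun i j ↦ (contMDiffOn_inner_chartFrame c _ _).continuousOn
  unfold chartVolume
  simp only [Matrix.det_apply, Matrix.of_apply]
  refine ContinuousOn.sqrt (continuousOn_finsetSum _ fun σ _ ↦ ContinuousOn.const_smul
    (continuousOn_finsetProd _ fun i _ ↦ h1 _ _) _)

/-- The square of the dual norm is a smooth function on the cotangent bundle. -/
lemma contMDiff_covectorNorm_sq : ContMDiff (cotangentModel N) 𝓘(ℝ, ℝ) ∞
    (fun z : CotangentBundle N M ↦ covectorNorm (N := N) z.snd ^ 2) := by
  intro c
  have hc : c ∈ (extChartAt (cotangentModel N) c).source := mem_extChartAt_source c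
  have hev : (fun z : CotangentBundle N M ↦ covectorNorm (N := N) z.snd ^ 2) =ᶠ[𝓝 c] fun z ↦
      (extChartAt (cotangentModel N) c z).2
        ((chartMetric (N := N) c.proj z.proj).inverse (extChartAt (cotangentModel N) c z).2) := by
    filter_upwards [(isOpen_extChartAt_source (I := cotangentModel N) c).mem_nhds hc] with z hz
    rw [cotangent_extChartAt_source] at hz
    obtain ⟨-, -, h⟩ := covectorNorm_sq_eq hz
    exact h
  refine ContMDiffAt.congr_of_eventuallyEq ?_ hev
  have h1 : ContMDiffAt (cotangentModel N) 𝓘(ℝ, EuclideanSpace ℝ (Fin N) →L[ℝ] ℝ) ∞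
      (fun z : CotangentBundle N M ↦ (extChartAt (cotangentModel N) c z).2) c :=
    contDiff_snd.contDiffAt.contMDiffAt.comp c (contMDiffAt_extChartAt (I := cotangentModel N))
  have hcp : c.proj ∈ (extChartAt (𝓡 N) c.proj).source := mem_extChartAt_source _
  have h2 : ContMDiffAt (cotangentModel N)
      𝓘(ℝ, EuclideanSpace ℝ (Fin N) →L[ℝ] EuclideanSpace ℝ (Fin N) →L[ℝ] ℝ) ∞
      (fun z : CotangentBundle N M ↦ chartMetric (N := N) c.proj z.proj) c :=
    ((contMDiffOn_chartMetric (N := N) c.proj).contMDiffAt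
      ((isOpen_extChartAt_source (I := 𝓡 N) c.proj).mem_nhds hcp)).comp c
      (contMDiffAt_proj (fun q : M ↦ TangentSpace (𝓡 N) q →L[ℝ] ℝ))
  obtain ⟨e, he, -⟩ := covectorNorm_sq_eq (c := c) (z := c) hcp
  have h3 : ContMDiffAt (cotangentModel N)
      𝓘(ℝ, (EuclideanSpace ℝ (Fin N) →L[ℝ] ℝ) →L[ℝ] EuclideanSpace ℝ (Fin N)) ∞
      (fun z : CotangentBundle N M ↦ (chartMetric (N := N) c.proj z.proj).inverse) c := by
    have h4 : ContDiffAt ℝ ∞ (ContinuousLinearMap.inverse :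
        (EuclideanSpace ℝ (Fin N) →L[ℝ] (EuclideanSpace ℝ (Fin N) →L[ℝ] ℝ)) → _)
        (chartMetric (N := N) c.proj c.proj) := by
      rw [← he]
      exact contDiffAt_map_inverse e
    exact h4.contMDiffAt.comp c h2
  exact h1.clm_apply (h3.clm_apply h1)

lemma contMDiff_hamiltonian {V : M → ℝ} (hV : ContMDiff (𝓡 N) 𝓘(ℝ, ℝ) ∞ V) :
    ContMDiff (cotangentModel N) 𝓘(ℝ, ℝ) ∞ (hamiltonian (N := N) V) := by
  have h1 := (contDiff_const (c := (1 / 2 : ℝ))).mul contDiff_id |>.contMDiff.comp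
    (contMDiff_covectorNorm_sq (N := N) (M := M))
  exact h1.add (hV.comp (contMDiff_proj (fun q : M ↦ TangentSpace (𝓡 N) q →L[ℝ] ℝ)))

lemma continuous_covectorNorm :
    Continuous fun z : CotangentBundle N M ↦ covectorNorm (N := N) z.snd := by
  have h := (contMDiff_covectorNorm_sq (N := N) (M := M)).continuous.sqrt
  refine h.congr fun z ↦ Real.sqrt_sq (norm_nonneg z.snd)

end Metric

/-! ### Rescaling of covectors -/

-- norm lemmas for a general normed space `V`, which are applied to the tangent spaces of `M` with
-- their Riemannian norms
section NormedDual

variable {V : Type*} [NormedAddCommGroup V] [NormedSpace ℝ V]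

lemma opNorm_smul_eq (r : ℝ) (p : V →L[ℝ] ℝ) : ‖r • p‖ = |r| * ‖p‖ := norm_smul r p

lemma opNorm_pos_iff {p : V →L[ℝ] ℝ} : 0 < ‖p‖ ↔ p ≠ 0 := norm_pos_iff

end NormedDual

section Scaling

variable {N : ℕ} {M : Type*} [TopologicalSpace M] [ChartedSpace (EuclideanSpace ℝ (Fin N)) M]

/-- Multiplication by `r` in the fibres of the cotangent bundle. -/
def scaleCovector (r : ℝ) (z : CotangentBundle N M) : CotangentBundle N M := ⟨z.proj, r • z.snd⟩

@[simp] lemma scaleCovector_proj (r : ℝ) (z : CotangentBundle N M) :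
    (scaleCovector r z).proj = z.proj := rfl

lemma scaleCovector_scaleCovector (r s : ℝ) (z : CotangentBundle N M) :
    scaleCovector r (scaleCovector s z) = scaleCovector (r * s) z := by
  exact congrArg (TotalSpace.mk z.proj) (smul_smul r s z.snd)

@[simp] lemma scaleCovector_one (z : CotangentBundle N M) : scaleCovector 1 z = z := by
  simp only [scaleCovector, one_smul]

lemma extChartAt_scaleCovector [IsManifold (𝓡 N) ∞ M] (c : CotangentBundle N M) (r : ℝ)
    (z : CotangentBundle N M) : extChartAt (cotangentModel N) c (scaleCovector r z) =
      ((extChartAt (cotangentModel N) c z).1, r • (extChartAt (cotangentModel N) c z).2) := by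
  refine Prod.ext ?_ ?_
  · simp only [cotangent_extChartAt_fst, scaleCovector_proj]
  · rw [cotangent_extChartAt_snd_eq, cotangent_extChartAt_snd_eq]
    exact ContinuousLinearMap.smul_comp r z.snd (chartFrame c.proj z.proj)

lemma scaleCovector_mem_source [IsManifold (𝓡 N) ∞ M] {c z : CotangentBundle N M} (r : ℝ)
    (hz : z ∈ (extChartAt (cotangentModel N) c).source) :
    scaleCovector r z ∈ (extChartAt (cotangentModel N) c).source := by
  rw [cotangent_extChartAt_source] at hz ⊢
  exact hz

lemma continuous_scaleCovector [IsManifold (𝓡 N) ∞ M] :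
    Continuous fun w : ℝ × CotangentBundle N M ↦ scaleCovector w.1 w.2 := by
  rw [continuous_iff_continuousAt]
  rintro ⟨r, c⟩
  have hc := mem_extChartAt_source (I := cotangentModel N) c
  have h1 : ContinuousAt (fun w : ℝ × CotangentBundle N M ↦ (extChartAt (cotangentModel N) c).symm
      ((extChartAt (cotangentModel N) c w.2).1, w.1 • (extChartAt (cotangentModel N) c w.2).2))
      (r, c) := by
    have h2 : ContinuousAt (fun w : ℝ × CotangentBundle N M ↦ extChartAt (cotangentModel N) c w.2)
        (r, c) := (continuousAt_extChartAt c).comp continuousAt_snd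
    refine ContinuousAt.comp (g := (extChartAt (cotangentModel N) c).symm)
      (continuousAt_extChartAt_symm'' ?_)
      ((continuousAt_fst.comp h2).prodMk (continuousAt_fst.smul (continuousAt_snd.comp h2)))
    rw [← extChartAt_scaleCovector]
    exact (extChartAt (cotangentModel N) c).map_source (scaleCovector_mem_source r hc)
  refine h1.congr ?_
  filter_upwards [continuousAt_snd.preimage_mem_nhds
    ((isOpen_extChartAt_source (I := cotangentModel N) c).mem_nhds hc)] with w hw
  rw [← extChartAt_scaleCovector, (extChartAt (cotangentModel N) c).left_inv
    (scaleCovector_mem_source _ hw)]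

variable [RiemannianBundle (fun q : M ↦ TangentSpace (𝓡 N) q)]

lemma covectorNorm_scaleCovector (r : ℝ) (z : CotangentBundle N M) :
    covectorNorm (N := N) (scaleCovector r z).snd = |r| * covectorNorm (N := N) z.snd :=
  opNorm_smul_eq (V := TangentSpace (𝓡 N) z.proj) r z.snd

lemma covectorNorm_pos {z : CotangentBundle N M} (hz : z.snd ≠ 0) :
    0 < covectorNorm (N := N) z.snd := (opNorm_pos_iff (V := TangentSpace (𝓡 N) z.proj)).2 hz

lemma snd_ne_zero_of_covectorNorm_pos {z : CotangentBundle N M}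
    (hz : 0 < covectorNorm (N := N) z.snd) : z.snd ≠ 0 :=
  (opNorm_pos_iff (V := TangentSpace (𝓡 N) z.proj)).1 hz

lemma normalizeCovector_eq (z : CotangentBundle N M) :
    normalizeCovector z = scaleCovector (covectorNorm (N := N) z.snd)⁻¹ z := rfl

lemma hamiltonian_scaleCovector (V : M → ℝ) (r : ℝ) (z : CotangentBundle N M) :
    hamiltonian (N := N) V (scaleCovector r z) =
      1 / 2 * (r ^ 2 * covectorNorm (N := N) z.snd ^ 2) + V z.proj := by
  rw [hamiltonian, covectorNorm_scaleCovector, mul_pow, sq_abs, scaleCovector_proj]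

lemma covectorNorm_eq_sqrt {V : M → ℝ} (z : CotangentBundle N M) :
    covectorNorm (N := N) z.snd = √(2 * (hamiltonian (N := N) V z - V z.proj)) := by
  have h1 : 2 * (hamiltonian (N := N) V z - V z.proj) = covectorNorm (N := N) z.snd ^ 2 := by
    rw [hamiltonian]; ring
  rw [h1]
  exact (Real.sqrt_sq (norm_nonneg z.snd)).symm

lemma scaleCovector_normalizeCovector {z : CotangentBundle N M} (hz : z.snd ≠ 0) :
    scaleCovector (covectorNorm (N := N) z.snd) (normalizeCovector z) = z := by
  rw [normalizeCovector_eq, scaleCovector_scaleCovector,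
    mul_inv_cancel₀ (covectorNorm_pos hz).ne', scaleCovector_one]

lemma covectorNorm_normalizeCovector {z : CotangentBundle N M} (hz : z.snd ≠ 0) :
    covectorNorm (N := N) (normalizeCovector z).snd = 1 := by
  rw [normalizeCovector_eq, covectorNorm_scaleCovector, abs_inv,
    abs_of_pos (covectorNorm_pos hz), inv_mul_cancel₀ (covectorNorm_pos hz).ne']

lemma normalizeCovector_scaleCovector {z : CotangentBundle N M}
    (hz : covectorNorm (N := N) z.snd = 1) {r : ℝ} (hr : 0 < r) :
    normalizeCovector (scaleCovector r z) = z := by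
  rw [normalizeCovector_eq, covectorNorm_scaleCovector, hz, mul_one, abs_of_pos hr,
    scaleCovector_scaleCovector, inv_mul_cancel₀ hr.ne', scaleCovector_one]

lemma lt_of_mem_levelNonzero {V : M → ℝ} {E : ℝ} {z : CotangentBundle N M}
    (hz : z ∈ levelNonzero (N := N) V E) : V z.proj < E := by
  have h1 := covectorNorm_pos hz.2
  have h2 := hz.1
  rw [hamiltonian] at h2
  nlinarith

lemma scaleCovector_mem_levelNonzero {V : M → ℝ} {E : ℝ} {z : CotangentBundle N M}
    (hz : z ∈ cosphereBundle (N := N) V E) :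
    scaleCovector √(2 * (E - V z.proj)) z ∈ levelNonzero (N := N) V E := by
  have h1 : 0 < 2 * (E - V z.proj) := by linarith [hz.1]
  refine ⟨?_, snd_ne_zero_of_covectorNorm_pos ?_⟩
  · rw [hamiltonian_scaleCovector, Real.sq_sqrt h1.le, hz.2]
    ring
  · rw [covectorNorm_scaleCovector, hz.2, mul_one]
    exact abs_pos.2 (Real.sqrt_pos.2 h1).ne'

lemma scaleCovector_sqrt_normalizeCovector {V : M → ℝ} {E : ℝ} {z : CotangentBundle N M}
    (hz : z ∈ levelNonzero (N := N) V E) :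
    scaleCovector √(2 * (E - V z.proj)) (normalizeCovector z) = z := by
  have h1 := covectorNorm_eq_sqrt (V := V) z
  rw [hz.1] at h1
  rw [← h1]
  exact scaleCovector_normalizeCovector hz.2

lemma normalizeCovector_injOn (V : M → ℝ) (E : ℝ) :
    Set.InjOn normalizeCovector (levelNonzero (N := N) V E) := by
  intro z hz z' hz' h
  have h1 := scaleCovector_sqrt_normalizeCovector hz
  have h2 := scaleCovector_sqrt_normalizeCovector hz'
  have h3 : ∀ w : CotangentBundle N M, V w.proj = V (normalizeCovector w).proj := fun _ ↦ rfl
  rw [h3] at h1 h2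
  rw [← h1, h, h2]

lemma snd_ne_zero_of_mem_levelNonzero {V : M → ℝ} {E : ℝ} {z : CotangentBundle N M}
    (hz : z ∈ levelNonzero (N := N) V E) : z.snd ≠ 0 := hz.2

lemma normalizeCovector_mem_cosphereBundle {V : M → ℝ} {E : ℝ} {z : CotangentBundle N M}
    (hz : z ∈ levelNonzero (N := N) V E) :
    normalizeCovector z ∈ cosphereBundle (N := N) V E := by
  have h1 := covectorNorm_normalizeCovector (snd_ne_zero_of_mem_levelNonzero hz)
  have h2 := lt_of_mem_levelNonzero hz
  exact ⟨h2, h1⟩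

lemma normalizeCovector_scaleCovector_sqrt {V : M → ℝ} {E : ℝ} {z : CotangentBundle N M}
    (hz : z ∈ cosphereBundle (N := N) V E) :
    normalizeCovector (scaleCovector √(2 * (E - V z.proj)) z) = z := by
  have h1 : 0 < 2 * (E - V z.proj) := by linarith [hz.1]
  exact normalizeCovector_scaleCovector hz.2 (Real.sqrt_pos.2 h1)

lemma bijOn_normalizeCovector (V : M → ℝ) (E : ℝ) :
    Set.BijOn normalizeCovector (levelNonzero (N := N) V E) (cosphereBundle V E) :=
  ⟨fun _ ↦ normalizeCovector_mem_cosphereBundle, normalizeCovector_injOn V E,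
    fun z hz ↦ ⟨scaleCovector √(2 * (E - V z.proj)) z, scaleCovector_mem_levelNonzero hz,
      normalizeCovector_scaleCovector_sqrt hz⟩⟩

variable [IsManifold (𝓡 N) ∞ M]
  [IsContMDiffRiemannianBundle (𝓡 N) ∞ (EuclideanSpace ℝ (Fin N))
    (fun q : M ↦ TangentSpace (𝓡 N) q)]

lemma isOpen_snd_ne_zero : IsOpen {z : CotangentBundle N M | z.snd ≠ 0} := by
  have h : {z : CotangentBundle N M | z.snd ≠ 0} =
      {z | 0 < covectorNorm (N := N) z.snd} := by
    ext z
    exact (opNorm_pos_iff (V := TangentSpace (𝓡 N) z.proj)).symm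
  rw [h]
  exact isOpen_lt continuous_const continuous_covectorNorm

lemma continuousOn_normalizeCovector :
    ContinuousOn normalizeCovector {z : CotangentBundle N M | z.snd ≠ 0} :=
  continuous_scaleCovector.comp_continuousOn
    ((continuous_covectorNorm.continuousOn.inv₀ fun _ hz ↦ (covectorNorm_pos hz).ne').prodMk
      continuousOn_id)

/-- Covectors `p ≠ 0` are regular points: the derivative of the Hamiltonian along the ray through
`p` is `|p|²`. -/
lemma mem_regularSet_of_snd_ne_zero {V : M → ℝ} (hV : ContMDiff (𝓡 N) 𝓘(ℝ, ℝ) ∞ V)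
    {z : CotangentBundle N M} (hz : z.snd ≠ 0) :
    z ∈ regularSet (cotangentModel N) (hamiltonian (N := N) V) := by
  have hH := contMDiff_hamiltonian (N := N) hV
  have hzs := mem_extChartAt_source (I := cotangentModel N) z
  rw [mem_regularSet_iff hH hzs]
  intro h0
  set y := extChartAt (cotangentModel N) z z with hy
  have hd : DifferentiableAt ℝ (hamiltonian (N := N) V ∘ (extChartAt (cotangentModel N) z).symm)
      y :=
    ((contDiffOn_comp_extChartAt_symm hH z).contDiffAt
      ((isOpen_extChartAt_target z).mem_nhds (mem_extChartAt_target z))).differentiableAt (by simp)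
  have hβ : HasDerivAt (fun t : ℝ ↦ (y.1, t • y.2)) (0, y.2) 1 := by
    have := (hasDerivAt_id (1 : ℝ)).smul_const y.2
    rw [one_smul] at this
    exact (hasDerivAt_const (1 : ℝ) y.1).prodMk this
  have hy1 : (y.1, (1 : ℝ) • y.2) = y := by rw [one_smul]
  have h1 := (hy1 ▸ hd.hasFDerivAt : HasFDerivAt _ _ (y.1, (1 : ℝ) • y.2)).comp_hasDerivAt 1 hβ
  have h2 : ((hamiltonian (N := N) V ∘ (extChartAt (cotangentModel N) z).symm) ∘
      fun t : ℝ ↦ (y.1, t • y.2)) =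
      fun t : ℝ ↦ 1 / 2 * (t ^ 2 * covectorNorm (N := N) z.snd ^ 2) + V z.proj := by
    funext t
    simp only [Function.comp_apply]
    rw [hy, ← extChartAt_scaleCovector, (extChartAt (cotangentModel N) z).left_inv
      (scaleCovector_mem_source t hzs), hamiltonian_scaleCovector]
  rw [h2] at h1
  have h3 : HasDerivAt (fun t : ℝ ↦ 1 / 2 * (t ^ 2 * covectorNorm (N := N) z.snd ^ 2) + V z.proj)
      (1 / 2 * (2 * covectorNorm (N := N) z.snd ^ 2)) 1 := by
    have := (((hasDerivAt_pow 2 (1 : ℝ)).mul_const (covectorNorm (N := N) z.snd ^ 2)).const_mul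
      (1 / 2 : ℝ)).add_const (V z.proj)
    simpa using this
  have h4 := h1.unique h3
  have h5 : fderiv ℝ (hamiltonian (N := N) V ∘ (extChartAt (cotangentModel N) z).symm) y
      (0, y.2) = 0 := by rw [h0]; rfl
  have h6 := covectorNorm_pos hz
  have h7 : (1 / 2 * (2 * covectorNorm (N := N) z.snd ^ 2)) = 0 := by
    rw [← h4, ← h5, hy1]
  nlinarith

end Scaling

/-! ### The Riemannian volume in charts -/

section Gram

variable {V : Type*} [NormedAddCommGroup V] [InnerProductSpace ℝ V]

/-- The square root of the Gram determinant transforms as a density. -/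
lemma sqrt_det_gram_comp {N : ℕ} (S : EuclideanSpace ℝ (Fin N) →L[ℝ] V)
    (T : EuclideanSpace ℝ (Fin N) →L[ℝ] EuclideanSpace ℝ (Fin N)) :
    √(Matrix.of fun i j ↦ inner ℝ (S (T (EuclideanSpace.basisFun (Fin N) ℝ i)))
        (S (T (EuclideanSpace.basisFun (Fin N) ℝ j)))).det =
      |T.det| * √(Matrix.of fun i j ↦ inner ℝ (S (EuclideanSpace.basisFun (Fin N) ℝ i))
        (S (EuclideanSpace.basisFun (Fin N) ℝ j))).det := by
  set b := (EuclideanSpace.basisFun (Fin N) ℝ) with hb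
  set A : Matrix (Fin N) (Fin N) ℝ := LinearMap.toMatrix b.toBasis b.toBasis T with hA
  have hT : ∀ i, T (b i) = ∑ k, A k i • b k := by
    intro i
    rw [← b.sum_repr (T (b i))]
    refine Finset.sum_congr rfl fun k _ ↦ ?_
    rw [hA, LinearMap.toMatrix_apply]
    simp
  have h1 : (Matrix.of fun i j ↦ inner ℝ (S (T (b i))) (S (T (b j)))) =
      A.transpose * (Matrix.of fun i j ↦ inner ℝ (S (b i)) (S (b j))) * A := by
    ext i j
    simp only [Matrix.mul_apply, Matrix.of_apply, Matrix.transpose_apply, hT, map_sum, map_smul,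
      sum_inner, inner_sum, real_inner_smul_left, real_inner_smul_right, Finset.sum_mul]
    refine Finset.sum_congr rfl fun k _ ↦ Finset.sum_congr rfl fun l _ ↦ by ring
  have h2 : T.det = A.det := by
    rw [hA, LinearMap.det_toMatrix]
  rw [h1, Matrix.det_mul, Matrix.det_mul, Matrix.det_transpose, h2,
    show A.det * (Matrix.of fun i j ↦ inner ℝ (S (b i)) (S (b j))).det * A.det =
      A.det ^ 2 * (Matrix.of fun i j ↦ inner ℝ (S (b i)) (S (b j))).det by ring,
    Real.sqrt_mul (sq_nonneg _), Real.sqrt_sq_eq_abs]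

end Gram

section Volume

variable {N : ℕ} {M : Type*} [TopologicalSpace M] [ChartedSpace (EuclideanSpace ℝ (Fin N)) M]
  [IsManifold (𝓡 N) ∞ M] [RiemannianBundle (fun q : M ↦ TangentSpace (𝓡 N) q)]

lemma densityInChart_riemannian {c : M} {u : EuclideanSpace ℝ (Fin N)}
    (hu : u ∈ (extChartAt (𝓡 N) c).target) :
    densityInChart (𝓡 N) (EuclideanSpace.basisFun (Fin N) ℝ).toBasis
      (fun q (v : Fin N → TangentSpace (𝓡 N) q) ↦
        √(Matrix.of fun i j ↦ inner ℝ (v i) (v j)).det) c u =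
      chartVolume (N := N) c ((extChartAt (𝓡 N) c).symm u) := by
  have h1 : (fun i ↦ mfderiv 𝓘(ℝ, EuclideanSpace ℝ (Fin N)) (𝓡 N) (extChartAt (𝓡 N) c).symm u
      ((EuclideanSpace.basisFun (Fin N) ℝ).toBasis i)) =
      fun i ↦ chartFrame c ((extChartAt (𝓡 N) c).symm u) (EuclideanSpace.basisFun (Fin N) ℝ i) := by
    funext i
    rw [OrthonormalBasis.coe_toBasis]
    exact mfderiv_extChartAt_symm_eq_chartFrame hu _
  exact congrArg (fun v : Fin N → TangentSpace (𝓡 N) ((extChartAt (𝓡 N) c).symm u) ↦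
    √(Matrix.of fun i j ↦ inner ℝ (v i) (v j)).det) h1

/-- The coordinate expressions of the Riemannian volume in two charts differ by the Jacobian
determinant of the coordinate change. -/
lemma chartVolume_coordChange {c c' : M} {u : EuclideanSpace ℝ (Fin N)}
    (hu : u ∈ (extChartAt (𝓡 N) c).target)
    (hu' : (extChartAt (𝓡 N) c).symm u ∈ (extChartAt (𝓡 N) c').source) :
    chartVolume (N := N) c ((extChartAt (𝓡 N) c).symm u) =
      |(fderiv ℝ (extChartAt (𝓡 N) c' ∘ (extChartAt (𝓡 N) c).symm) u).det| *
        chartVolume (N := N) c' ((extChartAt (𝓡 N) c).symm u) := by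
  set q := (extChartAt (𝓡 N) c).symm u with hq
  have hqs : q ∈ (extChartAt (𝓡 N) c).source := (extChartAt (𝓡 N) c).map_target hu
  have h1 : ∀ a, chartFrame c q a = chartFrame c' q
      (fderiv ℝ (extChartAt (𝓡 N) c' ∘ (extChartAt (𝓡 N) c).symm) u a) := by
    intro a
    have h2 := fderiv_coordChange_apply_mfderiv_extChartAt (𝓡 N) hqs hu' (chartFrame c q a)
    rw [hq, (extChartAt (𝓡 N) c).right_inv hu, ← hq] at h2
    have h3 := mfderiv_extChartAt_chartFrame hqs a
    have h4 := chartFrame_mfderiv_extChartAt hu' (chartFrame c q a)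
    rw [← h4]
    refine congrArg _ (h2.symm.trans ?_)
    exact congrArg _ h3
  unfold chartVolume
  simp only [h1]
  exact sqrt_det_gram_comp (V := TangentSpace (𝓡 N) q) (chartFrame c' q) _

variable [SecondCountableTopology M] [MeasurableSpace M] [BorelSpace M]

lemma riemannianVolume_apply (c : M) {A : Set M} (hA : MeasurableSet A)
    (hAc : A ⊆ (extChartAt (𝓡 N) c).source) :
    riemannianVolume (N := N) A = ∫⁻ u in extChartAt (𝓡 N) c '' A,
      ENNReal.ofReal (chartVolume (N := N) c ((extChartAt (𝓡 N) c).symm u))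
        ∂(EuclideanSpace.basisFun (Fin N) ℝ).toBasis.addHaar := by
  rw [riemannianVolume, densityMeasure_apply (𝓡 N) _ _ ?_ c hA hAc]
  · refine setLIntegral_congr_fun ((chartHomeo (𝓡 N) c).measurableSet_image hA hAc) ?_
    rintro _ ⟨x, hx, rfl⟩
    dsimp only
    rw [densityInChart_riemannian ((extChartAt (𝓡 N) c).map_source (hAc hx))]
  · intro c c' y hy hy'
    rw [densityInChart_riemannian hy,
      densityInChart_riemannian ((extChartAt (𝓡 N) c').map_source hy'),
      (extChartAt (𝓡 N) c').left_inv hy', chartVolume_coordChange hy hy']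

variable [IsContMDiffRiemannianBundle (𝓡 N) ∞ (EuclideanSpace ℝ (Fin N))
    (fun q : M ↦ TangentSpace (𝓡 N) q)]

lemma restrict_riemannianVolume (c : M) :
    (riemannianVolume (N := N) (M := M)).restrict (extChartAt (𝓡 N) c).source =
      (((EuclideanSpace.basisFun (Fin N) ℝ).toBasis.addHaar.restrict
        (extChartAt (𝓡 N) c).target).withDensity fun u ↦
          ENNReal.ofReal (chartVolume (N := N) c ((extChartAt (𝓡 N) c).symm u))).map
        (extChartAt (𝓡 N) c).symm := by
  have htm : MeasurableSet (extChartAt (𝓡 N) c).target :=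
    (isOpen_extChartAt_target (I := 𝓡 N) c).measurableSet
  have hsm : MeasurableSet (extChartAt (𝓡 N) c).source :=
    (isOpen_extChartAt_source (I := 𝓡 N) c).measurableSet
  refine Measure.ext fun B hB ↦ ?_
  rw [Measure.map_apply_of_aemeasurable (((continuousOn_extChartAt_symm
    (I := 𝓡 N) c).aemeasurable htm).mono_ac (withDensity_absolutelyContinuous _ _)) hB,
    withDensity_apply', Measure.restrict_restrict' htm, Measure.restrict_apply hB,
    riemannianVolume_apply c (hB.inter hsm) Set.inter_subset_right, Set.inter_comm B,
    (extChartAt (𝓡 N) c).image_source_inter_eq', Set.inter_comm]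

lemma setLIntegral_riemannianVolume (c : M) {f : M → ENNReal} (hf : Measurable f) :
    ∫⁻ q in (extChartAt (𝓡 N) c).source, f q ∂(riemannianVolume (N := N)) =
      ∫⁻ u in (extChartAt (𝓡 N) c).target,
        ENNReal.ofReal (chartVolume (N := N) c ((extChartAt (𝓡 N) c).symm u)) *
          f ((extChartAt (𝓡 N) c).symm u) ∂(EuclideanSpace.basisFun (Fin N) ℝ).toBasis.addHaar := by
  have htm : MeasurableSet (extChartAt (𝓡 N) c).target :=
    (isOpen_extChartAt_target (I := 𝓡 N) c).measurableSet
  have h1 : AEMeasurable (extChartAt (𝓡 N) c).symm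
      ((EuclideanSpace.basisFun (Fin N) ℝ).toBasis.addHaar.restrict (extChartAt (𝓡 N) c).target) :=
    (continuousOn_extChartAt_symm (I := 𝓡 N) c).aemeasurable htm
  have h2 := h1.mono_ac (withDensity_absolutelyContinuous _ fun u ↦
    ENNReal.ofReal (chartVolume (N := N) c ((extChartAt (𝓡 N) c).symm u)))
  have h3 : AEMeasurable (fun u ↦
      ENNReal.ofReal (chartVolume (N := N) c ((extChartAt (𝓡 N) c).symm u)))
      ((EuclideanSpace.basisFun (Fin N) ℝ).toBasis.addHaar.restrict (extChartAt (𝓡 N) c).target) :=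
    (((continuousOn_chartVolume c).comp (continuousOn_extChartAt_symm (I := 𝓡 N) c)
      fun u hu ↦ (extChartAt (𝓡 N) c).map_target hu).aemeasurable htm).ennreal_ofReal
  rw [restrict_riemannianVolume, lintegral_map' hf.aemeasurable h2,
    lintegral_withDensity_eq_lintegral_mul₀' h3
      (show AEMeasurable (fun u ↦ f ((extChartAt (𝓡 N) c).symm u)) _ from hf.comp_aemeasurable h2)]
  rfl

end Volume

/-! ### The Liouville measure and the Lebesgue measures of the fibres -/

section Sphere

open scoped Pointwise in
/-- The surface measure of a subset of the unit sphere in terms of the volume of the cone over it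
in the unit ball. -/
lemma map_toSphere_apply {G : Type*} [NormedAddCommGroup G] [NormedSpace ℝ G]
    [MeasurableSpace G] [BorelSpace G] (μ : Measure G) {S : Set G} (hS : MeasurableSet S) :
    (μ.toSphere.map Subtype.val) S =
      finrank ℝ G * μ {p | (0 < ‖p‖ ∧ ‖p‖ < 1) ∧ ‖p‖⁻¹ • p ∈ S} := by
  rw [Measure.map_apply measurable_subtype_coe hS, Measure.toSphere_apply' _
    (measurable_subtype_coe hS), Subtype.image_preimage_coe]
  congr 2
  ext p
  constructor
  · rintro ⟨r, hr, z, ⟨hz1, hz2⟩, rfl⟩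
    have hz : ‖z‖ = 1 := by simpa using hz1
    have hn : ‖r • z‖ = r := by rw [norm_smul, hz, mul_one, Real.norm_of_nonneg hr.1.le]
    refine ⟨by rw [hn]; exact hr, ?_⟩
    dsimp only
    rw [hn, smul_smul, inv_mul_cancel₀ hr.1.ne', one_smul]
    exact hz2
  · rintro ⟨hp, hpS⟩
    refine ⟨‖p‖, hp, ‖p‖⁻¹ • p, ⟨?_, hpS⟩, ?_⟩
    · simp only [mem_sphere_iff_norm, sub_zero, norm_smul, norm_inv, norm_norm]
      exact inv_mul_cancel₀ hp.1.ne'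
    · simp only [smul_smul]
      rw [mul_inv_cancel₀ hp.1.ne', one_smul]

lemma finrank_continuousDual {V : Type*} [NormedAddCommGroup V] [NormedSpace ℝ V]
    [FiniteDimensional ℝ V] : finrank ℝ (V →L[ℝ] ℝ) = finrank ℝ V := by
  rw [← LinearMap.toContinuousLinearMap.finrank_eq (R := ℝ)]
  exact Subspace.dual_finrank_eq

end Sphere

section Fibre

variable {N : ℕ} {M : Type*} [TopologicalSpace M] [ChartedSpace (EuclideanSpace ℝ (Fin N)) M]
  [RiemannianBundle (fun q : M ↦ TangentSpace (𝓡 N) q)]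

/-- The Lebesgue measure of the Euclidean space `(T*_q M, g)`. -/
def fibreMeasure (q : M) : Measure (TangentSpace (𝓡 N) q →L[ℝ] ℝ) :=
  (continuousDualBasis (stdOrthonormalBasis ℝ (TangentSpace (𝓡 N) q)).toBasis).addHaar

variable [IsManifold (𝓡 N) ∞ M]

/-- The Lebesgue measure, in canonical coordinates, of the slice of a set over a point `q` of the
base is `√(det g_ij)` times its Euclidean measure. This factor is the density of the Riemannian
volume, whence the product decomposition of the Liouville measure. -/
lemma addHaar_slice (c : CotangentBundle N M) {q : M}
    (hq : q ∈ (extChartAt (𝓡 N) c.proj).source) (B : Set (CotangentBundle N M)) :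
    (continuousDualBasis (EuclideanSpace.basisFun (Fin N) ℝ).toBasis).addHaar
      (Prod.mk (extChartAt (𝓡 N) c.proj q) ⁻¹' (extChartAt (cotangentModel N) c ''
        (B ∩ (extChartAt (cotangentModel N) c).source))) =
      ENNReal.ofReal (chartVolume (N := N) c.proj q) *
        fibreMeasure q {p | (⟨q, p⟩ : CotangentBundle N M) ∈ B} := by
  have h1 := addHaar_image_precomp (V := TangentSpace (𝓡 N) q) (chartFrameEquiv hq)
    {p | (⟨q, p⟩ : CotangentBundle N M) ∈ B}
  refine Eq.trans (congrArg _ ?_) h1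
  ext w
  constructor
  · rintro ⟨⟨q', p⟩, ⟨hzB, hzs⟩, hz⟩
    rw [cotangent_extChartAt_source] at hzs
    have h2 := congrArg Prod.fst hz
    rw [cotangent_extChartAt_fst] at h2
    obtain rfl : q' = q := (extChartAt (𝓡 N) c.proj).injOn hzs hq h2
    refine ⟨p, hzB, ?_⟩
    have h3 := congrArg Prod.snd hz
    rw [cotangent_extChartAt_snd_eq] at h3
    exact h3
  · rintro ⟨p, hp, rfl⟩
    refine ⟨⟨q, p⟩, ⟨hp, ?_⟩, Prod.ext ?_ ?_⟩
    · rw [cotangent_extChartAt_source]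
      exact hq
    · rw [cotangent_extChartAt_fst]
    · rw [cotangent_extChartAt_snd_eq]
      rfl

/-- Measurability can be checked on chart domains, since countably many of them cover `M`. -/
lemma measurable_of_chart_cover [SecondCountableTopology M] [MeasurableSpace M] [BorelSpace M]
    {f : M → ENNReal} (hf : ∀ c : M, ∀ t : Set ENNReal, MeasurableSet t →
      MeasurableSet ((extChartAt (𝓡 N) c).source ∩ f ⁻¹' t)) : Measurable f := by
  intro t ht
  rcases isEmpty_or_nonempty M with hM | hM
  · rw [Set.eq_empty_of_isEmpty (f ⁻¹' t)]
    exact MeasurableSet.empty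
  obtain ⟨c, hc⟩ := exists_seq_iUnion_chart_source (K := EuclideanSpace ℝ (Fin N)) (X := M)
  have h1 : f ⁻¹' t = ⋃ n, (extChartAt (𝓡 N) (c n)).source ∩ f ⁻¹' t := by
    rw [← Set.iUnion_inter]
    simp only [extChartAt_source]
    rw [hc, Set.univ_inter]
  rw [h1]
  exact MeasurableSet.iUnion fun n ↦ hf (c n) t ht

variable [MeasurableSpace M] [BorelSpace M] [SecondCountableTopology M]
  [IsContMDiffRiemannianBundle (𝓡 N) ∞ (EuclideanSpace ℝ (Fin N))
    (fun q : M ↦ TangentSpace (𝓡 N) q)]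

lemma measurable_fibreMeasure {B : Set (CotangentBundle N M)} (hB : MeasurableSet B) :
    Measurable fun q : M ↦ fibreMeasure q {p | (⟨q, p⟩ : CotangentBundle N M) ∈ B} := by
  refine measurable_of_chart_cover (N := N) fun c t ht ↦ ?_
  set z : CotangentBundle N M := ⟨c, 0⟩ with hz
  set h : EuclideanSpace ℝ (Fin N) → ENNReal := fun y ↦
    (continuousDualBasis (EuclideanSpace.basisFun (Fin N) ℝ).toBasis).addHaar
      (Prod.mk y ⁻¹' (extChartAt (cotangentModel N) z ''
        (B ∩ (extChartAt (cotangentModel N) z).source))) with hh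
  have hhm : Measurable h := measurable_measure_prodMk_left
    ((chartHomeo (cotangentModel N) z).measurableSet_image
      (hB.inter (isOpen_extChartAt_source (I := cotangentModel N) z).measurableSet)
      Set.inter_subset_right)
  have hk : Measurable fun w : EuclideanSpace ℝ (Fin N) × ℝ ↦ (ENNReal.ofReal w.2)⁻¹ * h w.1 :=
    measurable_snd.ennreal_ofReal.inv.mul (hhm.comp measurable_fst)
  have h1 := ((continuousOn_extChartAt (I := 𝓡 N) c).prodMk
    (continuousOn_chartVolume (N := N) c)).measurableSet_inter_preimage
      (isOpen_extChartAt_source (I := 𝓡 N) c).measurableSet (hk ht)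
  convert h1 using 1
  ext q
  refine and_congr_right fun hq ↦ ?_
  have h2 : h (extChartAt (𝓡 N) c q) = _ := addHaar_slice z hq B
  have h3 : ENNReal.ofReal (chartVolume (N := N) c q) ≠ 0 :=
    (ENNReal.ofReal_pos.2 (chartVolume_pos hq)).ne'
  rw [Set.mem_preimage, Set.mem_preimage, Set.mem_preimage, h2, ← mul_assoc,
    ENNReal.inv_mul_cancel h3 ENNReal.ofReal_ne_top, one_mul]

/-- Fubini's theorem for the Liouville measure, over one chart domain: the factors `√(det g_ij)` of
`addHaar_slice` and of the Riemannian volume coincide. -/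
lemma liouvilleMeasure_apply_of_subset (c : M) {B : Set (CotangentBundle N M)}
    (hB : MeasurableSet B) (hBc : ∀ z ∈ B, z.proj ∈ (extChartAt (𝓡 N) c).source) :
    liouvilleMeasure N M B = N.factorial * ∫⁻ q,
      fibreMeasure q {p | (⟨q, p⟩ : CotangentBundle N M) ∈ B} ∂(riemannianVolume (N := N)) := by
  set z : CotangentBundle N M := ⟨c, 0⟩ with hz
  have hBz : B ⊆ (extChartAt (cotangentModel N) z).source := by
    rw [cotangent_extChartAt_source]
    exact hBc
  have hsm : MeasurableSet (extChartAt (𝓡 N) c).source :=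
    (isOpen_extChartAt_source (I := 𝓡 N) c).measurableSet
  have htm : MeasurableSet (extChartAt (𝓡 N) c).target :=
    (isOpen_extChartAt_target (I := 𝓡 N) c).measurableSet
  have him : MeasurableSet (extChartAt (cotangentModel N) z '' B) :=
    (chartHomeo (cotangentModel N) z).measurableSet_image hB hBz
  have h1 : ∫⁻ q, fibreMeasure q {p | (⟨q, p⟩ : CotangentBundle N M) ∈ B}
      ∂(riemannianVolume (N := N)) = ∫⁻ q in (extChartAt (𝓡 N) c).source,
      fibreMeasure q {p | (⟨q, p⟩ : CotangentBundle N M) ∈ B} ∂(riemannianVolume (N := N)) := by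
    refine (setLIntegral_eq_of_support_subset ?_).symm
    intro q hq
    by_contra hqc
    refine hq ?_
    have h2 : {p | (⟨q, p⟩ : CotangentBundle N M) ∈ B} = ∅ :=
      Set.eq_empty_of_forall_notMem fun p hp ↦ hqc (hBc _ hp)
    dsimp only
    rw [h2, measure_empty]
  rw [h1, setLIntegral_riemannianVolume c (measurable_fibreMeasure hB),
    liouvilleMeasure_apply z B hBz hB, Measure.smul_apply, smul_eq_mul, canonicalBasis,
    Basis.prod_addHaar, Measure.prod_apply him]
  congr 1
  rw [← setLIntegral_eq_of_support_subset (s := (extChartAt (𝓡 N) c).target)]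
  · refine setLIntegral_congr_fun htm fun y hy ↦ ?_
    have h2 := addHaar_slice z ((extChartAt (𝓡 N) c).map_target hy) B
    rw [Set.inter_eq_left.2 hBz] at h2
    refine Eq.trans ?_ h2
    rw [show z.proj = c from rfl, (extChartAt (𝓡 N) c).right_inv hy]
  · intro y hy
    by_contra hyc
    refine hy ?_
    have h2 : Prod.mk y ⁻¹' (extChartAt (cotangentModel N) z '' B) = ∅ := by
      refine Set.eq_empty_of_forall_notMem fun w hw ↦ hyc ?_
      obtain ⟨x, hx, hxy⟩ := hw
      have h3 := congrArg Prod.fst hxy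
      rw [cotangent_extChartAt_fst] at h3
      rw [← show extChartAt (𝓡 N) c x.proj = y from h3]
      exact (extChartAt (𝓡 N) c).map_source (hBc x hx)
    dsimp only
    rw [h2, measure_empty]

lemma measurable_totalSpaceMk (q : M) : Measurable fun p : TangentSpace (𝓡 N) q →L[ℝ] ℝ ↦
    (⟨q, p⟩ : CotangentBundle N M) :=
  (FiberBundle.continuous_totalSpaceMk (EuclideanSpace ℝ (Fin N) →L[ℝ] ℝ)
    (fun q : M ↦ TangentSpace (𝓡 N) q →L[ℝ] ℝ) q).measurable

lemma measurable_map_fibreMeasure : Measurable fun q : M ↦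
    (fibreMeasure q).map fun p ↦ (⟨q, p⟩ : CotangentBundle N M) := by
  refine Measure.measurable_of_measurable_coe _ fun B hB ↦ ?_
  simp only [fun q : M ↦ Measure.map_apply (measurable_totalSpaceMk q) hB (μ := fibreMeasure q)]
  exact measurable_fibreMeasure hB

/-- The Liouville measure is `N!` times the product of the Riemannian volume of the base and the
Euclidean Lebesgue measures of the fibres. -/
lemma liouvilleMeasure_eq_bind : liouvilleMeasure N M = (N.factorial : ENNReal) •
    (riemannianVolume (N := N) (M := M)).bind fun q ↦
      (fibreMeasure q).map fun p ↦ (⟨q, p⟩ : CotangentBundle N M) := by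
  rcases isEmpty_or_nonempty M with hM | hM
  · have : IsEmpty (CotangentBundle N M) := ⟨fun z ↦ hM.false z.proj⟩
    exact Measure.ext fun B _ ↦ by rw [Set.eq_empty_of_isEmpty B, measure_empty, measure_empty]
  obtain ⟨c, hc⟩ := exists_seq_iUnion_chart_source (K := EuclideanSpace ℝ (Fin N)) (X := M)
  have hu : ⋃ n, {z : CotangentBundle N M | z.proj ∈ (extChartAt (𝓡 N) (c n)).source} =
      Set.univ := by
    refine Set.eq_univ_of_forall fun z ↦ ?_
    have h1 : z.proj ∈ ⋃ n, (chartAt (EuclideanSpace ℝ (Fin N)) (c n)).source := by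
      rw [hc]; trivial
    simpa [extChartAt_source] using h1
  rw [← Measure.restrict_univ (μ := liouvilleMeasure N M), ← hu,
    ← Measure.restrict_univ (μ := (N.factorial : ENNReal) • _), ← hu,
    Measure.restrict_iUnion_congr]
  intro n
  have hm : MeasurableSet {z : CotangentBundle N M |
      z.proj ∈ (extChartAt (𝓡 N) (c n)).source} :=
    ((isOpen_extChartAt_source (I := 𝓡 N) (c n)).preimage continuous_cotangent_proj).measurableSet
  refine Measure.ext fun B hB ↦ ?_
  rw [Measure.restrict_apply hB, Measure.restrict_apply hB,
    liouvilleMeasure_apply_of_subset (c n) (hB.inter hm) (fun z hz ↦ hz.2), Measure.smul_apply,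
    Measure.bind_apply (hB.inter hm) measurable_map_fibreMeasure.aemeasurable, smul_eq_mul]
  congr 1
  refine lintegral_congr fun q ↦ ?_
  rw [Measure.map_apply (measurable_totalSpaceMk q) (hB.inter hm)]
  rfl

end Fibre

/-! ### Polar coordinates on the cotangent bundle -/

section Cosphere

variable {N : ℕ} {M : Type*} [TopologicalSpace M] [ChartedSpace (EuclideanSpace ℝ (Fin N)) M]
  [RiemannianBundle (fun q : M ↦ TangentSpace (𝓡 N) q)] [IsManifold (𝓡 N) ∞ M]
  [MeasurableSpace M] [BorelSpace M] [SecondCountableTopology M]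
  [IsContMDiffRiemannianBundle (𝓡 N) ∞ (EuclideanSpace ℝ (Fin N))
    (fun q : M ↦ TangentSpace (𝓡 N) q)]

lemma finrank_cotangentSpace (q : M) : finrank ℝ (TangentSpace (𝓡 N) q →L[ℝ] ℝ) = N :=
  (finrank_continuousDual (V := TangentSpace (𝓡 N) q)).trans
    (finrank_euclideanSpace_fin (𝕜 := ℝ) (n := N))

/-- The surface measure in terms of the cone over `S` in the unit ball. In this form, measurability
in the base point follows from the measurability of the fibre measures. -/
lemma cosphereMeasure_apply (q : M) {S : Set (TangentSpace (𝓡 N) q →L[ℝ] ℝ)}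
    (hS : MeasurableSet S) : cosphereMeasure q S = N * fibreMeasure q
      {p | (0 < covectorNorm p ∧ covectorNorm p < 1) ∧ (covectorNorm p)⁻¹ • p ∈ S} := by
  refine (map_toSphere_apply (G := TangentSpace (𝓡 N) q →L[ℝ] ℝ) (fibreMeasure q) hS).trans ?_
  rw [finrank_cotangentSpace]
  rfl

lemma measurable_map_cosphereMeasure : Measurable fun q : M ↦
    (cosphereMeasure q).map fun p ↦ (⟨q, p⟩ : CotangentBundle N M) := by
  refine Measure.measurable_of_measurable_coe _ fun B hB ↦ ?_
  simp only [fun q : M ↦ Measure.map_apply (measurable_totalSpaceMk q) hB (μ := cosphereMeasure q),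
    fun q : M ↦ cosphereMeasure_apply q (measurable_totalSpaceMk q hB)]
  have h1 : MeasurableSet ({z : CotangentBundle N M | covectorNorm (N := N) z.snd < 1} ∩
      ({z | z.snd ≠ 0} ∩ normalizeCovector ⁻¹' B)) :=
    (isOpen_lt continuous_covectorNorm continuous_const).measurableSet.inter
      (continuousOn_normalizeCovector.measurableSet_inter_preimage
        isOpen_snd_ne_zero.measurableSet hB)
  refine Measurable.const_mul ?_ _
  convert measurable_fibreMeasure h1 using 3 with q
  ext p
  constructor
  · rintro ⟨⟨h2, h3⟩, h4⟩
    exact ⟨h3, snd_ne_zero_of_covectorNorm_pos (z := (⟨q, p⟩ : CotangentBundle N M)) h2, h4⟩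
  · rintro ⟨h3, h2, h4⟩
    exact ⟨⟨covectorNorm_pos (z := (⟨q, p⟩ : CotangentBundle N M)) h2, h3⟩, h4⟩

lemma cosphereBundleMeasure_covectorNorm_ne_one :
    cosphereBundleMeasure N M {z | covectorNorm (N := N) z.snd = 1}ᶜ = 0 := by
  have hm : MeasurableSet {z : CotangentBundle N M | covectorNorm (N := N) z.snd = 1}ᶜ :=
    (isClosed_eq continuous_covectorNorm continuous_const).measurableSet.compl
  rw [cosphereBundleMeasure, Measure.bind_apply hm measurable_map_cosphereMeasure.aemeasurable]
  refine (lintegral_congr fun q ↦ ?_).trans lintegral_zero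
  rw [Measure.map_apply (measurable_totalSpaceMk q) hm, cosphereMeasure,
    Measure.map_apply measurable_subtype_coe (measurable_totalSpaceMk q hm)]
  refine measure_mono_null (t := ∅) (fun z hz ↦ ?_) measure_empty
  exact hz (mem_sphere_zero_iff_norm.1 z.2)

instance (q : M) : (fibreMeasure (N := N) q).IsAddHaarMeasure :=
  inferInstanceAs (Basis.addHaar _).IsAddHaarMeasure

/-- Polar coordinates on the cotangent bundle. -/
lemma lintegral_liouvilleMeasure (hN : 1 ≤ N) {f : CotangentBundle N M → ENNReal}
    (hf : Measurable f) :
    ∫⁻ z, f z ∂(liouvilleMeasure N M) = N.factorial * ∫⁻ z, (∫⁻ r in Set.Ioi (0 : ℝ),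
      ENNReal.ofReal (r ^ (N - 1)) * f (scaleCovector r z)) ∂(cosphereBundleMeasure N M) := by
  have h1 : Measurable fun w : ℝ × CotangentBundle N M ↦
      ENNReal.ofReal (w.1 ^ (N - 1)) * f (scaleCovector w.1 w.2) :=
    (measurable_fst.pow_const _).ennreal_ofReal.mul (hf.comp continuous_scaleCovector.measurable)
  have h2 : Measurable fun z : CotangentBundle N M ↦ ∫⁻ r in Set.Ioi (0 : ℝ),
      ENNReal.ofReal (r ^ (N - 1)) * f (scaleCovector r z) := h1.lintegral_prod_left'
  rw [liouvilleMeasure_eq_bind, lintegral_smul_measure, smul_eq_mul, cosphereBundleMeasure,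
    Measure.lintegral_bind measurable_map_fibreMeasure.aemeasurable hf.aemeasurable,
    Measure.lintegral_bind measurable_map_cosphereMeasure.aemeasurable h2.aemeasurable]
  congr 1
  refine lintegral_congr fun q ↦ ?_
  rw [lintegral_map hf (measurable_totalSpaceMk q), lintegral_map h2 (measurable_totalSpaceMk q)]
  have : Nontrivial (TangentSpace (𝓡 N) q →L[ℝ] ℝ) :=
    Module.nontrivial_of_finrank_pos (R := ℝ) (by rw [finrank_cotangentSpace]; exact hN)
  have h3 := lintegral_eq_lintegral_toSphere (E := TangentSpace (𝓡 N) q →L[ℝ] ℝ) (fibreMeasure q)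
    (hf.comp (measurable_totalSpaceMk q))
  rw [finrank_cotangentSpace] at h3
  exact h3

variable [T2Space M]

/-- The measure `dσ_1 dv` of a compact set of unit covectors is bounded by the Liouville measure of
its multiples by factors in `[1, 2]`. -/
lemma isFiniteMeasureOnCompacts_cosphereBundleMeasure (hN : 1 ≤ N) :
    IsFiniteMeasureOnCompacts (cosphereBundleMeasure N M) := by
  refine ⟨fun K hK ↦ ?_⟩
  set S : Set (CotangentBundle N M) := {z | covectorNorm (N := N) z.snd = 1} with hS
  have hSc : IsClosed S := isClosed_eq continuous_covectorNorm continuous_const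
  have hKS : IsCompact (K ∩ S) := hK.inter_right hSc
  set D : Set (CotangentBundle N M) :=
    (fun w : ℝ × CotangentBundle N M ↦ scaleCovector w.1 w.2) '' (Set.Icc 1 2 ×ˢ (K ∩ S)) with hD
  have hDc : IsCompact D := (isCompact_Icc.prod hKS).image continuous_scaleCovector
  have h1 := lintegral_liouvilleMeasure hN (measurable_one.indicator hDc.measurableSet)
  rw [lintegral_indicator_one hDc.measurableSet] at h1
  have h2 : cosphereBundleMeasure N M (K ∩ S) ≤ ∫⁻ z, (∫⁻ r in Set.Ioi (0 : ℝ),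
      ENNReal.ofReal (r ^ (N - 1)) * D.indicator 1 (scaleCovector r z))
        ∂(cosphereBundleMeasure N M) := by
    rw [← lintegral_indicator_one hKS.measurableSet]
    refine lintegral_mono fun z ↦ ?_
    by_cases hz : z ∈ K ∩ S
    · rw [Set.indicator_of_mem hz]
      have h3 : (∫⁻ r in Set.Icc (1 : ℝ) 2, (1 : ENNReal)) = 1 := by
        rw [setLIntegral_one, Real.volume_Icc]
        norm_num
      refine h3.symm.trans_le ((setLIntegral_mono' measurableSet_Icc fun r hr ↦ ?_).trans
        (lintegral_mono_set fun r hr ↦ lt_of_lt_of_le one_pos hr.1))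
      rw [Set.indicator_of_mem (Set.mem_image_of_mem _ (Set.mk_mem_prod hr hz)), Pi.one_apply,
        mul_one, ← ENNReal.ofReal_one]
      exact ENNReal.ofReal_le_ofReal (one_le_pow₀ hr.1)
    · rw [Set.indicator_of_notMem hz]
      exact zero_le
  have h4 : cosphereBundleMeasure N M K = cosphereBundleMeasure N M (K ∩ S) := by
    refine le_antisymm ?_ (measure_mono Set.inter_subset_left)
    refine (measure_le_inter_add_sdiff _ K S).trans ?_
    rw [measure_mono_null (Set.sdiff_subset_compl K S) cosphereBundleMeasure_covectorNorm_ne_one,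
      add_zero]
  rw [h4]
  refine h2.trans_lt (lt_of_le_of_lt ?_ (hDc.measure_lt_top (μ := liouvilleMeasure N M)))
  rw [h1]
  refine le_mul_of_one_le_left zero_le ?_
  exact_mod_cast N.factorial_pos

end Cosphere

/-! ### Energy coordinates -/

/-- The substitution `s = r² / 2 + v` from kinetic momentum to energy. -/
lemma setLIntegral_Ioi_energy {N : ℕ} (hN : 1 ≤ N) (v : ℝ) (g : ℝ → ENNReal) :
    ∫⁻ s in Set.Ioi v, ENNReal.ofReal ((2 * (s - v)) ^ ((N : ℝ) / 2 - 1)) * g √(2 * (s - v)) =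
      ∫⁻ r in Set.Ioi (0 : ℝ), ENNReal.ofReal (r ^ (N - 1)) * g r := by
  have h1 : (fun r : ℝ ↦ r ^ 2 / 2 + v) '' Set.Ioi 0 = Set.Ioi v := by
    ext s
    constructor
    · rintro ⟨r, hr, rfl⟩
      have : (0 : ℝ) < r := hr
      show v < r ^ 2 / 2 + v
      have := sq_pos_of_pos this
      linarith
    · intro hs
      have hs' : 0 < 2 * (s - v) := by linarith [show v < s from hs]
      refine ⟨√(2 * (s - v)), Real.sqrt_pos.2 hs', ?_⟩
      dsimp only
      rw [Real.sq_sqrt hs'.le]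
      ring
  have h2 : ∀ r ∈ Set.Ioi (0 : ℝ),
      HasDerivWithinAt (fun r : ℝ ↦ r ^ 2 / 2 + v) r (Set.Ioi 0) r := by
    intro r _
    have := ((hasDerivAt_pow 2 r).div_const 2).add_const v
    refine (this.congr_deriv ?_).hasDerivWithinAt
    push_cast
    ring
  have h3 : Set.InjOn (fun r : ℝ ↦ r ^ 2 / 2 + v) (Set.Ioi 0) := by
    intro r hr r' hr' h
    have h4 : r ^ 2 = r' ^ 2 := by
      have : r ^ 2 / 2 + v = r' ^ 2 / 2 + v := h
      linarith
    exact (pow_left_inj₀ (le_of_lt hr) (le_of_lt hr') two_ne_zero).1 h4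
  rw [← h1, lintegral_image_eq_lintegral_abs_deriv_mul measurableSet_Ioi h2 h3]
  refine setLIntegral_congr_fun measurableSet_Ioi fun r hr ↦ ?_
  have hr0 : (0 : ℝ) < r := hr
  have h4 : 2 * (r ^ 2 / 2 + v - v) = r ^ 2 := by ring
  rw [h4, Real.sqrt_sq hr0.le, ← mul_assoc, ← ENNReal.ofReal_mul (abs_nonneg r), abs_of_pos hr0]
  congr 2
  rw [← Real.rpow_natCast r 2, ← Real.rpow_mul hr0.le, ← Real.rpow_natCast r (N - 1),
    Nat.cast_sub hN]
  nth_rewrite 1 [← Real.rpow_one r]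
  rw [← Real.rpow_add hr0]
  congr 1
  push_cast
  ring

section Energy

variable {N : ℕ} {M : Type*} [TopologicalSpace M] [ChartedSpace (EuclideanSpace ℝ (Fin N)) M]

/-- The covector in the direction of `z` at which a particle has energy `s`. -/
def energyMap (V : M → ℝ) (w : ℝ × CotangentBundle N M) : CotangentBundle N M :=
  scaleCovector √(2 * (w.1 - V w.2.proj)) w.2

/-- The density `N! (2 (s - V))^(N/2 - 1)` of the Liouville measure in energy coordinates. -/
def energyDensity (V : M → ℝ) (w : ℝ × CotangentBundle N M) : ℝ :=
  (N.factorial : ℝ) * (2 * (w.1 - V w.2.proj)) ^ ((N : ℝ) / 2 - 1)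

variable [IsManifold (𝓡 N) ∞ M]

lemma continuous_energy {V : M → ℝ} (hV : Continuous V) :
    Continuous fun w : ℝ × CotangentBundle N M ↦ 2 * (w.1 - V w.2.proj) :=
  continuous_const.mul (continuous_fst.sub
    (hV.comp (continuous_cotangent_proj.comp continuous_snd)))

lemma continuous_energyMap {V : M → ℝ} (hV : Continuous V) :
    Continuous (energyMap (N := N) V) :=
  continuous_scaleCovector.comp ((continuous_energy hV).sqrt.prodMk continuous_snd)

lemma energyDensity_nonneg {V : M → ℝ} {w : ℝ × CotangentBundle N M} (hw : V w.2.proj < w.1) :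
    0 ≤ energyDensity V w :=
  mul_nonneg (Nat.cast_nonneg _) (Real.rpow_nonneg (by linarith) _)

variable [RiemannianBundle (fun q : M ↦ TangentSpace (𝓡 N) q)]

lemma hamiltonian_energyMap {V : M → ℝ} {w : ℝ × CotangentBundle N M}
    (hw : V w.2.proj < w.1) (hw1 : covectorNorm (N := N) w.2.snd = 1) :
    hamiltonian (N := N) V (energyMap V w) = w.1 := by
  rw [energyMap, hamiltonian_scaleCovector, hw1, Real.sq_sqrt (by linarith)]
  ring

lemma covectorNorm_energyMap {V : M → ℝ} {w : ℝ × CotangentBundle N M}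
    (hw1 : covectorNorm (N := N) w.2.snd = 1) :
    covectorNorm (N := N) (energyMap V w).snd = √(2 * (w.1 - V w.2.proj)) := by
  rw [energyMap, covectorNorm_scaleCovector, hw1, mul_one, abs_of_nonneg (Real.sqrt_nonneg _)]

lemma energyMap_snd_ne_zero {V : M → ℝ} {w : ℝ × CotangentBundle N M}
    (hw : V w.2.proj < w.1) (hw1 : covectorNorm (N := N) w.2.snd = 1) :
    (energyMap V w).snd ≠ 0 := by
  refine snd_ne_zero_of_covectorNorm_pos ?_
  rw [covectorNorm_energyMap hw1]
  exact Real.sqrt_pos.2 (by linarith)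

variable (N) in
/-- The pairs of an energy `s` and a unit covector over a point with `V < s`. -/
def energyDomain (V : M → ℝ) : Set (ℝ × CotangentBundle N M) :=
  {w | V w.2.proj < w.1 ∧ covectorNorm (N := N) w.2.snd = 1}

/-- A continuous function with compact support that agrees with `energyDensity V · ψ ∘ energyMap V`
on the unit cosphere bundle: the latter is cut off to `1/2 ≤ |p| ≤ 3/2` after having been made
homogeneous of degree `0`. -/
def energyTest (V : M → ℝ) (ψ : CotangentBundle N M → ℝ) : ℝ × CotangentBundle N M → ℝ :=
  {w : ℝ × CotangentBundle N M | V w.2.proj < w.1 ∧ w.2.snd ≠ 0}.indicator fun w ↦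
    max 0 (1 - 2 * |covectorNorm (N := N) w.2.snd - 1|) *
      (energyDensity V w * ψ (energyMap V (w.1, normalizeCovector w.2)))

lemma energyTest_eq {V : M → ℝ} {ψ : CotangentBundle N M → ℝ} {w : ℝ × CotangentBundle N M}
    (hw1 : covectorNorm (N := N) w.2.snd = 1) :
    energyTest V ψ w = (energyDomain N V).indicator (fun w ↦ energyDensity V w * ψ (energyMap V w)) w := by
  have hz : w.2.snd ≠ 0 := snd_ne_zero_of_covectorNorm_pos (by rw [hw1]; exact one_pos)
  have hn : normalizeCovector w.2 = w.2 := by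
    rw [normalizeCovector_eq, hw1, inv_one, scaleCovector_one]
  by_cases hw : V w.2.proj < w.1
  · have h1 : w ∈ energyDomain N V := ⟨hw, hw1⟩
    have h2 : w ∈ {w : ℝ × CotangentBundle N M | V w.2.proj < w.1 ∧ w.2.snd ≠ 0} := ⟨hw, hz⟩
    rw [energyTest, Set.indicator_of_mem h2, Set.indicator_of_mem h1, hw1, hn]
    simp
  · have h1 : w ∉ energyDomain N V := fun h ↦ hw h.1
    have h2 : w ∉ {w : ℝ × CotangentBundle N M | V w.2.proj < w.1 ∧ w.2.snd ≠ 0} :=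
      fun h ↦ hw h.1
    rw [energyTest, Set.indicator_of_notMem h2, Set.indicator_of_notMem h1]

variable [T2Space M] [SecondCountableTopology M]
  [IsContMDiffRiemannianBundle (𝓡 N) ∞ (EuclideanSpace ℝ (Fin N))
    (fun q : M ↦ TangentSpace (𝓡 N) q)]

lemma continuous_energyTest {V : M → ℝ} (hV : ContMDiff (𝓡 N) 𝓘(ℝ, ℝ) ∞ V)
    {ψ : CotangentBundle N M → ℝ} (hψ : Continuous ψ) (hψc : HasCompactSupport ψ)
    (hψU : tsupport ψ ⊆ {z | z.snd ≠ 0}) :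
    Continuous (energyTest V ψ) ∧ HasCompactSupport (energyTest V ψ) := by
  set O : Set (ℝ × CotangentBundle N M) := {w | V w.2.proj < w.1 ∧ w.2.snd ≠ 0} with hO
  have hOo : IsOpen O :=
    (isOpen_lt (hV.continuous.comp (continuous_cotangent_proj.comp continuous_snd))
      continuous_fst).inter (isOpen_snd_ne_zero.preimage continuous_snd)
  -- `f` recovers a pair `(s, z)` from the covector of energy `s` in the direction of `z` and from
  -- the length of `z`; the support lies over `tsupport ψ` and lengths in `[1/2, 2]`
  set f : CotangentBundle N M × ℝ → ℝ × CotangentBundle N M := fun x ↦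
    (hamiltonian (N := N) V x.1, scaleCovector x.2 (normalizeCovector x.1)) with hf
  set K : Set (ℝ × CotangentBundle N M) := f '' (tsupport ψ ×ˢ Set.Icc (1 / 2) 2) with hK
  have hfc : ContinuousOn f (tsupport ψ ×ˢ Set.Icc (1 / 2) 2) := by
    refine ((contMDiff_hamiltonian (N := N) hV).continuous.comp continuous_fst).continuousOn.prodMk
      (continuous_scaleCovector.comp_continuousOn (continuousOn_snd.prodMk
        (continuousOn_normalizeCovector.comp continuousOn_fst fun x hx ↦ hψU hx.1)))
  have hKc : IsCompact K := (hψc.isCompact.prod isCompact_Icc).image_of_continuousOn hfc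
  have hKO : K ⊆ O := by
    rintro _ ⟨⟨x, r⟩, ⟨hx, hr⟩, rfl⟩
    have hx0 := hψU hx
    have h1 := covectorNorm_pos (z := x) hx0
    refine ⟨?_, snd_ne_zero_of_covectorNorm_pos (z := scaleCovector r (normalizeCovector x)) ?_⟩
    · show V x.proj < hamiltonian (N := N) V x
      rw [hamiltonian]
      have := sq_pos_of_pos h1
      linarith
    · rw [covectorNorm_scaleCovector, covectorNorm_normalizeCovector hx0, mul_one]
      exact abs_pos.2 (by linarith [hr.1] : (0 : ℝ) < r).ne'
  have h0 : ∀ w ∈ O, w ∉ K → max 0 (1 - 2 * |covectorNorm (N := N) w.2.snd - 1|) *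
      (energyDensity V w * ψ (energyMap V (w.1, normalizeCovector w.2))) = 0 := by
    rintro ⟨s, z⟩ ⟨hw, hz⟩ hwK
    by_contra hne
    refine hwK ?_
    have h1 := left_ne_zero_of_mul hne
    have h2 := right_ne_zero_of_mul (right_ne_zero_of_mul hne)
    have hw' : 0 < 2 * (s - V z.proj) := by linarith [show V z.proj < s from hw]
    have h3 : |covectorNorm (N := N) z.snd - 1| < 1 / 2 := by
      by_contra h4
      exact h1 (max_eq_left (by linarith [not_lt.1 h4]))
    have h4 := abs_lt.1 h3
    have hn := covectorNorm_normalizeCovector hz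
    refine ⟨(energyMap V (s, normalizeCovector z), covectorNorm (N := N) z.snd),
      ⟨subset_tsupport _ h2, ?_, ?_⟩, Prod.ext ?_ ?_⟩
    · dsimp only; linarith [h4.1]
    · dsimp only; linarith [h4.2]
    · exact hamiltonian_energyMap (V := V) (w := (s, normalizeCovector z)) hw hn
    · show scaleCovector (covectorNorm (N := N) z.snd) (normalizeCovector (energyMap V
        (s, normalizeCovector z))) = z
      exact (congrArg (scaleCovector _) (normalizeCovector_scaleCovector hn
        (Real.sqrt_pos.2 hw'))).trans (scaleCovector_normalizeCovector hz)
  have hg : ContinuousOn (fun w : ℝ × CotangentBundle N M ↦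
      max 0 (1 - 2 * |covectorNorm (N := N) w.2.snd - 1|) *
      (energyDensity V w * ψ (energyMap V (w.1, normalizeCovector w.2)))) O := by
    refine ContinuousOn.mul (Continuous.continuousOn ?_) (ContinuousOn.mul (ContinuousOn.mul
      continuousOn_const ((continuous_energy hV.continuous).continuousOn.rpow_const ?_))
      (hψ.comp_continuousOn ((continuous_energyMap hV.continuous).comp_continuousOn
        (continuousOn_fst.prodMk
          (continuousOn_normalizeCovector.comp continuousOn_snd fun w hw ↦ hw.2)))))
    · exact continuous_const.max (continuous_const.sub (continuous_const.mul
        ((continuous_covectorNorm.comp continuous_snd).sub continuous_const).abs))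
    · intro w hw
      exact Or.inl (by linarith [show V w.2.proj < w.1 from hw.1] : 0 < 2 * (w.1 - V w.2.proj)).ne'
  exact ⟨continuous_indicator_of_isCompact hOo hKc hKO hg h0, hasCompactSupport_indicator hKc h0⟩

end Energy

/-! ### The level measure on the set of nonzero covectors -/

section Formula

variable {N : ℕ} {M : Type*} [TopologicalSpace M] [ChartedSpace (EuclideanSpace ℝ (Fin N)) M]
  [IsManifold (𝓡 N) ∞ M] [RiemannianBundle (fun q : M ↦ TangentSpace (𝓡 N) q)]
  [T2Space M] [SecondCountableTopology M] [MeasurableSpace M] [BorelSpace M]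
  [IsContMDiffRiemannianBundle (𝓡 N) ∞ (EuclideanSpace ℝ (Fin N))
    (fun q : M ↦ TangentSpace (𝓡 N) q)]

lemma measurableSet_energyDomain {V : M → ℝ} (hV : Continuous V) :
    MeasurableSet (energyDomain N V) :=
  (isOpen_lt (hV.comp (continuous_cotangent_proj.comp continuous_snd))
    continuous_fst).measurableSet.inter
    (isClosed_eq (continuous_covectorNorm.comp continuous_snd) continuous_const).measurableSet

lemma measurable_energyDensity {V : M → ℝ} (hV : Continuous V) :
    Measurable (energyDensity (N := N) V) :=
  ((continuous_energy hV).measurable.pow_const _).const_mul _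

lemma ae_covectorNorm_eq_one :
    ∀ᵐ z ∂(cosphereBundleMeasure N M), covectorNorm (N := N) z.snd = 1 :=
  cosphereBundleMeasure_covectorNorm_ne_one

/-- The Liouville measure in energy coordinates. -/
lemma restrict_liouvilleMeasure_eq_map (hN : 1 ≤ N) {V : M → ℝ} (hV : Continuous V) :
    (liouvilleMeasure N M).restrict {z | z.snd ≠ 0} =
      (((volume.prod (cosphereBundleMeasure N M)).restrict (energyDomain N V)).withDensity
        fun w ↦ ENNReal.ofReal (energyDensity V w)).map (energyMap V) := by
  have := isFiniteMeasureOnCompacts_cosphereBundleMeasure (M := M) hN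
  refine Measure.ext fun B hB ↦ ?_
  have hΨ := (continuous_energyMap (N := N) hV).measurable
  have hU : MeasurableSet {z : CotangentBundle N M | z.snd ≠ 0} := isOpen_snd_ne_zero.measurableSet
  have hW := measurableSet_energyDomain (N := N) hV
  have hJ := (measurable_energyDensity (N := N) hV).ennreal_ofReal
  rw [Measure.map_apply hΨ hB, withDensity_apply _ (hΨ hB), Measure.restrict_restrict (hΨ hB),
    ← lintegral_indicator ((hΨ hB).inter hW),
    lintegral_prod_symm _ (hJ.indicator ((hΨ hB).inter hW)).aemeasurable,
    Measure.restrict_apply hB, ← lintegral_indicator_one (hB.inter hU),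
    lintegral_liouvilleMeasure hN (measurable_one.indicator (hB.inter hU)),
    ← lintegral_const_mul' _ _ (ENNReal.natCast_ne_top _)]
  refine lintegral_congr_ae ?_
  filter_upwards [ae_covectorNorm_eq_one] with z hz
  have h1 := setLIntegral_Ioi_energy hN (V z.proj) fun r ↦
    B.indicator 1 (scaleCovector r z)
  have h2 : ∫⁻ r in Set.Ioi (0 : ℝ), ENNReal.ofReal (r ^ (N - 1)) *
      (B ∩ {z | z.snd ≠ 0}).indicator 1 (scaleCovector r z) =
      ∫⁻ r in Set.Ioi (0 : ℝ), ENNReal.ofReal (r ^ (N - 1)) *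
        B.indicator 1 (scaleCovector r z) := by
    refine setLIntegral_congr_fun measurableSet_Ioi fun r hr ↦ ?_
    have h3 : (scaleCovector r z).snd ≠ 0 := by
      refine snd_ne_zero_of_covectorNorm_pos ?_
      rw [covectorNorm_scaleCovector, hz, mul_one]
      exact abs_pos.2 (ne_of_gt hr)
    refine congrArg _ ?_
    by_cases hB' : scaleCovector r z ∈ B
    · rw [Set.indicator_of_mem hB', Set.indicator_of_mem (Set.mem_inter hB' h3)]
    · rw [Set.indicator_of_notMem hB', Set.indicator_of_notMem fun h ↦ hB' h.1]
  rw [h2, ← h1, ← lintegral_const_mul' _ _ (ENNReal.natCast_ne_top _),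
    ← lintegral_indicator measurableSet_Ioi]
  refine lintegral_congr fun s ↦ ?_
  by_cases hs : V z.proj < s
  · rw [Set.indicator_of_mem (show s ∈ Set.Ioi (V z.proj) from hs)]
    by_cases hB' : energyMap V (s, z) ∈ B
    · rw [Set.indicator_of_mem (show (s, z) ∈ energyMap V ⁻¹' B ∩ energyDomain N V from
        ⟨hB', hs, hz⟩), Set.indicator_of_mem (show scaleCovector √(2 * (s - V z.proj)) z ∈ B
        from hB'), Pi.one_apply, mul_one, energyDensity, ENNReal.ofReal_mul (Nat.cast_nonneg _),
        ENNReal.ofReal_natCast]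
    · rw [Set.indicator_of_notMem (fun h : (s, z) ∈ energyMap V ⁻¹' B ∩ energyDomain N V ↦
        hB' h.1), Set.indicator_of_notMem (show scaleCovector √(2 * (s - V z.proj)) z ∉ B
        from hB'), mul_zero, mul_zero]
  · rw [Set.indicator_of_notMem (show s ∉ Set.Ioi (V z.proj) from hs),
      Set.indicator_of_notMem (fun h : (s, z) ∈ energyMap V ⁻¹' B ∩ energyDomain N V ↦ hs h.2.1)]

variable (N) in
/-- The image, under rescaling of unit covectors to the energy `E`, of the measure
`N! (2 (E - V))^(N/2 - 1) dσ_1 dv` on the unit cosphere bundle over `{V < E}`. -/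
def cosphereLevelMeasure (V : M → ℝ) (E : ℝ) : Measure (CotangentBundle N M) :=
  (((cosphereBundleMeasure N M).restrict {z | V z.proj < E}).withDensity fun z ↦
    ENNReal.ofReal (energyDensity V (E, z))).map fun z ↦ energyMap V (E, z)

lemma measurableSet_lt_energy {V : M → ℝ} (hV : Continuous V) (E : ℝ) :
    MeasurableSet {z : CotangentBundle N M | V z.proj < E} :=
  (isOpen_lt (hV.comp continuous_cotangent_proj) continuous_const).measurableSet

lemma lintegral_cosphereLevelMeasure {V : M → ℝ} (hV : Continuous V) (E : ℝ)
    {f : CotangentBundle N M → ENNReal} (hf : Measurable f) :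
    ∫⁻ z, f z ∂(cosphereLevelMeasure N V E) = ∫⁻ z in {z | V z.proj < E},
      ENNReal.ofReal (energyDensity V (E, z)) * f (energyMap V (E, z))
        ∂(cosphereBundleMeasure N M) := by
  have hΨ : Measurable fun z : CotangentBundle N M ↦ energyMap V (E, z) :=
    (continuous_energyMap (N := N) hV).measurable.comp measurable_prodMk_left
  have hJ : Measurable fun z : CotangentBundle N M ↦ ENNReal.ofReal (energyDensity V (E, z)) :=
    ((measurable_energyDensity (N := N) hV).comp measurable_prodMk_left).ennreal_ofReal
  rw [cosphereLevelMeasure, lintegral_map hf hΨ,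
    lintegral_withDensity_eq_lintegral_mul _ hJ
      (show Measurable fun z ↦ f (energyMap V (E, z)) from hf.comp hΨ)]
  rfl

lemma energyDensity_mk_nonneg {V : M → ℝ} {E : ℝ} {z : CotangentBundle N M}
    (h : V z.proj < E) : 0 ≤ energyDensity (N := N) V (E, z) :=
  energyDensity_nonneg (N := N) (w := (E, z)) h

lemma energyTest_mk_eq {V : M → ℝ} {E : ℝ} (ψ : CotangentBundle N M → ℝ)
    {z : CotangentBundle N M} (hz : covectorNorm (N := N) z.snd = 1) :
    energyTest V ψ (E, z) = {z : CotangentBundle N M | V z.proj < E}.indicator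
      (fun z ↦ energyDensity V (E, z) * ψ (energyMap V (E, z))) z := by
  rw [energyTest_eq (N := N) (w := (E, z)) hz]
  by_cases h : V z.proj < E
  · have h1 : z ∈ {z : CotangentBundle N M | V z.proj < E} := h
    have h2 : (E, z) ∈ energyDomain N V := And.intro h hz
    rw [Set.indicator_of_mem h1, Set.indicator_of_mem h2]
  · have h1 : z ∉ {z : CotangentBundle N M | V z.proj < E} := h
    have h2 : (E, z) ∉ energyDomain N V := fun h' ↦ h h'.1
    rw [Set.indicator_of_notMem h1, Set.indicator_of_notMem h2]

lemma ofReal_energyTest_mk_eq {V : M → ℝ} {E : ℝ} (ψ : CotangentBundle N M → ℝ)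
    {z : CotangentBundle N M} (hz : covectorNorm (N := N) z.snd = 1) :
    ENNReal.ofReal (energyTest V ψ (E, z)) = {z : CotangentBundle N M | V z.proj < E}.indicator
      (fun z ↦ ENNReal.ofReal (energyDensity V (E, z)) *
        ENNReal.ofReal (ψ (energyMap V (E, z)))) z := by
  rw [energyTest_mk_eq ψ hz]
  by_cases h : z ∈ {z : CotangentBundle N M | V z.proj < E}
  · rw [Set.indicator_of_mem h, Set.indicator_of_mem h,
      ENNReal.ofReal_mul (energyDensity_mk_nonneg h)]
  · rw [Set.indicator_of_notMem h, Set.indicator_of_notMem h, ENNReal.ofReal_zero]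

/-- Since `dσ_1 dv` is concentrated on unit covectors, the integrand may be replaced by its continuous
extension `energyTest`. -/
lemma integral_cosphereLevelMeasure {V : M → ℝ} (hV : Continuous V) (E : ℝ)
    {ψ : CotangentBundle N M → ℝ} (hψ : Continuous ψ) :
    ∫ z, ψ z ∂(cosphereLevelMeasure N V E) =
      ∫ z, energyTest V ψ (E, z) ∂(cosphereBundleMeasure N M) := by
  have hΨ : Measurable fun z : CotangentBundle N M ↦ energyMap V (E, z) :=
    (continuous_energyMap (N := N) hV).measurable.comp measurable_prodMk_left
  have hJ : Measurable fun z : CotangentBundle N M ↦ ENNReal.ofReal (energyDensity V (E, z)) :=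
    ((measurable_energyDensity (N := N) hV).comp measurable_prodMk_left).ennreal_ofReal
  have hm := measurableSet_lt_energy (N := N) hV E
  rw [cosphereLevelMeasure, integral_map hΨ.aemeasurable hψ.aestronglyMeasurable,
    integral_withDensity_eq_integral_toReal_smul hJ
      (Filter.Eventually.of_forall fun _ ↦ ENNReal.ofReal_lt_top), ← integral_indicator hm]
  refine integral_congr_ae ?_
  filter_upwards [ae_covectorNorm_eq_one] with z hz
  rw [energyTest_mk_eq ψ hz]
  refine congrFun (Set.indicator_congr fun x hx ↦ ?_) z
  rw [ENNReal.toReal_ofReal (energyDensity_mk_nonneg hx), smul_eq_mul]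

lemma integrable_energyTest (hN : 1 ≤ N) {V : M → ℝ} (hV : ContMDiff (𝓡 N) 𝓘(ℝ, ℝ) ∞ V) (E : ℝ)
    {ψ : CotangentBundle N M → ℝ} (hψ : Continuous ψ) (hψc : HasCompactSupport ψ)
    (hψU : tsupport ψ ⊆ {z | z.snd ≠ 0}) :
    Integrable (fun z ↦ energyTest V ψ (E, z)) (cosphereBundleMeasure N M) := by
  have := isFiniteMeasureOnCompacts_cosphereBundleMeasure (M := M) hN
  obtain ⟨h1, h2⟩ := continuous_energyTest hV hψ hψc hψU
  refine (h1.comp (Continuous.prodMk_right E)).integrable_of_hasCompactSupport ?_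
  refine HasCompactSupport.of_support_subset_isCompact (h2.image continuous_snd) fun z hz ↦ ?_
  exact ⟨(E, z), subset_tsupport _ hz, rfl⟩

lemma cosphereLevelMeasure_compl {V : M → ℝ} (hV : Continuous V) (E : ℝ) :
    cosphereLevelMeasure N V E {z : CotangentBundle N M | z.snd ≠ 0}ᶜ = 0 := by
  have hU : MeasurableSet {z : CotangentBundle N M | z.snd ≠ 0} := isOpen_snd_ne_zero.measurableSet
  rw [← lintegral_indicator_one hU.compl,
    lintegral_cosphereLevelMeasure hV E (measurable_one.indicator hU.compl)]
  refine (lintegral_congr_ae ?_).trans lintegral_zero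
  filter_upwards [ae_restrict_of_ae ae_covectorNorm_eq_one,
    ae_restrict_mem (measurableSet_lt_energy (N := N) hV E)] with z hz hzE
  have h1 : energyMap V (E, z) ∉ {z : CotangentBundle N M | z.snd ≠ 0}ᶜ :=
    fun h ↦ h (energyMap_snd_ne_zero (N := N) (w := (E, z)) hzE hz)
  rw [Set.indicator_of_notMem h1, mul_zero]

/-- The measure of a compact set is bounded by the integral of a continuous cut-off function, which
is the integral of an `energyTest`. -/
lemma cosphereLevelMeasure_lt_top (hN : 1 ≤ N) {V : M → ℝ}
    (hV : ContMDiff (𝓡 N) 𝓘(ℝ, ℝ) ∞ V) (E : ℝ) {C : Set (CotangentBundle N M)}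
    (hC : IsCompact C) (hCU : C ⊆ {z | z.snd ≠ 0}) : cosphereLevelMeasure N V E C < ⊤ := by
  obtain ⟨K, hK, hCK, hKU⟩ := exists_compact_between hC isOpen_snd_ne_zero hCU
  obtain ⟨χ, hχ1, hχ0, hχc, hχ⟩ := exists_continuous_one_zero_of_isCompact hC
    isOpen_interior.isClosed_compl (Set.disjoint_compl_right_iff_subset.2 hCK)
  have hχU : tsupport χ ⊆ {z | z.snd ≠ 0} := by
    refine (closure_minimal (fun x hx ↦ ?_) hK.isClosed).trans hKU
    by_contra hxK
    exact hx (hχ0 fun h ↦ hxK (interior_subset h))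
  have h1 : cosphereLevelMeasure N V E C ≤
      ∫⁻ z, ENNReal.ofReal (χ z) ∂(cosphereLevelMeasure N V E) := by
    rw [← lintegral_indicator_one hC.measurableSet]
    refine lintegral_mono fun z ↦ ?_
    by_cases hz : z ∈ C
    · rw [Set.indicator_of_mem hz, hχ1 hz]
      simp
    · rw [Set.indicator_of_notMem hz]
      exact zero_le
  have h2 : ∫⁻ z, ENNReal.ofReal (χ z) ∂(cosphereLevelMeasure N V E) =
      ∫⁻ z, ENNReal.ofReal (energyTest V χ (E, z)) ∂(cosphereBundleMeasure N M) := by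
    rw [lintegral_cosphereLevelMeasure hV.continuous E χ.continuous.measurable.ennreal_ofReal,
      ← lintegral_indicator (measurableSet_lt_energy (N := N) hV.continuous E)]
    refine lintegral_congr_ae ?_
    filter_upwards [ae_covectorNorm_eq_one] with z hz
    exact (ofReal_energyTest_mk_eq χ hz).symm
  exact h1.trans_lt (h2.trans_lt
    (integrable_energyTest hN hV E χ.continuous hχc hχU).lintegral_lt_top)

/-- On the set `{p ≠ 0}`, the slice of the Liouville measure at `s = E`, in energy coordinates, is
the level measure. -/
lemma isLevelMeasureOn_cosphereLevelMeasure (hN : 1 ≤ N) {V : M → ℝ}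
    (hV : ContMDiff (𝓡 N) 𝓘(ℝ, ℝ) ∞ V) (E : ℝ) :
    IsLevelMeasureOn (liouvilleMeasure N M) (hamiltonian V) E {z | z.snd ≠ 0}
      (cosphereLevelMeasure N V E) := by
  have := isFiniteMeasureOnCompacts_cosphereBundleMeasure (M := M) hN
  have hVc := hV.continuous
  refine ⟨cosphereLevelMeasure_compl hVc E, fun C hC hCU ↦ cosphereLevelMeasure_lt_top hN hV E
    hC hCU, fun ψ hψ hψc hψU ↦ ?_⟩
  obtain ⟨h1, h2⟩ := continuous_energyTest hV hψ hψc hψU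
  have h3 : ∀ᵐ w ∂(volume : Measure ℝ).prod (cosphereBundleMeasure N M),
      covectorNorm (N := N) w.2.snd = 1 :=
    Measure.quasiMeasurePreserving_snd.ae ae_covectorNorm_eq_one
  have h4 : energyTest V ψ =ᵐ[(volume : Measure ℝ).prod (cosphereBundleMeasure N M)]
      (energyDomain N V).indicator fun w ↦ energyDensity V w * ψ (energyMap V w) := by
    filter_upwards [h3] with w hw
    exact energyTest_eq hw
  have h5 : ∀ w ∈ energyDomain N V, hamiltonian (N := N) V (energyMap V w) = w.1 :=
    fun w hw ↦ hamiltonian_energyMap (N := N) hw.1 hw.2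
  have h6 : ∀ w ∈ energyDomain N V, 0 ≤ energyDensity (N := N) (M := M) V w :=
    fun w hw ↦ energyDensity_nonneg (N := N) hw.1
  rw [integral_cosphereLevelMeasure hVc E hψ]
  exact hasDerivAt_setIntegral_of_map_eq (contMDiff_hamiltonian hV).continuous.measurable
    (measurableSet_energyDomain hVc) (continuous_energyMap hVc).measurable.aemeasurable
    (measurable_energyDensity hVc).aemeasurable h6 h5 (restrict_liouvilleMeasure_eq_map hN hVc)
    hψ.measurable (fun x hx ↦ image_eq_zero_of_notMem_tsupport fun h ↦ hx (hψU h)) h1 h2 h4 E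

end Formula

/-! ### The formula on the unit cosphere bundle -/

section Comap

variable {N : ℕ} {M : Type*} [TopologicalSpace M] [ChartedSpace (EuclideanSpace ℝ (Fin N)) M]
  [RiemannianBundle (fun q : M ↦ TangentSpace (𝓡 N) q)]

lemma energyMap_normalizeCovector {V : M → ℝ} {E : ℝ} {z : CotangentBundle N M}
    (hz : z ∈ levelNonzero (N := N) V E) : energyMap V (E, normalizeCovector z) = z := by
  have h1 := scaleCovector_sqrt_normalizeCovector (N := N) hz
  have h2 : V z.proj = V (normalizeCovector z).proj := rfl
  rw [h2] at h1
  exact h1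

lemma normalizeCovector_energyMap {V : M → ℝ} {E : ℝ} {z : CotangentBundle N M}
    (hz : z ∈ cosphereBundle (N := N) V E) : normalizeCovector (energyMap V (E, z)) = z :=
  normalizeCovector_scaleCovector_sqrt (N := N) hz

/-- Images under `normalizeCovector` are preimages under its inverse, the rescaling to energy `E`. -/
lemma image_normalizeCovector {V : M → ℝ} {E : ℝ} {A : Set (CotangentBundle N M)}
    (hA : A ⊆ levelNonzero (N := N) V E) : normalizeCovector '' A =
      cosphereBundle (N := N) V E ∩ (fun z ↦ energyMap V (E, z)) ⁻¹' A := by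
  ext z
  constructor
  · rintro ⟨x, hx, rfl⟩
    refine ⟨normalizeCovector_mem_cosphereBundle (hA hx), ?_⟩
    rw [Set.mem_preimage, energyMap_normalizeCovector (hA hx)]
    exact hx
  · rintro ⟨hz, hzA⟩
    exact ⟨_, hzA, normalizeCovector_energyMap hz⟩

variable [IsManifold (𝓡 N) ∞ M]
  [IsContMDiffRiemannianBundle (𝓡 N) ∞ (EuclideanSpace ℝ (Fin N))
    (fun q : M ↦ TangentSpace (𝓡 N) q)]

lemma measurableSet_levelNonzero {V : M → ℝ} (hV : ContMDiff (𝓡 N) 𝓘(ℝ, ℝ) ∞ V) (E : ℝ) :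
    MeasurableSet (levelNonzero (N := N) V E) :=
  (isClosed_eq (contMDiff_hamiltonian (N := N) hV).continuous
    continuous_const).measurableSet.inter isOpen_snd_ne_zero.measurableSet

lemma measurableSet_cosphereBundle {V : M → ℝ} (hV : Continuous V) (E : ℝ) :
    MeasurableSet (cosphereBundle (N := N) V E) :=
  (isOpen_lt (hV.comp continuous_cotangent_proj) continuous_const).measurableSet.inter
    (isClosed_eq continuous_covectorNorm continuous_const).measurableSet

lemma measurableEmbedding_normalizeCovector {V : M → ℝ} (hV : ContMDiff (𝓡 N) 𝓘(ℝ, ℝ) ∞ V)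
    (E : ℝ) : MeasurableEmbedding fun x : levelNonzero (N := N) V E ↦ normalizeCovector x.1 where
  injective x y h := Subtype.ext (normalizeCovector_injOn V E x.2 y.2 h)
  measurable := (continuousOn_iff_continuous_domRestrict.1 (continuousOn_normalizeCovector.mono
    fun z hz ↦ snd_ne_zero_of_mem_levelNonzero hz)).measurable
  measurableSet_image' := by
    intro B hB
    have h1 := (MeasurableEmbedding.subtype_coe
      (measurableSet_levelNonzero hV E)).measurableSet_image.2 hB
    have h2 : (fun x : levelNonzero (N := N) V E ↦ normalizeCovector x.1) '' B =
        normalizeCovector '' (Subtype.val '' B) := (Set.image_image _ _ _).symm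
    rw [h2, image_normalizeCovector (Subtype.coe_image_subset _ _)]
    exact (measurableSet_cosphereBundle hV.continuous E).inter
      ((continuous_energyMap hV.continuous).measurable.comp measurable_prodMk_left h1)

variable [T2Space M] [SecondCountableTopology M] [MeasurableSpace M] [BorelSpace M]

/-- The measure `cosphereLevelMeasure` on the part `p ≠ 0` of the level set, expressed by pulling
back the measure `dσ_1 dv` under `normalizeCovector`. -/
lemma comap_cosphereLevelMeasure {V : M → ℝ} (hV : ContMDiff (𝓡 N) 𝓘(ℝ, ℝ) ∞ V) (E : ℝ) :
    (cosphereLevelMeasure N V E).comap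
        (fun x : levelNonzero (N := N) V E ↦ (x : CotangentBundle N M)) =
      ((cosphereBundleMeasure N M).comap
        (fun x : levelNonzero (N := N) V E ↦ normalizeCovector x.1)).withDensity
        (fun x ↦ ENNReal.ofReal
          ((N.factorial : ℝ) * (2 * (E - V x.1.proj)) ^ ((N : ℝ) / 2 - 1))) := by
  have hVc := hV.continuous
  have he := measurableEmbedding_normalizeCovector (N := N) hV E
  have hs := MeasurableEmbedding.subtype_coe (measurableSet_levelNonzero (N := N) hV E)
  refine Measure.ext fun B hB ↦ ?_
  have hBm := hs.measurableSet_image.2 hB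
  have h1 : (fun x : levelNonzero (N := N) V E ↦ normalizeCovector x.1) '' B =
      cosphereBundle (N := N) V E ∩ (fun z ↦ energyMap V (E, z)) ⁻¹' (Subtype.val '' B) :=
    (Set.image_image _ _ _).symm.trans (image_normalizeCovector (Subtype.coe_image_subset _ _))
  have hJ : Measurable fun z : CotangentBundle N M ↦ ENNReal.ofReal (energyDensity V (E, z)) :=
    ((measurable_energyDensity (N := N) hVc).comp measurable_prodMk_left).ennreal_ofReal
  have h2 := setLIntegral_map (μ := (cosphereBundleMeasure N M).comap
    (fun x : levelNonzero (N := N) V E ↦ normalizeCovector x.1))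
    (he.measurableSet_image.2 hB) hJ he.measurable
  rw [Set.preimage_image_eq _ he.injective, he.map_comap,
    Measure.restrict_restrict (he.measurableSet_image.2 hB),
    Set.inter_eq_left.2 (Set.image_subset_range _ _)] at h2
  rw [hs.comap_apply, withDensity_apply _ hB]
  refine Eq.trans ?_ h2
  rw [← lintegral_indicator_one hBm,
    lintegral_cosphereLevelMeasure hVc E (measurable_one.indicator hBm),
    ← lintegral_indicator (measurableSet_lt_energy (N := N) hVc E),
    ← lintegral_indicator (he.measurableSet_image.2 hB), h1]
  refine lintegral_congr_ae ?_
  filter_upwards [ae_covectorNorm_eq_one] with z hz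
  by_cases h : V z.proj < E
  · have h3 : z ∈ cosphereBundle (N := N) V E := ⟨h, hz⟩
    rw [Set.indicator_of_mem (show z ∈ {z : CotangentBundle N M | V z.proj < E} from h)]
    by_cases h4 : energyMap V (E, z) ∈ Subtype.val '' B
    · rw [Set.indicator_of_mem h4, Set.indicator_of_mem (Set.mem_inter h3 h4), Pi.one_apply,
        mul_one]
    · rw [Set.indicator_of_notMem h4, Set.indicator_of_notMem fun h5 ↦ h4 h5.2, mul_zero]
  · rw [Set.indicator_of_notMem (show z ∉ {z : CotangentBundle N M | V z.proj < E} from h),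
      Set.indicator_of_notMem fun h5 ↦ h h5.1.1]

/-- The formula for the restriction of the level measure to the part `p ≠ 0` of the level set. -/
lemma IsLevelMeasureOn.comap_levelNonzero {V : M → ℝ} (hV : ContMDiff (𝓡 N) 𝓘(ℝ, ℝ) ∞ V) {E : ℝ}
    {ν : Measure (CotangentBundle N M)}
    (hν : IsLevelMeasureOn (liouvilleMeasure N M) (hamiltonian V) E
      (regularSet (cotangentModel N) (hamiltonian (N := N) V)) ν) :
    ν.comap (fun x : levelNonzero (N := N) V E ↦ (x : CotangentBundle N M)) =
      ((cosphereBundleMeasure N M).comap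
        (fun x : levelNonzero (N := N) V E ↦ normalizeCovector x.1)).withDensity
        (fun x ↦ ENNReal.ofReal
          ((N.factorial : ℝ) * (2 * (E - V x.1.proj)) ^ ((N : ℝ) / 2 - 1))) := by
  -- in dimension `0` there are no nonzero covectors, and both sides are measures on the empty set
  rcases Nat.eq_zero_or_pos N with rfl | hN
  · have : IsEmpty (levelNonzero (N := 0) V E) := ⟨fun x ↦ x.2.2 (ContinuousLinearMap.ext fun v ↦ by
      rw [show v = 0 from Subsingleton.elim (α := EuclideanSpace ℝ (Fin 0)) _ _, map_zero,
        map_zero])⟩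
    exact Measure.ext fun B _ ↦ by rw [Set.eq_empty_of_isEmpty B, measure_empty, measure_empty]
  have h1 := (hν.restrict isOpen_snd_ne_zero fun z hz ↦ mem_regularSet_of_snd_ne_zero hV hz).unique
    isOpen_snd_ne_zero (isLevelMeasureOn_cosphereLevelMeasure hN hV E)
  have hs := MeasurableEmbedding.subtype_coe (measurableSet_levelNonzero (N := N) hV E)
  rw [← comap_cosphereLevelMeasure hV E, ← h1]
  refine Measure.ext fun B hB ↦ ?_
  rw [hs.comap_apply, hs.comap_apply, Measure.restrict_apply (hs.measurableSet_image.2 hB),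
    Set.inter_eq_left.2]
  rintro _ ⟨x, -, rfl⟩
  exact x.2.2

end Comap

/-! ### Existence, uniqueness and smoothness of the level measure -/

section LevelMeasure

variable {N : ℕ} {M : Type*} [TopologicalSpace M] [ChartedSpace (EuclideanSpace ℝ (Fin N)) M]
  [IsManifold (𝓡 N) ∞ M] [T2Space M] [SecondCountableTopology M]

lemma isLevelMeasure_iff {μ : Measure (CotangentBundle N M)} {H : CotangentBundle N M → ℝ} {E : ℝ}
    {ν : Measure (CotangentBundle N M)} : IsLevelMeasure (cotangentModel N) μ H E ν ↔
      IsLevelMeasureOn μ H E (regularSet (cotangentModel N) H) ν :=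
  ⟨fun h ↦ ⟨h.1, h.2, h.3⟩, fun h ↦ ⟨h.1, h.2, h.3⟩⟩

/-- On a manifold of dimension `0`, there are no regular points. -/
lemma pos_of_mem_regularSet {H : CotangentBundle N M → ℝ} {x : CotangentBundle N M}
    (hx : x ∈ regularSet (cotangentModel N) H) : 1 ≤ N := by
  by_contra hN
  obtain rfl : N = 0 := by omega
  have h1 : Subsingleton (PhaseSpace 0) := by
    refine finrank_zero_iff (R := ℝ) |>.1 ?_
    rw [finrank_phaseSpace]
  exact hx (Subsingleton.elim (α := PhaseSpace 0 →L[ℝ] ℝ) _ _)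

lemma finrank_phaseSpace_eq_add_one (hN : 1 ≤ N) :
    finrank ℝ (PhaseSpace N) = (2 * N - 1) + 1 := by
  rw [finrank_phaseSpace]
  omega

/-- Regular points exist only if `N ≥ 1`, and near each of them there is a level measure. These are
glued. -/
lemma existsUnique_isLevelMeasure {H : CotangentBundle N M → ℝ}
    (hH : ContMDiff (cotangentModel N) 𝓘(ℝ, ℝ) ∞ H) (E : ℝ) :
    ∃! ν : Measure (CotangentBundle N M),
      IsLevelMeasure (cotangentModel N) (liouvilleMeasure N M) H E ν := by
  obtain ⟨ν, hν⟩ := exists_isLevelMeasureOn_of_forall (μ := liouvilleMeasure N M) (H := H) (E := E)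
    (U := regularSet (cotangentModel N) H) fun x hx ↦ by
      obtain ⟨U, W, φ, φinv, f, hU, hxU, hUr, -, -, -, -, -, -, -, -, h⟩ :=
        exists_isLevelMeasureOn_nhds (I := cotangentModel N)
          ((N.factorial : ENNReal) • (canonicalBasis N).addHaar) liouvilleMeasure_apply
          (finrank_phaseSpace_eq_add_one (pos_of_mem_regularSet hx)) hH E hx
      exact ⟨U, hU, hxU, hUr, _, h⟩
  exact ⟨ν, isLevelMeasure_iff.2 hν, fun ν' hν' ↦
    (isLevelMeasure_iff.1 hν').unique (isOpen_regularSet hH) hν⟩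

/-- By uniqueness, the level measure agrees locally with the one constructed from a smooth
parametrization of the level set; being locally concentrated on the level set, it is so globally. -/
lemma IsLevelMeasureOn.isSmoothMeasureOn {H : CotangentBundle N M → ℝ}
    (hH : ContMDiff (cotangentModel N) 𝓘(ℝ, ℝ) ∞ H) {E : ℝ} {ν : Measure (CotangentBundle N M)}
    (hν : IsLevelMeasureOn (liouvilleMeasure N M) H E (regularSet (cotangentModel N) H) ν) :
    IsSmoothMeasureOn (cotangentModel N) (2 * N - 1) (regularLevel (cotangentModel N) H E) ν := by
  have hO := isOpen_regularSet hH
  have hSm : MeasurableSet (regularLevel (cotangentModel N) H E) :=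
    (isClosed_eq hH.continuous continuous_const).measurableSet.inter hO.measurableSet
  have hloc : ∀ x ∈ regularSet (cotangentModel N) H, ∃ (U : Set (CotangentBundle N M))
      (W : Set (EuclideanSpace ℝ (Fin (2 * N - 1))))
      (φ : EuclideanSpace ℝ (Fin (2 * N - 1)) → CotangentBundle N M)
      (φinv : CotangentBundle N M → EuclideanSpace ℝ (Fin (2 * N - 1)))
      (f : EuclideanSpace ℝ (Fin (2 * N - 1)) → ℝ),
      IsOpen U ∧ x ∈ U ∧ IsOpen W ∧
      ContMDiffOn (𝓡 (2 * N - 1)) (cotangentModel N) ∞ φ W ∧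
      (∀ w ∈ W, Function.Injective (mfderiv (𝓡 (2 * N - 1)) (cotangentModel N) φ w)) ∧
      φ '' W = regularLevel (cotangentModel N) H E ∩ U ∧
      ContinuousOn φinv (regularLevel (cotangentModel N) H E ∩ U) ∧ (∀ w ∈ W, φinv (φ w) = w) ∧
      ContDiffOn ℝ ∞ f W ∧ (∀ w ∈ W, 0 ≤ f w) ∧
      ν.restrict U =
        ((volume.restrict W).withDensity (fun w ↦ ENNReal.ofReal (f w))).map φ := by
    intro x hx
    obtain ⟨U, W, φ, φinv, f, hU, hxU, hUr, h1, h2, h3, h4, h5, h6, h7, h8, h9⟩ :=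
      exists_isLevelMeasureOn_nhds (I := cotangentModel N)
        ((N.factorial : ENNReal) • (canonicalBasis N).addHaar) liouvilleMeasure_apply
        (finrank_phaseSpace_eq_add_one (pos_of_mem_regularSet hx)) hH E hx
    exact ⟨U, W, φ, φinv, f, hU, hxU, h1, h2, h3, h4, h5, h6, h7, h8,
      (hν.restrict hU hUr).unique hU h9⟩
  refine ⟨?_, fun x hx ↦ hloc x hx.2⟩
  rw [← Set.inter_union_compl (regularLevel (cotangentModel N) H E)ᶜ
    (regularSet (cotangentModel N) H), measure_union_null_iff]
  refine ⟨measure_null_of_locally_null _ fun x hx ↦ ?_,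
    measure_mono_null Set.inter_subset_right hν.compl⟩
  obtain ⟨U, W, φ, φinv, f, hU, hxU, hW, hφ, -, hφW, -, -, -, -, h9⟩ := hloc x hx.2
  refine ⟨(regularLevel (cotangentModel N) H E)ᶜ ∩ U, ?_, ?_⟩
  · refine mem_nhdsWithin.2 ⟨U, hU, hxU, fun y hy ↦ ⟨hy.2.1, hy.1⟩⟩
  · have hφa : AEMeasurable φ ((volume.restrict W).withDensity fun w ↦ ENNReal.ofReal (f w)) :=
      (hφ.continuousOn.aemeasurable hW.measurableSet).mono_ac (withDensity_absolutelyContinuous _ _)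
    rw [← Measure.restrict_apply hSm.compl, h9, Measure.map_apply_of_aemeasurable hφa hSm.compl]
    refine withDensity_absolutelyContinuous _ _ ?_
    rw [Measure.restrict_apply' hW.measurableSet]
    refine measure_mono_null (t := ∅) (fun w hw ↦ ?_) measure_empty
    exact hw.1 (hφW.le ⟨w, hw.2, rfl⟩).1

end LevelMeasure

end

theorem mainTheorem3 (N : ℕ) (M : Type*) [TopologicalSpace M] [T2Space M]
    [SecondCountableTopology M] [ChartedSpace (EuclideanSpace ℝ (Fin N)) M]
    [IsManifold (𝓡 N) ∞ M] [MeasurableSpace M] [BorelSpace M]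
    [RiemannianBundle (fun q : M ↦ TangentSpace (𝓡 N) q)]
    [IsContMDiffRiemannianBundle (𝓡 N) ∞ (EuclideanSpace ℝ (Fin N))
      (fun q : M ↦ TangentSpace (𝓡 N) q)]
    (V : M → ℝ) (hV : ContMDiff (𝓡 N) 𝓘(ℝ, ℝ) ∞ V) (E : ℝ) :
    -- `|Ω^N| = c_N dq dp` with `c_N = N!` in canonical coordinates
    (∀ x : CotangentBundle N M,
      ((liouvilleMeasure N M).restrict (extChartAt (cotangentModel N) x).source).map
          (extChartAt (cotangentModel N) x) =
        (N.factorial : ENNReal) •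
          (canonicalBasis N).addHaar.restrict (extChartAt (cotangentModel N) x).target) ∧
    -- `Φ` maps the part `p ≠ 0` of the level set bijectively onto the unit cosphere bundle
    Set.BijOn normalizeCovector (levelNonzero (N := N) V E) (cosphereBundle V E) ∧
    -- the Hamiltonian vector field exists and is unique
    (∃! Y : ∀ x : CotangentBundle N M, TangentSpace (cotangentModel N) x,
      IsHamiltonianVectorField (hamiltonian V) Y) ∧
    -- the induced measure exists and is unique
    (∃! ν : Measure (CotangentBundle N M),
      IsLevelMeasure (cotangentModel N) (liouvilleMeasure N M) (hamiltonian V) E ν) ∧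
    ∀ ν : Measure (CotangentBundle N M),
      IsLevelMeasure (cotangentModel N) (liouvilleMeasure N M) (hamiltonian V) E ν →
      -- the formula for its restriction to the part `p ≠ 0` of the level set
      ν.comap (fun x : levelNonzero (N := N) V E ↦ (x : CotangentBundle N M)) =
        ((cosphereBundleMeasure N M).comap
          (fun x : levelNonzero (N := N) V E ↦ normalizeCovector x.1)).withDensity
          (fun x ↦ ENNReal.ofReal ((N.factorial : ℝ) * (2 * (E - V x.1.proj)) ^ ((N : ℝ) / 2 - 1))) ∧
      -- it is a smooth measure on the regular part of the level set
      IsSmoothMeasureOn (cotangentModel N) (2 * N - 1)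
        (regularLevel (cotangentModel N) (hamiltonian (N := N) V) E) ν ∧
      -- it is invariant under the Hamiltonian flow
      ∀ Y : ∀ x : CotangentBundle N M, TangentSpace (cotangentModel N) x,
        IsHamiltonianVectorField (hamiltonian V) Y →
        IsInvariantUnderFlow (cotangentModel N) Y
          (regularLevel (cotangentModel N) (hamiltonian (N := N) V) E) ν := by
  have hH := contMDiff_hamiltonian (N := N) hV
  refine ⟨fun x ↦ map_restrict_liouvilleMeasure x, bijOn_normalizeCovector V E,
    existsUnique_isHamiltonianVectorField hH, existsUnique_isLevelMeasure hH E, fun ν hν ↦ ?_⟩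
  rw [isLevelMeasure_iff] at hν
  exact ⟨hν.comap_levelNonzero hV, hν.isSmoothMeasureOn hH, fun Y hY ↦
    isInvariantUnderFlow_of_isLevelMeasureOn ((N.factorial : ENNReal) • (canonicalBasis N).addHaar)
      liouvilleMeasure_apply modelHamiltonianMap_antisymm
      (isHamiltonianInCharts_of_isHamiltonianVectorField hH hY) hH hν⟩
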